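/- For a graph $G$, a vertex $v$ of $G$ and an integer $r\ge 1$, let $N_r^{(G)}(v)$ be the subgraph of $G$ induced by the vertices at distance at most $r$ from $v$. Two graphs $G$ and $H$ have isomorphic $r$-neighbourhoods if there is a bijection $\phi:V(G)\to V(H)$ such that, for each vertex $v$ of $G$, there is a graph isomorphism from $N_r^{(G)}(v)$ to $N_r^{(H)}(\phi(v))$ which maps $v$ to $\phi(v)$. The graph $G$ is reconstructible from its $r$-neighbourhoods if every graph $H$ such that $G$ and $H$ have isomorphic $r$-neighbourhoods is isomorphic to $G$. Let $\mathcal G(n,p)$ denote the random graph on $n$ labelled vertices in which each of the $\binom n2$ possible edges is present independently with probability $p$. Theorem. Let $p=p(n)\in[0,1]$ satisfy $p(n)=\omega(n^{-5/4})$ (that is, $p(n)\,n^{5/4}\to\infty$ as $n\to\infty$) and $p(n)\le \frac13 n^{-3/4}(\log n)^{1/4}$ for all sufficiently large $n$, where $\log$ is the natural logarithm. Then with high probability $G\in\mathcal G(n,p)$ is not reconstructible from its $2$-neighbourhoods, that is, $$\lim_{n\to\infty}\mathbb P\bigl(G\in\mathcal G(n,p(n))\text{ is not reconstructible from its 2-neighbourhoods}\bigr)=1.$$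 -/

import Mathlib

universe u

namespace Shotgun

variable {V W : Type u}

/-- The set of vertices at distance at most `r` from `v` in `G` (a vertex in another component is at
infinite distance from `v`). -/
def closedBall (G : SimpleGraph V) (r : ℕ) (v : V) : Set V :=
  {w | G.edist v w ≤ (r : ℕ∞)}

/-- Every vertex lies in the ball around itself. -/
theorem mem_closedBall_self (G : SimpleGraph V) (r : ℕ) (v : V) : v ∈ closedBall G r v := by
  simp [closedBall]

/-- The `r`-neighbourhood `N_r(v)`: the subgraph of `G` induced by the vertices at distance at
most `r` from `v`. -/
def nbhd (G : SimpleGraph V) (r : ℕ) (v : V) : SimpleGraph (closedBall G r v) :=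
  G.induce (closedBall G r v)

/-- The vertex `v` as the root of its `r`-neighbourhood. -/
def root (G : SimpleGraph V) (r : ℕ) (v : V) : closedBall G r v :=
  ⟨v, mem_closedBall_self G r v⟩

/-- `G` and `H` have isomorphic `r`-neighbourhoods: there is a bijection `φ` of the vertex sets and,
for each vertex `v` of `G`, an isomorphism `N_r(v) ≃ N_r(φ v)` which maps `v` to `φ v`. -/
def HaveIsomorphicNbhds (r : ℕ) (G : SimpleGraph V) (H : SimpleGraph W) : Prop :=
  ∃ φ : V ≃ W, ∀ v : V, ∃ e : nbhd G r v ≃g nbhd H r (φ v), e (root G r v) = root H r (φ v)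

/-- `G` is reconstructible from its `r`-neighbourhoods: every graph whose `r`-neighbourhoods are
isomorphic to those of `G` is isomorphic to `G`. -/
def Reconstructible (r : ℕ) (G : SimpleGraph V) : Prop :=
  ∀ (W : Type u) (H : SimpleGraph W), HaveIsomorphicNbhds r G H → Nonempty (G ≃g H)

end Shotgun

set_option linter.unusedSectionVars false

/-! Write d = np. A switch replaces two edges xy and uv by xv and uy. Suppose that the stars of x,
y, u, v are in general position (`StarPair`), that no further short path links {x, u} with {y, v}
(`NoShort`), and that deg x = deg u and deg y = deg v. Then the switch preserves every rooted 2-ball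
up to isomorphism, with the identity as bijection of the vertices (`haveIsomorphicNbhds_switch`). It
also preserves all degrees and all sums D(a) of the degrees of the neighbours of a, but it changes
the sum of D(a)D(b) over oriented edges ab by -2(D(x) - D(u))(D(y) - D(v)) (`edgeInvariant_switch`).
So one switchable pair with D(x) ≠ D(u) and D(y) ≠ D(v) shows that the graph is not reconstructible
(`not_reconstructible`). It remains to find such a pair with high probability.

For d ≤ (log n)/10 it comes from two components which are paths on five vertices: a switch turns
them into paths on four and six vertices. The expected number of such components is at least of
order n d⁴ exp(-5.5 d), which tends to infinity because n⁵p⁴ does. Two of them are equal as vertex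
sets or else disjoint and almost independent, so the second moment method applies
(`pr_reconstructible_le_sparse`).

For d ≥ (log n)/10 let Z be the expected number of quadruples whose stars allow a switch. It is at
least n²d/200: there are about n²d² pairs of oriented edges, and the two degree equalities cost a
factor of order 1/d (`le_pr_starEvent`). Given the stars, `NoShort` is a decreasing event in the
remaining edges, and Harris' inequality gives it probability at least γ = exp(-7d⁴/n)
(`le_pr_noShort`); the upper bound on p makes 1/γ at most n^(7/81). Given the stars, D(x) - D(u)
still contains an independent binomial variable with variance of order d², so a tie has probability
O(1/d) (`pr_degSum_eq_le`). By the Efron–Stein inequality the number of good quadruples has variance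
O(n³d⁵ + n²d⁹) (`variance_goodCount_le`), which is negligible against (γn²d)². If the graph is
reconstructible, every good quadruple has a tie. Chebyshev for the good quadruples and Markov for
the ties make this unlikely (`pr_reconstructible_le_dense`). -/

namespace Shotgun

open Finset

/-! ### Random subsets with independent elements: Efron–Stein, Harris, Markov, Chebyshev. -/

section ProductWeight

variable {ι : Type*} [DecidableEq ι] {p : ℝ} {s t : Finset ι} {e : ι} {f g : Finset ι → ℝ}

/-- The expectation of `f S`, where `S` is a random subset of `s` which contains each element
independently with probability `p`. -/
noncomputable def ex (p : ℝ) (s : Finset ι) (f : Finset ι → ℝ) : ℝ :=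
  ∑ S ∈ s.powerset, p ^ #S * (1 - p) ^ #(s \ S) * f S

open Classical in
/-- The probability of `P S`, where `S` is a random subset of `s` which contains each element
independently with probability `p`. -/
noncomputable def pr (p : ℝ) (s : Finset ι) (P : Finset ι → Prop) : ℝ :=
  ex p s fun S => if P S then 1 else 0

theorem ex_empty : ex p ∅ f = f ∅ := by simp [ex]

theorem ex_insert (he : e ∉ s) :
    ex p (insert e s) f = (1 - p) * ex p s f + p * ex p s fun S => f (insert e S) := by
  unfold ex
  rw [sum_powerset_insert he, mul_sum, mul_sum]
  congr 1 <;> refine sum_congr rfl fun S hS => ?_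
  · rw [insert_sdiff_of_notMem _ (fun h => he (mem_powerset.1 hS h)),
      card_insert_of_notMem (by simp [he])]
    ring
  · have heS : e ∉ S := fun h => he (mem_powerset.1 hS h)
    rw [card_insert_of_notMem heS, insert_sdiff_insert, sdiff_insert_of_notMem he]
    ring

theorem ex_congr (h : ∀ S ⊆ s, f S = g S) : ex p s f = ex p s g :=
  sum_congr rfl fun S hS => by rw [h S (mem_powerset.1 hS)]

theorem ex_mono (hp : 0 ≤ p) (hp1 : p ≤ 1) (h : ∀ S ⊆ s, f S ≤ g S) : ex p s f ≤ ex p s g :=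
  sum_le_sum fun S hS => mul_le_mul_of_nonneg_left (h S (mem_powerset.1 hS))
    (mul_nonneg (pow_nonneg hp _) (pow_nonneg (sub_nonneg.2 hp1) _))

theorem ex_add : (ex p s fun S => f S + g S) = ex p s f + ex p s g := by
  simp only [ex, mul_add, sum_add_distrib]

theorem ex_sub : (ex p s fun S => f S - g S) = ex p s f - ex p s g := by
  simp only [ex, mul_sub, sum_sub_distrib]

theorem ex_const_mul (c : ℝ) : (ex p s fun S => c * f S) = c * ex p s f := by
  simp only [ex, mul_sum]
  exact sum_congr rfl fun S _ => by ring

theorem ex_mul_const (c : ℝ) : (ex p s fun S => f S * c) = ex p s f * c := by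
  simp only [mul_comm _ c, ex_const_mul]

theorem ex_sum {κ : Type*} (K : Finset κ) (F : κ → Finset ι → ℝ) :
    (ex p s fun S => ∑ k ∈ K, F k S) = ∑ k ∈ K, ex p s (F k) := by
  simp only [ex, mul_sum]
  exact sum_comm

theorem ex_const (c : ℝ) : (ex p s fun _ => c) = c := by
  induction s using Finset.induction_on with
  | empty => exact ex_empty
  | insert e s he ih => rw [ex_insert he, ih]; ring

theorem ex_nonneg (hp : 0 ≤ p) (hp1 : p ≤ 1) (h : ∀ S ⊆ s, 0 ≤ f S) : 0 ≤ ex p s f := by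
  simpa [ex_const] using ex_mono (f := fun _ => 0) hp hp1 h

theorem ex_le_const (hp : 0 ≤ p) (hp1 : p ≤ 1) {c : ℝ} (h : ∀ S ⊆ s, f S ≤ c) :
    ex p s f ≤ c := by
  simpa [ex_const] using ex_mono (g := fun _ => c) hp hp1 h

theorem ex_union (hst : Disjoint s t) :
    ex p (s ∪ t) f = ex p s fun S => ex p t fun T => f (S ∪ T) := by
  induction s using Finset.induction_on generalizing f with
  | empty => simp [ex_empty]
  | insert e s he ih =>
    rw [disjoint_insert_left] at hst
    rw [insert_union, ex_insert (by simp [he, hst.1]), ex_insert he, ih hst.2, ih hst.2]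
    simp only [insert_union]

theorem ex_union_mul (hst : Disjoint s t) :
    (ex p (s ∪ t) fun S => f (S ∩ s) * g (S ∩ t)) = ex p s f * ex p t g := by
  rw [ex_union hst, ← ex_mul_const]
  refine ex_congr fun S hS => ?_
  rw [← ex_const_mul]
  refine ex_congr fun T hT => ?_
  rw [union_inter_distrib_right, union_inter_distrib_right, inter_eq_left.2 hS, inter_eq_left.2 hT,
    disjoint_iff_inter_eq_empty.1 (disjoint_of_subset_left hS hst),
    disjoint_iff_inter_eq_empty.1 (disjoint_of_subset_left hT hst.symm), union_empty, empty_union]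

/-- The average of a random variable squared dominates the square of its average. -/
theorem sq_ex_le (hp : 0 ≤ p) (hp1 : p ≤ 1) : ex p s f ^ 2 ≤ ex p s fun S => f S ^ 2 := by
  have h := ex_nonneg (s := s) (f := fun S => (f S - ex p s f) ^ 2) hp hp1 fun S _ => sq_nonneg _
  have h2 : (ex p s fun S => (f S - ex p s f) ^ 2) = (ex p s fun S => f S ^ 2) - ex p s f ^ 2 := by
    have : ∀ S, (f S - ex p s f) ^ 2 = f S ^ 2 - 2 * ex p s f * f S + ex p s f ^ 2 :=
      fun S => by ring
    simp only [this]
    rw [ex_add, ex_sub, ex_const_mul, ex_const]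
    ring
  linarith

/-- The Efron–Stein inequality. -/
theorem efron_stein (hp : 0 ≤ p) (hp1 : p ≤ 1) :
    (ex p s fun S => f S ^ 2) - ex p s f ^ 2 ≤
      ex p s fun S => ∑ e ∈ S, (f S - f (S.erase e)) ^ 2 := by
  induction s using Finset.induction_on generalizing f with
  | empty => simp [ex_empty]
  | insert a s ha ih =>
    rw [ex_insert ha, ex_insert ha, ex_insert ha]
    have h0 := ih (f := f)
    have h1 := ih (f := fun S => f (insert a S))
    have hj := sq_ex_le (s := s) (f := fun S => f (insert a S) - f S) hp hp1
    rw [ex_sub] at hj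
    have h2 : (ex p s fun S => ∑ e ∈ insert a S, (f (insert a S) - f ((insert a S).erase e)) ^ 2) =
        (ex p s fun S => (f (insert a S) - f S) ^ 2) +
          ex p s fun S => ∑ e ∈ S, (f (insert a S) - f (insert a (S.erase e))) ^ 2 := by
      rw [← ex_add]
      refine ex_congr fun S hS => ?_
      have haS : a ∉ S := fun h => ha (hS h)
      rw [sum_insert haS, erase_insert haS]
      congr 1
      refine sum_congr rfl fun e he => ?_
      rw [erase_insert_of_ne (by rintro rfl; exact haS he)]
    rw [h2]
    set A := ex p s f
    set B := ex p s fun S => f (insert a S)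
    have hq : 0 ≤ 1 - p := sub_nonneg.2 hp1
    have e1 := mul_le_mul_of_nonneg_left h0 hq
    have e2 := mul_le_mul_of_nonneg_left h1 hp
    have e3 := mul_le_mul_of_nonneg_left hj hp
    -- The variance splits as (1 - p) Var f₀ + p Var f₁ + p(1 - p)(B - A)². Since only elements of S
    -- are erased, the right side offers p(B - A)², and `e4` is the slack.
    have e4 : 0 ≤ p * p * (B - A) ^ 2 := by positivity
    nlinarith

/-- Harris' inequality for two decreasing functions. -/
theorem harris (hp : 0 ≤ p) (hp1 : p ≤ 1) (hf : Antitone f) (hg : Antitone g) :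
    ex p s f * ex p s g ≤ ex p s fun S => f S * g S := by
  induction s using Finset.induction_on generalizing f g with
  | empty => simp [ex_empty]
  | insert a s ha ih =>
    rw [ex_insert ha, ex_insert ha, ex_insert ha]
    have h0 := ih hf hg
    have h1 := ih (f := fun S => f (insert a S)) (g := fun S => g (insert a S))
      (fun S T h => hf (insert_subset_insert a h)) (fun S T h => hg (insert_subset_insert a h))
    have hF : (ex p s fun S => f (insert a S)) ≤ ex p s f :=
      ex_mono hp hp1 fun S _ => hf (subset_insert a S)
    have hG : (ex p s fun S => g (insert a S)) ≤ ex p s g :=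
      ex_mono hp hp1 fun S _ => hg (subset_insert a S)
    have hq : 0 ≤ 1 - p := sub_nonneg.2 hp1
    have e1 := mul_le_mul_of_nonneg_left h0 hq
    have e2 := mul_le_mul_of_nonneg_left h1 hp
    -- The covariance of the two conditional means is p(1 - p) times the product of their drops, and
    -- both drops are nonnegative.
    have e3 := mul_nonneg (mul_nonneg hp hq) (mul_nonneg (sub_nonneg.2 hF) (sub_nonneg.2 hG))
    nlinarith

variable {P Q : Finset ι → Prop}

theorem pr_nonneg (hp : 0 ≤ p) (hp1 : p ≤ 1) : 0 ≤ pr p s P :=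
  ex_nonneg hp hp1 fun S _ => by split_ifs <;> simp

theorem pr_mono (hp : 0 ≤ p) (hp1 : p ≤ 1) (h : ∀ S ⊆ s, P S → Q S) : pr p s P ≤ pr p s Q :=
  ex_mono hp hp1 fun S hS => by
    by_cases hP : P S
    · simp [hP, h S hS hP]
    · simp only [hP, if_false]; split_ifs <;> simp

theorem pr_congr (h : ∀ S ⊆ s, P S ↔ Q S) : pr p s P = pr p s Q := by
  refine ex_congr fun S hS => ?_
  by_cases hQ : Q S
  · simp [hQ, (h S hS).2 hQ]
  · simp [hQ, mt (h S hS).1 hQ]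

theorem pr_le_add (hp : 0 ≤ p) (hp1 : p ≤ 1) {R : Finset ι → Prop}
    (h : ∀ S ⊆ s, P S → Q S ∨ R S) : pr p s P ≤ pr p s Q + pr p s R := by
  unfold pr
  rw [← ex_add]
  refine ex_mono hp hp1 fun S hS => ?_
  by_cases hP : P S
  · rcases h S hS hP with hQ | hR
    · by_cases hR : R S <;> simp [hP, hQ, hR]
    · by_cases hQ : Q S <;> simp [hP, hQ, hR]
  · by_cases hQ : Q S <;> by_cases hR : R S <;> simp [hP, hQ, hR]

theorem pr_le_sum (hp : 0 ≤ p) (hp1 : p ≤ 1) {κ : Type*} (K : Finset κ) (R : κ → Finset ι → Prop)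
    (h : ∀ S ⊆ s, P S → ∃ k ∈ K, R k S) : pr p s P ≤ ∑ k ∈ K, pr p s (R k) := by
  classical
  unfold pr
  rw [← ex_sum]
  refine ex_mono hp hp1 fun S hS => ?_
  split_ifs with hP
  · obtain ⟨k, hk, hR⟩ := h S hS hP
    refine le_trans (by simp [hR]) (single_le_sum (f := fun k => if R k S then (1 : ℝ) else 0)
      (fun i _ => by split_ifs <;> simp) hk)
  · exact sum_nonneg fun i _ => by split_ifs <;> simp

theorem pr_not : pr p s (fun S => ¬ P S) = 1 - pr p s P := by
  classical
  have h := ex_sub (p := p) (s := s) (f := fun _ => 1) (g := fun S => if P S then 1 else 0)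
  rw [ex_const] at h
  rw [pr, pr, ← h]
  exact ex_congr fun S _ => by by_cases h : P S <;> simp [h]

theorem pr_true : pr p s (fun _ => True) = 1 := by simp [pr, ex_const]

theorem pr_union (hst : Disjoint s t) :
    pr p (s ∪ t) P = ex p s fun S => pr p t fun T => P (S ∪ T) :=
  ex_union hst

theorem pr_union_mul (hst : Disjoint s t) :
    (pr p (s ∪ t) fun S => P (S ∩ s) ∧ Q (S ∩ t)) = pr p s P * pr p t Q := by
  unfold pr
  rw [← ex_union_mul hst]
  refine ex_congr fun S _ => ?_
  by_cases h : P (S ∩ s) <;> by_cases h' : Q (S ∩ t) <;> simp [h, h']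

/-- Markov's inequality. -/
theorem markov (hp : 0 ≤ p) (hp1 : p ≤ 1) (hf : ∀ S ⊆ s, 0 ≤ f S) (c : ℝ) :
    c * pr p s (fun S => c ≤ f S) ≤ ex p s f := by
  unfold pr
  rw [← ex_const_mul]
  refine ex_mono hp hp1 fun S hS => ?_
  split_ifs with h
  · simpa using h
  · simpa using hf S hS

/-- Chebyshev's inequality. -/
theorem chebyshev (hp : 0 ≤ p) (hp1 : p ≤ 1) {c : ℝ} (hc : 0 ≤ c) :
    c ^ 2 * pr p s (fun S => c ≤ |f S - ex p s f|) ≤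
      (ex p s fun S => f S ^ 2) - ex p s f ^ 2 := by
  have h := markov (s := s) (f := fun S => (f S - ex p s f) ^ 2) hp hp1 (fun S _ => sq_nonneg _)
    (c ^ 2)
  have h2 : (ex p s fun S => (f S - ex p s f) ^ 2) = (ex p s fun S => f S ^ 2) - ex p s f ^ 2 := by
    have : ∀ S, (f S - ex p s f) ^ 2 = f S ^ 2 - 2 * ex p s f * f S + ex p s f ^ 2 :=
      fun S => by ring
    simp only [this]
    rw [ex_add, ex_sub, ex_const_mul, ex_const]
    ring
  rw [h2] at h
  refine le_trans (le_of_eq ?_) h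
  congr 1
  refine pr_congr fun S _ => ?_
  rw [← sq_abs (f S - _), sq_le_sq₀ hc (abs_nonneg _)]

theorem pr_subset {T : Finset ι} (hT : T ⊆ s) : pr p s (fun S => T ⊆ S) = p ^ #T := by
  rw [← union_sdiff_of_subset hT, pr_union disjoint_sdiff]
  have h0 : ∀ {U : Finset ι}, (pr p U fun S => U ⊆ S) = p ^ #U := by
    intro U
    unfold pr ex
    rw [sum_eq_single_of_mem U (by simp)]
    · simp
    · intro S hS hne
      have : ¬ U ⊆ S := fun h => hne (Subset.antisymm (mem_powerset.1 hS) h)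
      simp [this]
  rw [← h0]
  refine ex_congr fun S hS => ?_
  have : ∀ U ⊆ s \ T, (T ⊆ S ∪ U ↔ T ⊆ S) := by
    intro U hU
    refine ⟨fun h x hx => ?_, fun h => h.trans subset_union_left⟩
    rcases mem_union.1 (h hx) with h | h
    · exact h
    · exact absurd hx (mem_sdiff.1 (hU h)).2
  rw [pr_congr this]
  by_cases h : T ⊆ S <;> simp [h, pr, ex_const]

theorem pr_subset_disjoint {T U : Finset ι} (hT : T ⊆ s) (hU : U ⊆ s) (hTU : Disjoint T U) :
    pr p s (fun S => T ⊆ S ∧ Disjoint S U) = p ^ #T * (1 - p) ^ #U := by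
  have hs : s = (s \ U) ∪ U := (sdiff_union_of_subset hU).symm
  have h0 : (pr p U fun S => S = ∅) = (1 - p) ^ #U := by
    unfold pr ex
    rw [sum_eq_single_of_mem ∅ (by simp)]
    · simp
    · intro S hS hne
      simp [hne]
  have h1 : T ⊆ s \ U := subset_sdiff.2 ⟨hT, hTU⟩
  rw [← pr_subset h1, ← h0, ← pr_union_mul sdiff_disjoint, ← hs]
  refine pr_congr fun S hS => ?_
  rw [← disjoint_iff_inter_eq_empty]
  refine and_congr_left fun hd => ?_
  rw [subset_inter_iff]
  exact ⟨fun h => ⟨h, h1⟩, fun h => h.1⟩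

/-- Avoiding each T k is a decreasing event, so by Harris' inequality these events are positively
correlated, however much the sets overlap. -/
theorem prod_le_pr_forall_not_subset (hp : 0 ≤ p) (hp1 : p ≤ 1) {κ : Type*} (K : Finset κ)
    (T : κ → Finset ι) (hT : ∀ k ∈ K, T k ⊆ s) :
    ∏ k ∈ K, (1 - p ^ #(T k)) ≤ pr p s fun S => ∀ k ∈ K, ¬ T k ⊆ S := by
  classical
  induction K using Finset.induction_on with
  | empty => simp [pr_true]
  | insert a K ha ih =>
    rw [prod_insert ha]
    have hanti : ∀ (P : Finset ι → Prop), (∀ S T, S ⊆ T → P T → P S) →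
        Antitone fun S => if P S then (1 : ℝ) else 0 := by
      intro P hP S T h
      dsimp only
      by_cases hT : P T
      · simp [hT, hP S T h hT]
      · simp only [hT, if_false]; split_ifs <;> simp
    have h1 := harris (s := s) hp hp1 (hanti (fun S => ¬ T a ⊆ S) fun S U h h' h'' => h' (h''.trans h))
      (hanti (fun S => ∀ k ∈ K, ¬ T k ⊆ S) fun S U h h' k hk h'' => h' k hk (h''.trans h))
    have h2 : (1 - p ^ #(T a)) = pr p s fun S => ¬ T a ⊆ S := by
      rw [pr_not, pr_subset (hT a (mem_insert_self a K))]
    have h3 := ih fun k hk => hT k (mem_insert_of_mem hk)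
    have h4 : 0 ≤ 1 - p ^ #(T a) := sub_nonneg.2 (pow_le_one₀ hp hp1)
    calc _ ≤ (1 - p ^ #(T a)) * pr p s fun S => ∀ k ∈ K, ¬ T k ⊆ S :=
          mul_le_mul_of_nonneg_left h3 h4
      _ ≤ _ := by
        rw [h2]
        unfold pr
        convert h1 using 2
        funext S
        by_cases h : T a ⊆ S <;> simp [h]

end ProductWeight

end Shotgun

namespace Shotgun

open Finset

/-! ### Concentration, anticoncentration and collisions of binomial variables. -/

section Binomial

variable {ι : Type*} [DecidableEq ι] {p : ℝ} {s t : Finset ι} {e : ι} {f g : Finset ι → ℝ}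

theorem ex_comp_card (g : ℕ → ℝ) :
    (ex p s fun S => g #S) =
      ∑ j ∈ range (#s + 1), (#s).choose j * (p ^ j * (1 - p) ^ (#s - j) * g j) := by
  unfold ex
  have h := sum_powerset_apply_card (fun j => p ^ j * (1 - p) ^ (#s - j) * g j) (x := s)
  rw [sum_congr rfl fun j _ => nsmul_eq_mul _ _] at h
  rw [← h]
  exact sum_congr rfl fun S hS => by rw [card_sdiff_of_subset (mem_powerset.1 hS)]

theorem ex_card : (ex p s fun S => (#S : ℝ)) = #s * p := by
  induction s using Finset.induction_on with
  | empty => simp [ex_empty]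
  | insert a s ha ih =>
    rw [ex_insert ha, ih, card_insert_of_notMem ha]
    have : (ex p s fun S => (#(insert a S) : ℝ)) = ex p s fun S => (#S : ℝ) + 1 :=
      ex_congr fun S hS => by rw [card_insert_of_notMem fun h => ha (hS h)]; push_cast; ring
    rw [this, ex_add, ih, ex_const]
    push_cast
    ring

/-- A binomial random variable is rarely far from its mean. -/
theorem pr_far_card_le (hp : 0 ≤ p) (hp1 : p ≤ 1) (hs : 0 < #s * p) :
    pr p s (fun S => 2 * √(#s * p) ≤ |(#S : ℝ) - #s * p|) ≤ 1 / 4 := by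
  have h := chebyshev (s := s) (f := fun S => (#S : ℝ)) hp hp1
    (c := 2 * √(#s * p)) (by positivity)
  have h2 := efron_stein (s := s) (f := fun S => (#S : ℝ)) hp hp1
  have h3 : (ex p s fun S => ∑ e ∈ S, ((#S : ℝ) - #(S.erase e)) ^ 2) = #s * p := by
    rw [← ex_card]
    refine ex_congr fun S _ => ?_
    have : ∀ e ∈ S, ((#S : ℝ) - #(S.erase e)) ^ 2 = 1 := fun e he => by
      have := card_erase_add_one he
      rw [← this]; push_cast; ring
    rw [sum_congr rfl this]
    simp
  rw [h3] at h2
  simp only [ex_card] at h h2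
  rw [mul_pow, Real.sq_sqrt hs.le] at h
  have h4 := h.trans h2
  set P := pr p s fun S => 2 * √(#s * p) ≤ |(#S : ℝ) - #s * p|
  have : #s * p * (4 * P) ≤ #s * p * 1 := by linarith
  have := le_of_mul_le_mul_left this hs
  linarith

/-- Two-round exposure: first keep elements with probability a, then keep the survivors with
probability b. It reduces anticoncentration for general p to the case of probability 1/2. -/
theorem ex_mul_thin (a b : ℝ) : ex (a * b) s f = ex a s fun M => ex b M f := by
  induction s using Finset.induction_on generalizing f with
  | empty => simp [ex_empty]
  | insert e s he ih =>
    rw [ex_insert he, ex_insert he, ih, ih]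
    have : (ex a s fun S => ex b (insert e S) f) =
        (1 - b) * (ex a s fun M => ex b M f) +
          b * ex a s fun M => ex b M fun S => f (insert e S) := by
      rw [← ex_const_mul, ← ex_const_mul, ← ex_add]
      exact ex_congr fun S hS => ex_insert fun h => he (hS h)
    rw [this]
    ring

/-- The induction rests on (2n + 3)(2n + 1) ≤ 4(n + 1)². -/
theorem centralBinom_sq_le (n : ℕ) : (2 * n + 1) * n.centralBinom ^ 2 ≤ 16 ^ n := by
  induction n with
  | zero => simp
  | succ n ih =>
    have h := Nat.succ_mul_centralBinom_succ n
    have h2 : (n + 1) ^ 2 * ((2 * (n + 1) + 1) * (n + 1).centralBinom ^ 2) ≤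
        (n + 1) ^ 2 * 16 ^ (n + 1) := by
      calc _ = (2 * n + 3) * ((n + 1) * (n + 1).centralBinom) ^ 2 := by ring
        _ = 4 * (2 * n + 3) * (2 * n + 1) * ((2 * n + 1) * n.centralBinom ^ 2) := by
          rw [h]; ring
        _ ≤ 4 * (2 * n + 3) * (2 * n + 1) * 16 ^ n := Nat.mul_le_mul_left _ ih
        _ ≤ (16 * (n + 1) ^ 2) * 16 ^ n := Nat.mul_le_mul_right _ (by nlinarith)
        _ = _ := by ring
    exact Nat.le_of_mul_le_mul_left h2 (by positivity)

/-- Only the middle coefficient matters. For odd m = 2k + 1 it is half of the central coefficient of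
2k + 2. -/
theorem choose_sq_le (m j : ℕ) : (m + 1) * m.choose j ^ 2 ≤ 4 ^ m := by
  have h0 := Nat.choose_le_middle j m
  have h1 : (m + 1) * m.choose j ^ 2 ≤ (m + 1) * m.choose (m / 2) ^ 2 := by gcongr
  refine h1.trans ?_
  rcases Nat.even_or_odd' m with ⟨k, rfl | rfl⟩
  · have := centralBinom_sq_le k
    rw [Nat.centralBinom_eq_two_mul_choose] at this
    rw [Nat.mul_div_cancel_left k two_pos, pow_mul]
    exact this
  · have h2 : (2 * k + 1) / 2 = k := by omega
    rw [h2]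
    have h3 := centralBinom_sq_le (k + 1)
    rw [Nat.centralBinom_eq_two_mul_choose] at h3
    have h4 : (2 * (k + 1)).choose (k + 1) = 2 * (2 * k + 1).choose k := by
      rw [show 2 * (k + 1) = (2 * k + 1) + 1 by ring, Nat.choose_succ_succ,
        ← Nat.choose_symm_half k]
      ring
    rw [h4] at h3
    have : 4 ^ (2 * k + 1) * 4 = 16 ^ (k + 1) := by
      rw [show (16 : ℕ) = 4 ^ 2 by norm_num, ← pow_mul]; ring
    nlinarith

theorem pr_card_eq (j : ℕ) :
    pr p s (fun S => #S = j) = (#s).choose j * (p ^ j * (1 - p) ^ (#s - j)) := by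
  have h := ex_comp_card (p := p) (s := s) fun i => if i = j then (1 : ℝ) else 0
  have h0 : pr p s (fun S => #S = j) = ex p s fun S => if #S = j then 1 else 0 := by
    unfold pr
    exact ex_congr fun S _ => by by_cases h : #S = j <;> simp [h]
  rw [h0, h]
  by_cases hj : j ∈ range (#s + 1)
  · rw [sum_eq_single_of_mem j hj (fun i _ hi => by simp [hi])]
    simp
  · rw [sum_eq_zero fun i hi => ?_, Nat.choose_eq_zero_of_lt]
    · simp
    · simpa using hj
    · have : i ≠ j := fun h => hj (h ▸ hi)
      simp [this]

theorem pr_half_card_eq_sq_le (j : ℕ) :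
    pr (1 / 2) s (fun S => #S = j) ^ 2 ≤ 1 / (#s + 1) := by
  have h : pr (1 / 2) s (fun S => #S = j) = (#s).choose j / 2 ^ #s := by
    rw [pr_card_eq]
    rcases le_or_gt j #s with hj | hj
    · have : (1 - 1 / 2 : ℝ) = 1 / 2 := by norm_num
      rw [this, ← pow_add, Nat.add_sub_cancel' hj]
      simp [div_eq_mul_inv]
    · simp [Nat.choose_eq_zero_of_lt hj]
  rw [h, div_pow, ← pow_mul, mul_comm, pow_mul, div_le_div_iff₀ (by positivity) (by positivity)]
  have := choose_sq_le #s j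
  have h' : ((#s : ℝ) + 1) * ((#s).choose j : ℝ) ^ 2 ≤ 4 ^ #s := by exact_mod_cast this
  norm_num
  linarith

/-- Absorbing 1/(j + 1) into the binomial coefficient shifts the sum to a binomial expansion of
exponent #s + 1 without its zeroth term. -/
theorem ex_inv_card_le {a : ℝ} (ha : 0 ≤ a) (ha1 : a ≤ 1) :
    (#s * a) * (ex a s fun S => 1 / ((#S : ℝ) + 1)) ≤ 1 := by
  have h0 : (#s * a) * (ex a s fun S => 1 / ((#S : ℝ) + 1)) ≤
      ((#s + 1) * a) * (ex a s fun S => 1 / ((#S : ℝ) + 1)) := by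
    refine mul_le_mul_of_nonneg_right ?_ (ex_nonneg ha ha1 fun S _ => by positivity)
    nlinarith
  refine h0.trans ?_
  rw [ex_comp_card fun i => 1 / ((i : ℝ) + 1)]
  have h1 : (1 : ℝ) = (a + (1 - a)) ^ (#s + 1) := by simp
  rw [add_pow, sum_range_succ'] at h1
  rw [mul_sum]
  have h2 : ∀ j ∈ range (#s + 1), (((#s : ℝ) + 1) * a) *
      ((#s).choose j * (a ^ j * (1 - a) ^ (#s - j) * (1 / ((j : ℝ) + 1)))) =
      a ^ (j + 1) * (1 - a) ^ (#s + 1 - (j + 1)) * (#s + 1).choose (j + 1) := by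
    intro j _
    have := Nat.add_one_mul_choose_eq #s j
    have h3 : ((#s : ℝ) + 1) * (#s).choose j = (#s + 1).choose (j + 1) * (j + 1) := by
      exact_mod_cast this
    rw [Nat.add_sub_add_right]
    have hj : (j : ℝ) + 1 ≠ 0 := by positivity
    field_simp
    linear_combination (a ^ j * (1 - a) ^ (#s - j) * a) * h3
  rw [sum_congr rfl h2]
  have : 0 ≤ 1 - a := sub_nonneg.2 ha1
  have h5 : 0 ≤ a ^ 0 * (1 - a) ^ (#s + 1 - 0) * ((#s + 1).choose 0 : ℝ) := by positivity
  linarith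

/-- Each value of a binomial random variable has small probability. -/
theorem pr_card_eq_sq_le (hp : 0 ≤ p) (hp1 : p ≤ 1 / 2) (j : ℕ) :
    (2 * (#s * p)) * pr p s (fun S => #S = j) ^ 2 ≤ 1 := by
  have ha : 0 ≤ 2 * p := by linarith
  have ha1 : 2 * p ≤ 1 := by linarith
  -- Thinning at rate 2p and then at rate 1/2. Jensen moves the square inside, each fair point
  -- probability squared is at most 1/(#M + 1), and the mean of that is at most 1/(2p #s).
  have h1 : pr p s (fun S => #S = j) = ex (2 * p) s fun M => pr (1 / 2) M fun S => #S = j := by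
    unfold pr
    rw [← ex_mul_thin]
    congr 1
    ring
  have h2 := sq_ex_le (s := s) (f := fun M => pr (1 / 2) M fun S => #S = j) ha ha1
  have h3 := h2.trans (ex_mono (s := s) ha ha1 fun M _ => pr_half_card_eq_sq_le (s := M) j)
  have h4 := ex_inv_card_le (s := s) ha ha1
  rw [← h1] at h3
  have := mul_le_mul_of_nonneg_left h3 (by positivity : 0 ≤ 2 * (#s * p))
  nlinarith

/-- Two independent binomial random variables collide near their mean with probability of the order
of the inverse of the standard deviation. -/
theorem le_pr_card_eq_card (hp : 0 ≤ p) (hp1 : p ≤ 1) (hst : Disjoint s t) (hc : #s = #t)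
    (hs : 0 < #s * p) :
    9 / 16 / (4 * √(#s * p) + 1) ≤ pr p (s ∪ t) fun S =>
      #(S ∩ s) = #(S ∩ t) ∧ |(#(S ∩ s) : ℝ) - #s * p| < 2 * √(#s * p) := by
  classical
  set w := √(#s * p)
  have hw : 0 < w := Real.sqrt_pos.2 hs
  set W := (range (#s + 1)).filter fun k : ℕ => |(k : ℝ) - #s * p| < 2 * w
  -- An interval of length 4w contains at most 4w + 1 integers.
  have hW : (#W : ℝ) ≤ 4 * w + 1 := by
    have hsub : W ⊆ Icc ⌈#s * p - 2 * w⌉₊ ⌊#s * p + 2 * w⌋₊ := by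
      intro k hk
      have := abs_lt.1 (mem_filter.1 hk).2
      rw [mem_Icc]
      exact ⟨Nat.ceil_le.2 (by linarith), Nat.le_floor (by linarith)⟩
    have h1 := card_le_card hsub
    rw [Nat.card_Icc] at h1
    have h2 : (⌊#s * p + 2 * w⌋₊ : ℝ) ≤ #s * p + 2 * w := Nat.floor_le (by positivity)
    have h3 : #s * p - 2 * w ≤ (⌈#s * p - 2 * w⌉₊ : ℝ) := Nat.le_ceil _
    rcases Nat.eq_zero_or_pos #W with h0 | h0
    · rw [h0]; push_cast; positivity
    · have h4 : #W + ⌈#s * p - 2 * w⌉₊ ≤ ⌊#s * p + 2 * w⌋₊ + 1 := by omega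
      have h5 : (#W : ℝ) + ⌈#s * p - 2 * w⌉₊ ≤ ⌊#s * p + 2 * w⌋₊ + 1 := by exact_mod_cast h4
      linarith
  have hmass : 3 / 4 ≤ ∑ k ∈ W, pr p s fun S => #S = k := by
    have h1 := pr_far_card_le hp hp1 hs
    have h2 : 1 - (pr p s fun S => 2 * w ≤ |(#S : ℝ) - #s * p|) =
        pr p s fun S => ¬ 2 * w ≤ |(#S : ℝ) - #s * p| := pr_not.symm
    have h3 : (pr p s fun S => ¬ 2 * w ≤ |(#S : ℝ) - #s * p|) ≤ ∑ k ∈ W, pr p s fun S => #S = k := by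
      refine pr_le_sum hp hp1 _ _ fun S hS h => ⟨#S, ?_, rfl⟩
      rw [mem_filter, mem_range, Nat.lt_succ_iff]
      exact ⟨card_le_card hS, not_le.1 h⟩
    linarith
  have hsame : ∀ k, (pr p t fun S => #S = k) = pr p s fun S => #S = k := by
    intro k
    rw [pr_card_eq, pr_card_eq, hc]
  have hsum : ∑ k ∈ W, (pr p s fun S => #S = k) ^ 2 ≤ pr p (s ∪ t) fun S =>
      #(S ∩ s) = #(S ∩ t) ∧ |(#(S ∩ s) : ℝ) - #s * p| < 2 * w := by
    have h1 : ∀ k ∈ W, (pr p s fun S => #S = k) ^ 2 =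
        pr p (s ∪ t) fun S => #(S ∩ s) = k ∧ #(S ∩ t) = k := by
      intro k _
      rw [sq, pr_union_mul hst (P := fun S => #S = k) (Q := fun S => #S = k), hsame]
    rw [sum_congr rfl h1]
    unfold pr
    rw [← ex_sum]
    refine ex_mono hp hp1 fun S _ => ?_
    by_cases h : ∃ k ∈ W, #(S ∩ s) = k ∧ #(S ∩ t) = k
    · obtain ⟨k, hk, h2, h3⟩ := h
      rw [sum_eq_single_of_mem k hk (fun i _ hi => by simp [h2, hi.symm])]
      have := (mem_filter.1 hk).2
      simp [h2, h3, this]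
    · push Not at h
      rw [sum_eq_zero fun k hk => ?_]
      · split_ifs <;> simp
      · have := h k hk
        simpa using this
  -- Cauchy–Schwarz: a mass of at least 3/4 on #W values has square sum at least (9/16)/#W, and this
  -- square sum is the probability that the two variables collide inside the window.
  have hcs := sq_sum_le_card_mul_sum_sq (s := W) (f := fun k => pr p s fun S => #S = k)
  have h9 : (9 / 16 : ℝ) ≤ (∑ k ∈ W, pr p s fun S => #S = k) ^ 2 := by nlinarith
  rw [div_le_iff₀ (by positivity)]
  have hpos : 0 ≤ ∑ k ∈ W, (pr p s fun S => #S = k) ^ 2 := sum_nonneg fun _ _ => sq_nonneg _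
  nlinarith

end Binomial

end Shotgun

namespace Shotgun

open Finset

/-! ### The switch preserves the rooted 2-neighbourhoods. -/

section Switch

variable {V : Type u} {G H : SimpleGraph V} {x y u v w z : V}

theorem mem_closedBall_two :
    z ∈ closedBall G 2 w ↔ z = w ∨ G.Adj w z ∨ ∃ c, G.Adj w c ∧ G.Adj c z := by
  unfold closedBall
  constructor
  · intro h
    have h' : G.edist w z ≤ (2 : ℕ) := h
    have hne : G.edist w z ≠ ⊤ := fun ht => by rw [ht] at h'; exact absurd h' (by simp)
    obtain ⟨q, hq⟩ := SimpleGraph.exists_walk_of_edist_ne_top hne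
    rw [← hq] at h'
    have hl : q.length ≤ 2 := by exact_mod_cast h'
    match q, hl with
    | .nil, _ => exact Or.inl rfl
    | .cons h .nil, _ => exact Or.inr (Or.inl h)
    | .cons h (.cons h2 .nil), _ => exact Or.inr (Or.inr ⟨_, h, h2⟩)
    | .cons h (.cons h2 (.cons h3 q)), hl => simp at hl
  · have key : ∀ q : G.Walk w z, q.length ≤ 2 → G.edist w z ≤ (2 : ℕ) := fun q hq =>
      q.edist_le.trans (by exact_mod_cast hq)
    rintro (rfl | h | ⟨c, h, h2⟩)
    · exact key .nil (by simp)
    · exact key (.cons h .nil) (by simp)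
    · exact key (.cons h (.cons h2 .nil)) (by simp)

/-- A permutation which fixes `w` and respects the balls around `w` gives an isomorphism of rooted
neighbourhoods. -/
theorem exists_nbhd_iso (σ : Equiv.Perm V) (hw : σ w = w)
    (hball : ∀ z, z ∈ closedBall G 2 w ↔ σ z ∈ closedBall H 2 w)
    (hadj : ∀ z ∈ closedBall G 2 w, ∀ z' ∈ closedBall G 2 w, G.Adj z z' ↔ H.Adj (σ z) (σ z')) :
    ∃ e : nbhd G 2 w ≃g nbhd H 2 w, e (root G 2 w) = root H 2 w := by
  refine ⟨⟨σ.subtypeEquiv hball, ?_⟩, ?_⟩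
  · rintro ⟨a, ha⟩ ⟨b, hb⟩
    exact (hadj a ha b hb).symm
  · exact Subtype.ext hw

/-- The edges `xy` and `uv` are far enough from each other for a switch, as far as the stars of
`x`, `y`, `u`, `v` can tell. -/
structure StarPair [Fintype V] (G : SimpleGraph V) (x y u v : V) : Prop where
  xy : G.Adj x y
  uv : G.Adj u v
  ne_xu : x ≠ u
  ne_yv : y ≠ v
  nxu : ¬ G.Adj x u
  nxv : ¬ G.Adj x v
  nyu : ¬ G.Adj y u
  nyv : ¬ G.Adj y v
  cxy : ∀ b, G.Adj x b → ¬ G.Adj y b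
  cxu : ∀ b, G.Adj x b → ¬ G.Adj u b
  cxv : ∀ b, G.Adj x b → ¬ G.Adj v b
  cyu : ∀ b, G.Adj y b → ¬ G.Adj u b
  cyv : ∀ b, G.Adj y b → ¬ G.Adj v b
  cuv : ∀ b, G.Adj u b → ¬ G.Adj v b

/-- The vertices next to one of the two vertices `x` and `u`, apart from `y` and `v`. -/
def Side (G : SimpleGraph V) (x y u v a : V) : Prop :=
  (G.Adj x a ∧ a ≠ y) ∨ (G.Adj u a ∧ a ≠ v)

/-- Apart from the edges `xy` and `uv` there is no path of length at most `4` between `{x, u}` and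
`{y, v}`, and no triangle at one of these vertices. -/
structure NoShort (G : SimpleGraph V) (x y u v : V) : Prop where
  side : ∀ a a', Side G x y u v a → Side G x y u v a' → ¬ G.Adj a a'
  side' : ∀ a a', Side G y x v u a → Side G y x v u a' → ¬ G.Adj a a'
  cross : ∀ a c, Side G x y u v a → Side G y x v u c → ¬ G.Adj a c
  path : ∀ a b c, Side G x y u v a → Side G y x v u c → G.Adj a b → ¬ G.Adj b c

/-- The graph where the edges `xy` and `uv` are replaced by `xv` and `uy`. -/
def switch (G : SimpleGraph V) (x y u v : V) : SimpleGraph V :=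
  SimpleGraph.fromEdgeSet ((G.edgeSet \ {s(x, y), s(u, v)}) ∪ {s(x, v), s(u, y)})

theorem switch_adj (hxv : x ≠ v) (huy : u ≠ y) (a b : V) : (switch G x y u v).Adj a b ↔
    (G.Adj a b ∧ ¬ ((a = x ∧ b = y) ∨ (a = y ∧ b = x) ∨ (a = u ∧ b = v) ∨ (a = v ∧ b = u))) ∨
      ((a = x ∧ b = v) ∨ (a = v ∧ b = x) ∨ (a = u ∧ b = y) ∨ (a = y ∧ b = u)) := by
  have := G.ne_of_adj (a := a) (b := b)
  simp only [switch, SimpleGraph.fromEdgeSet_adj, Set.mem_union, Set.mem_sdiff,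
    SimpleGraph.mem_edgeSet, Set.mem_insert_iff, Set.mem_singleton_iff, Sym2.eq_iff]
  grind

theorem StarPair.symm [Fintype V] (h : StarPair G x y u v) : StarPair G u v x y := by
  have := h.cxy; have := h.cxu; have := h.cxv; have := h.cyu; have := h.cyv; have := h.cuv
  exact ⟨h.uv, h.xy, h.ne_xu.symm, h.ne_yv.symm, fun k => h.nxu k.symm, fun k => h.nyu k.symm,
    fun k => h.nxv k.symm, fun k => h.nyv k.symm, by grind, by grind, by grind, by grind, by grind,
    by grind⟩

theorem StarPair.swap [Fintype V] (h : StarPair G x y u v) : StarPair G y x v u := by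
  have := h.cxy; have := h.cxu; have := h.cxv; have := h.cyu; have := h.cyv; have := h.cuv
  exact ⟨h.xy.symm, h.uv.symm, h.ne_yv, h.ne_xu, h.nyv, h.nyu, h.nxv, h.nxu, by grind, by grind,
    by grind, by grind, by grind, by grind⟩

theorem side_comm {a : V} : Side G u v x y a ↔ Side G x y u v a := or_comm

theorem NoShort.symm (h : NoShort G x y u v) : NoShort G u v x y := by
  constructor
  · simpa only [side_comm] using h.side
  · simpa only [side_comm] using h.side'
  · simpa only [side_comm] using h.cross
  · simpa only [side_comm] using h.path

theorem NoShort.swap (h : NoShort G x y u v) : NoShort G y x v u :=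
  ⟨h.side', h.side, fun a c ha hc k => h.cross c a hc ha k.symm,
    fun a b c ha hc k k' => h.path c b a hc ha k'.symm k.symm⟩

theorem switch_symm : switch G u v x y = switch G x y u v := by
  unfold switch
  rw [Set.pair_comm, Set.pair_comm s(u, y)]

theorem switch_swap : switch G y x v u = switch G x y u v := by
  unfold switch
  rw [Set.pair_comm s(y, u), Sym2.eq_swap (a := y) (b := x), Sym2.eq_swap (a := v) (b := u),
    Sym2.eq_swap (a := y) (b := u), Sym2.eq_swap (a := v) (b := x)]

variable [Fintype V]

/-- For a centre off the four vertices and their neighbours the identity works: the ball stays the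
same set, and no altered pair lies inside it. -/
theorem nbhd_iso_far (hs : StarPair G x y u v) (hn : NoShort G x y u v)
    (hx : w ≠ x) (hy : w ≠ y) (hu : w ≠ u) (hv : w ≠ v) (hA : ¬ Side G x y u v w)
    (hB : ¬ Side G y x v u w) :
    ∃ e : nbhd G 2 w ≃g nbhd (switch G x y u v) 2 w,
      e (root G 2 w) = root (switch G x y u v) 2 w := by
  have hxv : x ≠ v := fun h => hs.nxu (h ▸ hs.uv.symm)
  have huy : u ≠ y := fun h => hs.nxu (h ▸ hs.xy)
  have hadj := switch_adj (G := G) hxv huy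
  set H := switch G x y u v
  have h1 : ∀ c, G.Adj w c → c ≠ x ∧ c ≠ y ∧ c ≠ u ∧ c ≠ v := by
    intro c hc
    unfold Side at hA hB
    have := hc.symm
    grind
  have h1' : ∀ c, H.Adj w c ↔ G.Adj w c := by grind
  have h2 : ∀ c z, G.Adj w c → (G.Adj c z ↔ H.Adj c z) := by grind
  have hball : ∀ z, z ∈ closedBall G 2 w ↔ z ∈ closedBall H 2 w := by
    intro z
    rw [mem_closedBall_two, mem_closedBall_two]
    grind
  have hmem : ∀ z, (z = x ∨ z = u) → z ∈ closedBall G 2 w → ∃ a, Side G x y u v a ∧ G.Adj w a := by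
    intro z hz hb
    rw [mem_closedBall_two] at hb
    have : ∀ {a b}, G.Adj a b → G.Adj b a := fun h => h.symm
    unfold Side
    grind
  have hmem' : ∀ z, (z = y ∨ z = v) → z ∈ closedBall G 2 w →
      ∃ a, Side G y x v u a ∧ G.Adj a w := by
    intro z hz hb
    rw [mem_closedBall_two] at hb
    have : ∀ {a b}, G.Adj a b → G.Adj b a := fun h => h.symm
    unfold Side
    grind
  -- Every removed or added edge joins {x, u} to {y, v}. A ball which meets both sets would give a
  -- path a, w, c between the two sides, which `NoShort.path` forbids.
  have hno : ∀ z z', (z = x ∨ z = u) → z ∈ closedBall G 2 w → (z' = y ∨ z' = v) →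
      z' ∈ closedBall G 2 w → False := by
    intro z z' hz hb hz' hb'
    obtain ⟨a, ha, hwa⟩ := hmem z hz hb
    obtain ⟨c, hc, hcw⟩ := hmem' z' hz' hb'
    exact hn.path a w c ha hc hwa.symm hcw.symm
  refine exists_nbhd_iso (Equiv.refl V) rfl hball fun z hz z' hz' => ?_
  simp only [Equiv.refl_apply]
  rw [hadj]
  grind

/-- From a neighbour w of x, the vertex y is seen only at the rim of the ball, where x is its only
neighbour, and v is not seen. After the switch v plays exactly this role, so the transposition of y
and v is the isomorphism. -/
theorem nbhd_iso_adj (hs : StarPair G x y u v) (hn : NoShort G x y u v)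
    (hx : G.Adj x w) (hy : w ≠ y) :
    ∃ e : nbhd G 2 w ≃g nbhd (switch G x y u v) 2 w,
      e (root G 2 w) = root (switch G x y u v) 2 w := by
  classical
  have hxv : x ≠ v := fun h => hs.nxu (h ▸ hs.uv.symm)
  have huy : u ≠ y := fun h => hs.nxu (h ▸ hs.xy)
  have hadj := switch_adj (G := G) hxv huy
  set H := switch G x y u v
  have sym : ∀ {a b}, G.Adj a b → G.Adj b a := fun h => h.symm
  have hwv : w ≠ v := by rintro rfl; exact hs.nxv hx
  have hwx : w ≠ x := hx.ne'
  have hwu : w ≠ u := by rintro rfl; exact hs.nxu hx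
  have hwy' : ¬ G.Adj w y := fun h => hs.cxy w hx h.symm
  have hwu' : ¬ G.Adj w u := fun h => hs.cxu w hx h.symm
  have hwv' : ¬ G.Adj w v := fun h => hs.cxv w hx h.symm
  have hsw : Side G x y u v w := Or.inl ⟨hx, hy⟩
  have hv : ∀ c, G.Adj w c → ¬ G.Adj c v := by
    intro c hc hcv
    by_cases hcu : c = u
    · exact hwu' (hcu ▸ hc)
    · exact hn.cross w c hsw (Or.inr ⟨hcv.symm, hcu⟩) hc
  have hy2 : ∀ c, G.Adj w c → G.Adj c y → c = x := by
    intro c hc hcy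
    by_contra hcx
    exact hn.cross w c hsw (Or.inl ⟨hcy.symm, hcx⟩) hc
  have h1 : ∀ c, H.Adj w c ↔ G.Adj w c := by grind
  have hGy : ∀ z ∈ closedBall G 2 w, G.Adj y z → z = x := by
    intro z hz hyz
    by_contra hzx
    have hB : Side G y x v u z := Or.inl ⟨hyz, hzx⟩
    rw [mem_closedBall_two] at hz
    rcases hz with rfl | hz | ⟨c, hc, hcz⟩
    · exact hwy' hyz.symm
    · exact hn.cross w z hsw hB hz
    · exact hn.path w c z hsw hB hc hcz
  have hvball : v ∉ closedBall G 2 w := by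
    rw [mem_closedBall_two]
    grind
  refine exists_nbhd_iso (Equiv.swap y v) (Equiv.swap_apply_of_ne_of_ne hy hwv) ?_ ?_
  · intro z
    rw [mem_closedBall_two, mem_closedBall_two]
    have hxw : G.Adj w x := hx.symm
    have hxy := hs.xy
    simp only [Equiv.swap_apply_def, h1]
    by_cases hz1 : z = y
    · subst hz1
      simp only [if_true]
      have : H.Adj x v := by grind
      grind
    · by_cases hz2 : z = v
      · subst hz2
        simp only [hz1, if_false, if_true]
        grind
      · simp only [hz1, hz2, if_false]
        have : ∀ c, G.Adj w c → (G.Adj c z ↔ H.Adj c z) := by grind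
        grind
  · intro z hz z' hz'
    have hzv : z ≠ v := by rintro rfl; exact hvball hz
    have hzv' : z' ≠ v := by rintro rfl; exact hvball hz'
    have e1 := hGy z hz
    have e2 := hGy z' hz'
    have hxy := hs.xy
    have hnb : ∀ z ∈ closedBall G 2 w, G.Adj v z → z = u := by
      intro z hz hvz
      by_contra hzu
      have hB : Side G y x v u z := Or.inr ⟨hvz, hzu⟩
      rw [mem_closedBall_two] at hz
      rcases hz with rfl | hz | ⟨c, hc, hcz⟩
      · exact hwv' hvz.symm
      · exact hn.cross w z hsw hB hz
      · exact hn.path w c z hsw hB hc hcz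
    have e3 := hnb z hz
    have e4 := hnb z' hz'
    have hyv := hs.ne_yv
    have hyu := hs.nyu
    have hirr : ∀ a, ¬ G.Adj a a := fun a => G.irrefl
    rw [hadj]
    simp only [Equiv.swap_apply_def]
    by_cases hz1 : z = y <;> by_cases hz2 : z' = y <;>
      simp only [hz1, hz2, hzv, hzv', if_true, if_false] <;> grind

open Classical in
/-- The degree of a vertex. -/
noncomputable def deg (G : SimpleGraph V) (a : V) : ℕ := #{b | G.Adj a b}

/-- Two vertices of the same degree have neighbourhoods, each without one vertex, which an
involution exchanges. -/
theorem exists_involutive (hs : StarPair G x y u v) (hd : deg G y = deg G v) :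
    ∃ σ : V → V, Function.Involutive σ ∧ σ y = v ∧ σ v = y ∧
      (∀ c, G.Adj y c → c ≠ x → G.Adj v (σ c) ∧ σ c ≠ u) ∧
      (∀ c, G.Adj v c → c ≠ u → G.Adj y (σ c) ∧ σ c ≠ x) ∧
      ∀ c, c ≠ y → c ≠ v → ¬ Side G y x v u c → σ c = c := by
  classical
  set B : Finset V := ({c | G.Adj y c} : Finset V).erase x with hB
  set B' : Finset V := ({c | G.Adj v c} : Finset V).erase u with hB'
  have hcard : #B = #B' := by
    rw [hB, hB', card_erase_of_mem (by simpa using hs.xy.symm),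
      card_erase_of_mem (by simpa using hs.uv.symm)]
    unfold deg at hd
    rw [hd]
  let τ : B ≃ B' := Fintype.equivOfCardEq (by simpa using hcard)
  have hmB : ∀ c, c ∈ B ↔ c ≠ x ∧ G.Adj y c := by simp [hB]
  have hmB' : ∀ c, c ∈ B' ↔ c ≠ u ∧ G.Adj v c := by simp [hB']
  have hyB : y ∉ B := by simp [hmB]
  have hyB' : y ∉ B' := by simp [hmB', SimpleGraph.adj_comm G v, hs.nyv]
  have hvB : v ∉ B := by simp [hmB, hs.nyv]
  have hvB' : v ∉ B' := by simp [hmB']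
  have hBB : ∀ c, c ∈ B → c ∉ B' := fun c h h' =>
    hs.cyv c ((hmB c).1 h).2 ((hmB' c).1 h').2
  let σ : V → V := fun c => if c = y then v else if c = v then y else
    if h : c ∈ B then τ ⟨c, h⟩ else if h : c ∈ B' then τ.symm ⟨c, h⟩ else c
  have hyv := hs.ne_yv
  have σB : ∀ c (h : c ∈ B), σ c = τ ⟨c, h⟩ := by
    intro c h
    have h1 : c ≠ y := by rintro rfl; exact hyB h
    have h2 : c ≠ v := by rintro rfl; exact hvB h
    simp [σ, h1, h2, h]
  have σB' : ∀ c (h : c ∈ B'), σ c = τ.symm ⟨c, h⟩ := by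
    intro c h
    have h1 : c ≠ y := by rintro rfl; exact hyB' h
    have h2 : c ≠ v := by rintro rfl; exact hvB' h
    have h3 : c ∉ B := fun h' => hBB c h' h
    simp [σ, h1, h2, h, h3]
  have σy : σ y = v := by simp [σ]
  have σv : σ v = y := by simp [σ, hyv.symm]
  have σo : ∀ c, c ≠ y → c ≠ v → c ∉ B → c ∉ B' → σ c = c := by
    intro c h1 h2 h3 h4
    simp [σ, h1, h2, h3, h4]
  refine ⟨σ, ?_, σy, σv, ?_, ?_, ?_⟩
  · intro c
    by_cases h1 : c = y
    · rw [h1, σy, σv]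
    by_cases h2 : c = v
    · rw [h2, σv, σy]
    by_cases h3 : c ∈ B
    · rw [σB c h3, σB' _ (τ ⟨c, h3⟩).2]
      simp
    by_cases h4 : c ∈ B'
    · rw [σB' c h4, σB _ (τ.symm ⟨c, h4⟩).2]
      simp
    rw [σo c h1 h2 h3 h4, σo c h1 h2 h3 h4]
  · intro c hc hcx
    have h : c ∈ B := (hmB c).2 ⟨hcx, hc⟩
    rw [σB c h]
    exact ((hmB' _).1 (τ ⟨c, h⟩).2).symm
  · intro c hc hcu
    have h : c ∈ B' := (hmB' c).2 ⟨hcu, hc⟩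
    rw [σB' c h]
    exact ((hmB _).1 (τ.symm ⟨c, h⟩).2).symm
  · intro c h1 h2 h3
    refine σo c h1 h2 (fun h => h3 (Or.inl ((hmB c).1 h).symm)) (fun h => h3 (Or.inr ((hmB' c).1 h).symm))

/-- In the ball around x the branch through y becomes a branch through v. Equal degrees allow an
involution to exchange the two branches. It is an isomorphism because a branch has no inner edges
between its leaves (`side'`) and its leaves are not adjacent to the rest of the ball (`cross`,
`path`). -/
theorem nbhd_iso_root (hs : StarPair G x y u v) (hn : NoShort G x y u v)
    (hd : deg G y = deg G v) :
    ∃ e : nbhd G 2 x ≃g nbhd (switch G x y u v) 2 x,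
      e (root G 2 x) = root (switch G x y u v) 2 x := by
  have hxv : x ≠ v := fun h => hs.nxu (h ▸ hs.uv.symm)
  have huy : u ≠ y := fun h => hs.nxu (h ▸ hs.xy)
  have hadj := switch_adj (G := G) hxv huy
  obtain ⟨σ, hσ, σy, σv, σB, σB', σo⟩ := exists_involutive hs hd
  set H := switch G x y u v
  have sym : ∀ {a b}, G.Adj a b → G.Adj b a := fun h => h.symm
  have hirr : ∀ a, ¬ G.Adj a a := fun a => G.irrefl
  have hxy := hs.xy
  have huv := hs.uv
  have hxu := hs.ne_xu
  have hyv := hs.ne_yv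
  have nxu := hs.nxu
  have nxv := hs.nxv
  have nyu := hs.nyu
  have nyv := hs.nyv
  have hxy' : x ≠ y := hxy.ne
  have cxu := hs.cxu
  have cxv := hs.cxv
  have cxy := hs.cxy
  have hxB : ¬ Side G y x v u x := by unfold Side; grind
  have σx : σ x = x := σo x hxy' hxv hxB
  have hAB : ∀ a, G.Adj x a → a ≠ y → ¬ Side G y x v u a := by unfold Side; grind
  have hAB2 : ∀ a z, G.Adj x a → a ≠ y → G.Adj a z → ¬ Side G y x v u z := fun a z h1 h2 h3 h4 =>
    hn.cross a z (Or.inl ⟨h1, h2⟩) h4 h3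
  have hAy : ∀ a z, G.Adj x a → a ≠ y → G.Adj a z → z ≠ y ∧ z ≠ v := by
    intro a z h1 h2 h3
    constructor
    · rintro rfl; exact cxy a h1 h3.symm
    · rintro rfl; exact cxv a h1 h3.symm
  have hAB3 : ∀ a z c, G.Adj x a → a ≠ y → G.Adj a z → Side G y x v u c → ¬ G.Adj z c :=
    fun a z c h1 h2 h3 h4 h5 => hn.path a z c (Or.inl ⟨h1, h2⟩) h4 h3 h5
  have hBB : ∀ c c', Side G y x v u c → Side G y x v u c' → ¬ G.Adj c c' := hn.side'
  have hG : ∀ z, z ∈ closedBall G 2 x ↔ z = x ∨ z = y ∨ (G.Adj y z ∧ z ≠ x) ∨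
      (G.Adj x z ∧ z ≠ y) ∨ ∃ a, G.Adj x a ∧ a ≠ y ∧ G.Adj a z := by
    intro z
    rw [mem_closedBall_two]
    constructor
    · rintro (h | h | ⟨c, h, h'⟩)
      · exact Or.inl h
      · by_cases hz : z = y
        · exact Or.inr (Or.inl hz)
        · exact Or.inr (Or.inr (Or.inr (Or.inl ⟨h, hz⟩)))
      · by_cases hc : c = y
        · subst hc
          by_cases hz : z = x
          · exact Or.inl hz
          · exact Or.inr (Or.inr (Or.inl ⟨h', hz⟩))
        · exact Or.inr (Or.inr (Or.inr (Or.inr ⟨c, h, hc, h'⟩)))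
    · rintro (h | rfl | h | h | ⟨a, h1, h2, h3⟩)
      · exact Or.inl h
      · exact Or.inr (Or.inl hxy)
      · exact Or.inr (Or.inr ⟨y, hxy, h.1⟩)
      · exact Or.inr (Or.inl h.1)
      · exact Or.inr (Or.inr ⟨a, h1, h3⟩)
  have hH1 : ∀ a, G.Adj x a → a ≠ y → ∀ z, (H.Adj a z ↔ G.Adj a z) := by grind
  have hHx : ∀ a, H.Adj x a ↔ (G.Adj x a ∧ a ≠ y) ∨ a = v := by grind
  have hHv : ∀ a, H.Adj v a ↔ (G.Adj v a ∧ a ≠ u) ∨ a = x := by grind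
  have hH : ∀ z, z ∈ closedBall H 2 x ↔ z = x ∨ z = v ∨ (G.Adj v z ∧ z ≠ u) ∨
      (G.Adj x z ∧ z ≠ y) ∨ ∃ a, G.Adj x a ∧ a ≠ y ∧ G.Adj a z := by
    intro z
    rw [mem_closedBall_two]
    constructor
    · rintro (h | h | ⟨c, h, h'⟩)
      · exact Or.inl h
      · grind
      · rcases (hHx c).1 h with h1 | rfl
        · rw [hH1 c h1.1 h1.2] at h'
          exact Or.inr (Or.inr (Or.inr (Or.inr ⟨c, h1.1, h1.2, h'⟩)))
        · grind
    · rintro (h | h | h | h | ⟨a, h1, h2, h3⟩)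
      · exact Or.inl h
      · exact Or.inr (Or.inl ((hHx z).2 (Or.inr h)))
      · exact Or.inr (Or.inr ⟨v, (hHx v).2 (Or.inr rfl), (hHv z).2 (Or.inl h)⟩)
      · exact Or.inr (Or.inl ((hHx z).2 (Or.inl h)))
      · exact Or.inr (Or.inr ⟨a, (hHx a).2 (Or.inl ⟨h1, h2⟩), (hH1 a h1 h2 z).2 h3⟩)
  have σA : ∀ z, G.Adj x z → z ≠ y → σ z = z := fun z h1 h2 =>
    σo z h2 (by rintro rfl; exact nxv h1) (hAB z h1 h2)
  have σA2 : ∀ a z, G.Adj x a → a ≠ y → G.Adj a z → σ z = z := fun a z h1 h2 h3 =>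
    σo z (hAy a z h1 h2 h3).1 (hAy a z h1 h2 h3).2 (hAB2 a z h1 h2 h3)
  have hfwd : ∀ z, z ∈ closedBall G 2 x → σ z ∈ closedBall H 2 x := by
    intro z
    rw [hG, hH]
    rintro (rfl | rfl | h | h | ⟨a, h1, h2, h3⟩)
    · exact Or.inl σx
    · exact Or.inr (Or.inl σy)
    · exact Or.inr (Or.inr (Or.inl (σB z h.1 h.2)))
    · rw [σA z h.1 h.2]; exact Or.inr (Or.inr (Or.inr (Or.inl h)))
    · rw [σA2 a z h1 h2 h3]; exact Or.inr (Or.inr (Or.inr (Or.inr ⟨a, h1, h2, h3⟩)))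
  have hbwd : ∀ z, z ∈ closedBall H 2 x → σ z ∈ closedBall G 2 x := by
    intro z
    rw [hG, hH]
    rintro (rfl | rfl | h | h | ⟨a, h1, h2, h3⟩)
    · exact Or.inl σx
    · exact Or.inr (Or.inl σv)
    · exact Or.inr (Or.inr (Or.inl (σB' z h.1 h.2)))
    · rw [σA z h.1 h.2]; exact Or.inr (Or.inr (Or.inr (Or.inl h)))
    · rw [σA2 a z h1 h2 h3]; exact Or.inr (Or.inr (Or.inr (Or.inr ⟨a, h1, h2, h3⟩)))
  -- the part of the ball which the involution fixes
  have hfix : ∀ z, z ∈ closedBall G 2 x → z ≠ y → ¬ (G.Adj y z ∧ z ≠ x) →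
      σ z = z ∧ z ≠ v ∧ ∀ c, Side G y x v u c → G.Adj z c → False := by
    intro z hz h1 h2
    rcases (hG z).1 hz with rfl | h | h | h | ⟨a, h3, h4, h5⟩
    · refine ⟨σx, hxv, fun c hc h => ?_⟩
      unfold Side at hc
      grind
    · exact absurd h h1
    · exact absurd h h2
    · exact ⟨σA z h.1 h.2, by rintro rfl; exact nxv h.1, fun c hc h' => hAB2 z c h.1 h.2 h' hc⟩
    · exact ⟨σA2 a z h3 h4 h5, (hAy a z h3 h4 h5).2, fun c hc h' => hAB3 a z c h3 h4 h5 hc h'⟩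
  have hBy : ∀ z, G.Adj y z ∧ z ≠ x → σ z ≠ v ∧ σ z ≠ y ∧ σ z ≠ x ∧ σ z ≠ u ∧ G.Adj v (σ z) := by
    intro z h
    have := σB z h.1 h.2
    grind
  refine exists_nbhd_iso hσ.toPerm σx (fun z => ⟨hfwd z, fun h => ?_⟩) ?_
  · have := hbwd _ h
    rwa [Function.Involutive.coe_toPerm, hσ z] at this
  intro z hz z' hz'
  simp only [Function.Involutive.coe_toPerm]
  by_cases h1 : z = y
  · subst h1
    rw [σy, hHv]
    by_cases h2 : z' = z
    · subst h2; rw [σy]; grind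
    by_cases h3 : G.Adj z z' ∧ z' ≠ x
    · exact ⟨fun _ => Or.inl (σB z' h3.1 h3.2), fun _ => h3.1⟩
    · obtain ⟨e1, e2, e3⟩ := hfix z' hz' h2 h3
      rw [e1]
      constructor
      · intro h; right; by_contra h4; exact h3 ⟨h, h4⟩
      · rintro (h | rfl)
        · exfalso
          rcases (hG z').1 hz' with rfl | h' | h' | h' | ⟨a, h5, h6, h7⟩
          · exact nxv h.1.symm
          · exact h2 h'
          · exact h3 h'
          · exact cxv z' h'.1 h.1
          · exact hAB2 a z' h5 h6 h7 (Or.inr h)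
        · exact hxy.symm
  by_cases h2 : z' = y
  · subst h2
    rw [σy, SimpleGraph.adj_comm, SimpleGraph.adj_comm H, hHv]
    by_cases h3 : G.Adj z' z ∧ z ≠ x
    · exact ⟨fun _ => Or.inl (σB z h3.1 h3.2), fun _ => h3.1⟩
    · obtain ⟨e1, e2, e3⟩ := hfix z hz h1 h3
      rw [e1]
      constructor
      · intro h; right; by_contra h4; exact h3 ⟨h, h4⟩
      · rintro (h | rfl)
        · exfalso
          rcases (hG z).1 hz with rfl | h' | h' | h' | ⟨a, h5, h6, h7⟩
          · exact nxv h.1.symm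
          · exact h1 h'
          · exact h3 h'
          · exact cxv z h'.1 h.1
          · exact hAB2 a z h5 h6 h7 (Or.inr h)
        · exact hxy.symm
  by_cases h3 : G.Adj y z ∧ z ≠ x <;> by_cases h4 : G.Adj y z' ∧ z' ≠ x
  · obtain ⟨a1, a2, a3, a4, a5⟩ := hBy z h3
    obtain ⟨b1, b2, b3, b4, b5⟩ := hBy z' h4
    have e1 := hBB z z' (Or.inl h3) (Or.inl h4)
    have e2 := hBB (σ z) (σ z') (Or.inr ⟨a5, a4⟩) (Or.inr ⟨b5, b4⟩)
    rw [hadj]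
    simp [e1, e2, a1, a2, b1, b2, a3, a4]
  · obtain ⟨a1, a2, a3, a4, a5⟩ := hBy z h3
    obtain ⟨b1, b2, b3⟩ := hfix z' hz' h2 h4
    have e1 : ¬ G.Adj z z' := fun h => b3 z (Or.inl h3) h.symm
    have e2 : ¬ G.Adj (σ z) z' := fun h => b3 (σ z) (Or.inr ⟨a5, a4⟩) h.symm
    rw [hadj, b1]
    simp [e1, e2, a1, a2, b2, a3, a4]
  · obtain ⟨a1, a2, a3, a4, a5⟩ := hBy z' h4
    obtain ⟨b1, b2, b3⟩ := hfix z hz h1 h3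
    have e1 : ¬ G.Adj z z' := fun h => b3 z' (Or.inl h4) h
    have e2 : ¬ G.Adj z (σ z') := fun h => b3 (σ z') (Or.inr ⟨a5, a4⟩) h
    rw [hadj, b1]
    simp [e1, e2, a1, a2, b2, a3, a4]
  · obtain ⟨a1, a2, -⟩ := hfix z hz h1 h3
    obtain ⟨b1, b2, -⟩ := hfix z' hz' h2 h4
    rw [hadj, a1, b1]
    simp [a2, b2, h1, h2]

/-- The symmetries `symm` and `swap` of the configuration reduce all centres to three cases: x
itself, a neighbour of x, or far away. The degrees of y and v matter for the centres x and u, those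
of x and u for the centres y and v. -/
theorem haveIsomorphicNbhds_switch (hs : StarPair G x y u v) (hn : NoShort G x y u v)
    (hdx : deg G x = deg G u) (hdy : deg G y = deg G v) :
    HaveIsomorphicNbhds 2 G (switch G x y u v) := by
  refine ⟨Equiv.refl V, fun w => ?_⟩
  change ∃ e : nbhd G 2 w ≃g nbhd (switch G x y u v) 2 w, _
  by_cases h1 : w = x
  · subst h1; exact nbhd_iso_root hs hn hdy
  by_cases h2 : w = u
  · subst h2
    have := nbhd_iso_root hs.symm hn.symm hdy.symm
    rwa [switch_symm] at this
  by_cases h3 : w = y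
  · subst h3
    have := nbhd_iso_root hs.swap hn.swap hdx
    rwa [switch_swap] at this
  by_cases h4 : w = v
  · subst h4
    have := nbhd_iso_root hs.swap.symm hn.swap.symm hdx.symm
    rwa [switch_symm, switch_swap] at this
  by_cases h5 : Side G x y u v w
  · rcases h5 with h | h
    · exact nbhd_iso_adj hs hn h.1 h.2
    · have := nbhd_iso_adj hs.symm hn.symm h.1 h.2
      rwa [switch_symm] at this
  by_cases h6 : Side G y x v u w
  · rcases h6 with h | h
    · have := nbhd_iso_adj hs.swap hn.swap h.1 h.2
      rwa [switch_swap] at this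
    · have := nbhd_iso_adj hs.swap.symm hn.swap.symm h.1 h.2
      rwa [switch_symm, switch_swap] at this
  exact nbhd_iso_far hs hn h1 h3 h2 h4 h5 h6

end Switch

end Shotgun

namespace Shotgun

open Finset

/-! ### An isomorphism invariant which detects a switch. -/

section Invariant

variable {V : Type u} [Fintype V] {G H : SimpleGraph V} {x y u v : V}

open Classical in
/-- The sum of a function over the neighbours of a vertex. -/
noncomputable def nbrSum (G : SimpleGraph V) (g : V → ℤ) (a : V) : ℤ :=
  ∑ b, if G.Adj a b then g b else 0

/-- The sum of the degrees of the neighbours of a vertex. -/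
noncomputable def degSum (G : SimpleGraph V) : V → ℤ :=
  nbrSum G (nbrSum G fun _ => 1)

/-- The sum over the oriented edges of the products of the degree sums of the ends. -/
noncomputable def edgeInvariant (G : SimpleGraph V) : ℤ :=
  ∑ a, degSum G a * nbrSum G (degSum G) a

theorem nbrSum_one (a : V) : nbrSum G (fun _ => 1) a = deg G a := by
  classical
  simp only [nbrSum, deg, sum_boole]

theorem nbrSum_iso {W : Type u} [Fintype W] {H : SimpleGraph W} (e : G ≃g H) (g : W → ℤ) (a : V) :
    nbrSum G (g ∘ e) a = nbrSum H g (e a) := by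
  classical
  unfold nbrSum
  rw [← e.toEquiv.sum_comp]
  refine sum_congr rfl fun b _ => ?_
  have : H.Adj (e a) (e.toEquiv b) ↔ G.Adj a b := e.map_rel_iff
  simp only [this, Function.comp]
  rfl

theorem degSum_iso {W : Type u} [Fintype W] {H : SimpleGraph W} (e : G ≃g H) :
    degSum G = degSum H ∘ e := by
  have h1 : nbrSum G (fun _ => 1) = nbrSum H (fun _ => 1) ∘ e :=
    funext fun a => nbrSum_iso e (fun _ => 1) a
  funext a
  rw [degSum, h1, nbrSum_iso]
  rfl

theorem edgeInvariant_iso {W : Type u} [Fintype W] {H : SimpleGraph W} (e : G ≃g H) :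
    edgeInvariant G = edgeInvariant H := by
  unfold edgeInvariant
  rw [← e.toEquiv.sum_comp]
  refine sum_congr rfl fun a _ => ?_
  rw [degSum_iso e, nbrSum_iso]
  rfl

/-- Each of the four vertices loses one neighbour and gains another, and all other neighbourhoods
stay the same. -/
theorem nbrSum_switch (hs : StarPair G x y u v) (g : V → ℤ) (a : V) [DecidableEq V] :
    nbrSum (switch G x y u v) g a = nbrSum G g a + ((if a = x then g v - g y else 0) +
      (if a = y then g u - g x else 0) + (if a = u then g y - g v else 0) +
      if a = v then g x - g u else 0) := by
  have hxv : x ≠ v := fun h => hs.nxu (h ▸ hs.uv.symm)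
  have huy : u ≠ y := fun h => hs.nxu (h ▸ hs.xy)
  have hadj := switch_adj (G := G) hxv huy
  have hxy := hs.xy.ne
  have huv := hs.uv.ne
  have hxu := hs.ne_xu
  have hyv := hs.ne_yv
  have hxy' := hs.xy
  have huv' := hs.uv
  have nxu := hs.nxu
  have nxv := hs.nxv
  have nyu := hs.nyu
  have nyv := hs.nyv
  have key : ∀ i j : V, (if a = i then g j else 0) = ∑ b, if a = i ∧ b = j then g b else 0 := by
    intro i j
    by_cases h : a = i <;> simp [h]
  have e0 : ∀ i j k : V, (if a = i then g j - g k else 0) =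
      (∑ b, if a = i ∧ b = j then g b else 0) - ∑ b, if a = i ∧ b = k then g b else 0 := by
    intro i j k
    rw [← key, ← key]
    split_ifs <;> simp
  rw [e0, e0, e0, e0]
  unfold nbrSum
  simp only [← sum_add_distrib, ← sum_sub_distrib]
  refine sum_congr rfl fun b _ => ?_
  have sym : ∀ {a b}, G.Adj a b → G.Adj b a := fun h => h.symm
  have := hadj a b
  by_cases ha1 : a = x
  · subst ha1
    simp only [hxy, hxu, hxv, false_and, true_and, if_false] at this ⊢
    by_cases hb : b = y <;> by_cases hb' : b = v <;> grind
  by_cases ha2 : a = y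
  · subst ha2
    simp only [ha1, hyv, huy.symm, false_and, true_and, if_false] at this ⊢
    by_cases hb : b = x <;> by_cases hb' : b = u <;> grind
  by_cases ha3 : a = u
  · subst ha3
    simp only [ha1, ha2, huv, false_and, true_and, if_false] at this ⊢
    by_cases hb : b = y <;> by_cases hb' : b = v <;> grind
  by_cases ha4 : a = v
  · subst ha4
    simp only [ha1, ha2, ha3, false_and, true_and, if_false] at this ⊢
    by_cases hb : b = x <;> by_cases hb' : b = u <;> grind
  simp only [ha1, ha2, ha3, ha4, false_and, if_false, or_self, not_false_eq_true, and_true,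
    or_false] at this ⊢
  simp only [sub_self, add_zero]
  by_cases h : G.Adj a b
  · rw [if_pos h, if_pos (this.2 h)]
  · rw [if_neg h, if_neg fun h' => h (this.1 h')]

/-- Degrees do not change, and each exchanged neighbour is replaced by one of equal degree, so
`degSum` does not change either. The invariant then sees only the altered edges, and xv + uy - xy -
uv factors; the 2 counts orientations. -/
theorem edgeInvariant_switch (hs : StarPair G x y u v) (hdx : deg G x = deg G u)
    (hdy : deg G y = deg G v) :
    edgeInvariant (switch G x y u v) =
      edgeInvariant G - 2 * ((degSum G x - degSum G u) * (degSum G y - degSum G v)) := by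
  classical
  have h1 : nbrSum (switch G x y u v) (fun _ => 1) = nbrSum G (fun _ => 1) := by
    funext a
    rw [nbrSum_switch hs]
    simp
  have h2 : degSum (switch G x y u v) = degSum G := by
    funext a
    rw [degSum, h1, nbrSum_switch hs, degSum]
    simp only [nbrSum_one, hdx, hdy]
    simp
  unfold edgeInvariant
  rw [h2]
  simp only [nbrSum_switch hs, mul_add, sum_add_distrib, mul_ite, mul_zero, sum_ite_eq',
    mem_univ, if_true]
  ring

/-- If two edges can be switched and the degree sums at their ends differ, then the graph is not
determined by its neighbourhoods. -/
theorem not_reconstructible (hs : StarPair G x y u v) (hn : NoShort G x y u v)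
    (hdx : deg G x = deg G u) (hdy : deg G y = deg G v) (hx : degSum G x ≠ degSum G u)
    (hy : degSum G y ≠ degSum G v) : ¬ Reconstructible 2 G := by
  intro h
  obtain ⟨e⟩ := h V _ (haveIsomorphicNbhds_switch hs hn hdx hdy)
  have h1 := edgeInvariant_iso e
  rw [edgeInvariant_switch hs hdx hdy] at h1
  have : (degSum G x - degSum G u) * (degSum G y - degSum G v) = 0 := by linarith
  rcases mul_eq_zero.1 this with h | h
  · exact hx (sub_eq_zero.1 h)
  · exact hy (sub_eq_zero.1 h)

end Invariant

/-! ### The random graph as a random set of pairs. -/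

section RandomGraph

open MeasureTheory ProbabilityTheory unitInterval

/-- The graph with the given set of edges. -/
def gr {V : Type u} (S : Finset (Sym2 V)) : SimpleGraph V :=
  SimpleGraph.fromEdgeSet (S : Set (Sym2 V))

theorem gr_adj {V : Type u} (S : Finset (Sym2 V)) (a b : V) :
    (gr S).Adj a b ↔ s(a, b) ∈ S ∧ a ≠ b := by
  simp [gr]

variable {V : Type u} [Fintype V] [DecidableEq V]

/-- The pairs of distinct vertices. -/
def pairs (V : Type u) [Fintype V] [DecidableEq V] : Finset (Sym2 V) :=
  univ.filter fun e => ¬ e.IsDiag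

theorem mem_pairs {a b : V} : s(a, b) ∈ pairs V ↔ a ≠ b := by
  simp [pairs]

theorem gr_adj' {S : Finset (Sym2 V)} (hS : S ⊆ pairs V) (a b : V) :
    (gr S).Adj a b ↔ s(a, b) ∈ S := by
  rw [gr_adj]
  exact ⟨fun h => h.1, fun h => ⟨h, mem_pairs.1 (hS h)⟩⟩

/-- Probabilities in the binomial random graph as finite sums. -/
theorem binomialRandom_real (p : I) (P : SimpleGraph V → Prop) :
    (SimpleGraph.binomialRandom V p).real {G | P G} = pr (p : ℝ) (pairs V) fun S => P (gr S) := by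
  classical
  have hu : (Sym2.diagSetᶜ : Set (Sym2 V)) = ↑(pairs V) := by
    ext e; simp [pairs]
  rw [measureReal_def, SimpleGraph.binomialRandom_apply', ← measureReal_def]
  set 𝒮 : Finset (Finset (Sym2 V)) := (pairs V).powerset.filter fun S => P (gr S) with h𝒮
  have hset : SimpleGraph.edgeSet '' {G : SimpleGraph V | P G} =
      ⋃ S ∈ 𝒮, {(S : Set (Sym2 V))} := by
    ext s
    simp only [Set.mem_image, Set.mem_ofPred_eq, Set.mem_iUnion, Set.mem_singleton_iff, h𝒮,
      mem_filter, mem_powerset, exists_prop]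
    constructor
    · rintro ⟨G, h1, rfl⟩
      refine ⟨G.edgeSet.toFinset, ⟨?_, ?_⟩, by simp⟩
      · intro e he
        simpa [pairs] using G.not_isDiag_of_mem_edgeSet (by simpa using he)
      · simpa [gr] using h1
    · rintro ⟨S, ⟨h1, h2⟩, rfl⟩
      refine ⟨gr S, h2, ?_⟩
      ext e
      induction e with
      | _ a b => simp [gr_adj' h1]
  rw [hset, measureReal_biUnion_finset]
  · unfold pr ex
    rw [h𝒮, sum_filter]
    refine sum_congr rfl fun S hS => ?_
    dsimp only
    have hS' : (S : Set (Sym2 V)) ⊆ Sym2.diagSetᶜ := by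
      rw [hu]; exact_mod_cast mem_powerset.1 hS
    split_ifs with h
    · rw [setBernoulli_real_singleton p hS' (Set.toFinite _), hu, ← Finset.coe_sdiff,
        Set.ncard_coe_finset, Set.ncard_coe_finset, mul_one]
    · simp
  · intro S _ T _ hST
    simpa [Function.onFun] using hST
  · intro S _
    exact (Set.toFinite _).measurableSet

end RandomGraph

end Shotgun

namespace Shotgun

open Finset

/-! ### The sparse range: path components on five vertices. -/

section PathComponents

variable {V : Type u} [Fintype V] {G : SimpleGraph V}

theorem nbrSum_of_one (g : V → ℤ) {a b : V} (h : ∀ z, G.Adj a z ↔ z = b) : nbrSum G g a = g b := by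
  classical
  simp only [nbrSum, h]
  simp

theorem nbrSum_of_two (g : V → ℤ) {a b c : V} (hbc : b ≠ c) (h : ∀ z, G.Adj a z ↔ z = b ∨ z = c) :
    nbrSum G g a = g b + g c := by
  classical
  simp only [nbrSum, h]
  have : ∀ z, (if z = b ∨ z = c then g z else 0) =
      (if z = b then g z else 0) + if z = c then g z else 0 := by
    intro z
    by_cases h1 : z = b
    · subst h1; simp [hbc]
    · simp [h1]
  simp only [this, sum_add_distrib]
  simp

/-- The vertices `a 0, …, a 4` form, in this order, a path which is a component. -/
structure PathComponent (G : SimpleGraph V) (a : Fin 5 → V) : Prop where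
  inj : Function.Injective a
  zero : ∀ z, G.Adj (a 0) z ↔ z = a 1
  one : ∀ z, G.Adj (a 1) z ↔ z = a 0 ∨ z = a 2
  two : ∀ z, G.Adj (a 2) z ↔ z = a 1 ∨ z = a 3
  three : ∀ z, G.Adj (a 3) z ↔ z = a 2 ∨ z = a 4
  four : ∀ z, G.Adj (a 4) z ↔ z = a 3

theorem PathComponent.mem_range {a : Fin 5 → V} (h : PathComponent G a) (i : Fin 5) {z : V}
    (hz : G.Adj (a i) z) : z ∈ Set.range a := by
  fin_cases i
  · exact ⟨1, ((h.zero z).1 hz).symm⟩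
  · rcases (h.one z).1 hz with h | h <;> exact ⟨_, h.symm⟩
  · rcases (h.two z).1 hz with h | h <;> exact ⟨_, h.symm⟩
  · rcases (h.three z).1 hz with h | h <;> exact ⟨_, h.symm⟩
  · exact ⟨3, ((h.four z).1 hz).symm⟩

/-- Walking along b from the common vertex never leaves the component a. So two such components are
disjoint or have the same vertices. -/
theorem PathComponent.range_subset {a b : Fin 5 → V} (ha : PathComponent G a)
    (hb : PathComponent G b) {i j : Fin 5} (hij : a i = b j) (k : Fin 5) : b k ∈ Set.range a := by
  have h01 : G.Adj (b 0) (b 1) := (hb.zero _).2 rfl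
  have h12 : G.Adj (b 1) (b 2) := (hb.one _).2 (Or.inr rfl)
  have h23 : G.Adj (b 2) (b 3) := (hb.two _).2 (Or.inr rfl)
  have h34 : G.Adj (b 3) (b 4) := (hb.three _).2 (Or.inr rfl)
  have step : ∀ {z w : V}, z ∈ Set.range a → G.Adj z w → w ∈ Set.range a := by
    rintro z w ⟨l, rfl⟩ h
    exact ha.mem_range l h
  have hj : b j ∈ Set.range a := ⟨i, hij⟩
  have h0 : b 0 ∈ Set.range a := by
    fin_cases j
    · exact hj
    · exact step hj h01.symm
    · exact step (step hj h12.symm) h01.symm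
    · exact step (step (step hj h23.symm) h12.symm) h01.symm
    · exact step (step (step (step hj h34.symm) h23.symm) h12.symm) h01.symm
  fin_cases k
  · exact h0
  · exact step h0 h01
  · exact step (step h0 h01) h12
  · exact step (step (step h0 h01) h12) h23
  · exact step (step (step (step h0 h01) h12) h23) h34

/-- A graph with two disjoint path components with five vertices each is not determined by its
`2`-neighbourhoods: these two components may be replaced by paths with four and six vertices. -/
theorem not_reconstructible_of_pathComponents {a b : Fin 5 → V} (ha : PathComponent G a)
    (hb : PathComponent G b) (hab : ∀ i j, a i ≠ b j) : ¬ Reconstructible 2 G := by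
  have ia := fun i j => ha.inj.ne_iff (x := i) (y := j)
  have ib := fun i j => hb.inj.ne_iff (x := i) (y := j)
  obtain ⟨-, a0, a1, a2, a3, a4⟩ := ha
  obtain ⟨-, b0, b1, b2, b3, b4⟩ := hb
  have a01 := (ia 0 1).2 (by decide)
  have a02 := (ia 0 2).2 (by decide)
  have a03 := (ia 0 3).2 (by decide)
  have a04 := (ia 0 4).2 (by decide)
  have a12 := (ia 1 2).2 (by decide)
  have a13 := (ia 1 3).2 (by decide)
  have a14 := (ia 1 4).2 (by decide)
  have a23 := (ia 2 3).2 (by decide)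
  have a24 := (ia 2 4).2 (by decide)
  have a34 := (ia 3 4).2 (by decide)
  have b01 := (ib 0 1).2 (by decide)
  have b02 := (ib 0 2).2 (by decide)
  have b03 := (ib 0 3).2 (by decide)
  have b04 := (ib 0 4).2 (by decide)
  have b12 := (ib 1 2).2 (by decide)
  have b13 := (ib 1 3).2 (by decide)
  have b14 := (ib 1 4).2 (by decide)
  have b23 := (ib 2 3).2 (by decide)
  have b24 := (ib 2 4).2 (by decide)
  have b34 := (ib 3 4).2 (by decide)
  have d0 : (deg G (a 1) : ℤ) = 2 := by rw [← nbrSum_one, nbrSum_of_two _ a02 a1]; rfl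
  have d1 : (deg G (a 2) : ℤ) = 2 := by rw [← nbrSum_one, nbrSum_of_two _ a13 a2]; rfl
  have d2 : (deg G (a 3) : ℤ) = 2 := by rw [← nbrSum_one, nbrSum_of_two _ a24 a3]; rfl
  have d3 : (deg G (a 4) : ℤ) = 1 := by rw [← nbrSum_one, nbrSum_of_one _ a4]
  have f0 : (deg G (b 0) : ℤ) = 1 := by rw [← nbrSum_one, nbrSum_of_one _ b0]
  have f1 : (deg G (b 1) : ℤ) = 2 := by rw [← nbrSum_one, nbrSum_of_two _ b02 b1]; rfl
  have f2 : (deg G (b 2) : ℤ) = 2 := by rw [← nbrSum_one, nbrSum_of_two _ b13 b2]; rfl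
  have f3 : (deg G (b 3) : ℤ) = 2 := by rw [← nbrSum_one, nbrSum_of_two _ b24 b3]; rfl
  have hA : ∀ z, Side G (a 2) (a 3) (b 1) (b 2) z ↔ z = a 1 ∨ z = b 0 := by
    intro z; unfold Side; grind
  have hB : ∀ z, Side G (a 3) (a 2) (b 2) (b 1) z ↔ z = a 4 ∨ z = b 3 := by
    intro z; unfold Side; grind
  -- The new paths are a₀a₁a₂b₂b₃b₄ and b₀b₁a₃a₄. All four switched vertices have degree 2, while
  -- the degree sums are 4 at a₂, b₂ and 3 at a₃, b₁.
  refine not_reconstructible (x := a 2) (y := a 3) (u := b 1) (v := b 2) ⟨?_, ?_, hab _ _, hab _ _,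
    ?_, ?_, ?_, ?_, ?_, ?_, ?_, ?_, ?_, ?_⟩ ⟨?_, ?_, ?_, ?_⟩ ?_ ?_ ?_ ?_
  all_goals try simp only [hA, hB]
  · exact (a2 _).2 (Or.inr rfl)
  · exact (b1 _).2 (Or.inr rfl)
  · grind
  · grind
  · grind
  · grind
  · grind
  · grind
  · grind
  · grind
  · grind
  · grind
  · grind
  · grind
  · grind
  · rintro z w c (rfl | rfl) (rfl | rfl) h <;> grind
  · exact_mod_cast d1.trans f1.symm
  · exact_mod_cast d2.trans f2.symm
  · rw [degSum, nbrSum_of_two _ a13 a2, nbrSum_of_two _ b02 b1]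
    simp only [nbrSum_one]
    omega
  · rw [degSum, nbrSum_of_two _ a24 a3, nbrSum_of_two _ b13 b2]
    simp only [nbrSum_one]
    omega

variable [DecidableEq V]

/-- The edges of the path `a 0, …, a 4`. -/
def pathEdges (a : Fin 5 → V) : Finset (Sym2 V) :=
  {s(a 0, a 1), s(a 1, a 2), s(a 2, a 3), s(a 3, a 4)}

/-- The pairs of vertices which meet the path `a 0, …, a 4`. -/
def pathPairs (a : Fin 5 → V) : Finset (Sym2 V) :=
  (pairs V).filter fun e => ∃ i, a i ∈ e

theorem pathPairs_subset (a : Fin 5 → V) : pathPairs a ⊆ pairs V := filter_subset _ _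

theorem pathEdges_subset {a : Fin 5 → V} (ha : Function.Injective a) :
    pathEdges a ⊆ pathPairs a := by
  have ia := fun i j => ha.ne_iff (x := i) (y := j)
  intro e he
  simp only [pathEdges, mem_insert, mem_singleton] at he
  simp only [pathPairs, mem_filter]
  rcases he with rfl | rfl | rfl | rfl
  · exact ⟨mem_pairs.2 ((ia 0 1).2 (by decide)), 0, by simp⟩
  · exact ⟨mem_pairs.2 ((ia 1 2).2 (by decide)), 1, by simp⟩
  · exact ⟨mem_pairs.2 ((ia 2 3).2 (by decide)), 2, by simp⟩
  · exact ⟨mem_pairs.2 ((ia 3 4).2 (by decide)), 3, by simp⟩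

theorem card_pathEdges {a : Fin 5 → V} (ha : Function.Injective a) : #(pathEdges a) = 4 := by
  have ia := fun i j => ha.ne_iff (x := i) (y := j)
  unfold pathEdges
  rw [card_insert_of_notMem, card_insert_of_notMem, card_insert_of_notMem, card_singleton]
  all_goals simp [ha.eq_iff]

/-- The component event, in terms of the edge set. -/
def PathEvent (a : Fin 5 → V) (S : Finset (Sym2 V)) : Prop :=
  pathEdges a ⊆ S ∧ Disjoint S (pathPairs a \ pathEdges a)

theorem pathComponent_of_pathEvent {a : Fin 5 → V} (ha : Function.Injective a)
    {S : Finset (Sym2 V)} (hS : S ⊆ pairs V) (h : PathEvent a S) : PathComponent (gr S) a := by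
  have key : ∀ i z, (gr S).Adj (a i) z ↔ s(a i, z) ∈ pathEdges a := by
    intro i z
    rw [gr_adj' hS]
    refine ⟨fun h1 => ?_, fun h1 => h.1 h1⟩
    by_contra h2
    refine disjoint_left.1 h.2 h1 (mem_sdiff.2 ⟨?_, h2⟩)
    exact mem_filter.2 ⟨hS h1, i, by simp⟩
  refine ⟨ha, ?_, ?_, ?_, ?_, ?_⟩ <;> intro z <;> rw [key] <;>
    simp only [pathEdges, mem_insert, mem_singleton, Sym2.eq_iff, ha.eq_iff] <;>
    simp

theorem pr_pathEvent {p : ℝ} {a : Fin 5 → V} (ha : Function.Injective a) :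
    pr p (pairs V) (PathEvent a) = p ^ 4 * (1 - p) ^ (#(pathPairs a) - 4) := by
  unfold PathEvent
  rw [pr_subset_disjoint ((pathEdges_subset ha).trans (pathPairs_subset a))
    (sdiff_subset.trans (pathPairs_subset a)) disjoint_sdiff,
    card_sdiff_of_subset (pathEdges_subset ha), card_pathEdges ha]

theorem card_pathPairs_le (a : Fin 5 → V) : #(pathPairs a) ≤ 5 * Fintype.card V := by
  have : pathPairs a ⊆ (univ : Finset (Fin 5 × V)).image fun q => s(a q.1, q.2) := by
    intro e he
    obtain ⟨-, i, hi⟩ := mem_filter.1 he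
    obtain ⟨z, rfl⟩ := Sym2.mem_iff_exists.1 hi
    exact mem_image.2 ⟨(i, z), mem_univ _, rfl⟩
  refine (card_le_card this).trans (card_image_le.trans ?_)
  simp [card_univ]

/-- The two events fail to be independent only because the pairs joining the two paths, at most 25
of them, must be absent for both and are counted twice in the product. -/
theorem pr_pathEvent_and {p : ℝ} (hp : 0 ≤ p) (hp1 : p ≤ 1) {a b : Fin 5 → V}
    (ha : Function.Injective a) (hb : Function.Injective b) (hab : ∀ i j, a i ≠ b j) :
    (1 - p) ^ 25 * pr p (pairs V) (fun S => PathEvent a S ∧ PathEvent b S) ≤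
      pr p (pairs V) (PathEvent a) * pr p (pairs V) (PathEvent b) := by
  have hd : ∀ {a b : Fin 5 → V}, (∀ i j, a i ≠ b j) → ∀ e ∈ pathEdges a, e ∉ pathPairs b := by
    intro a b hab e he he'
    obtain ⟨-, j, hj⟩ := mem_filter.1 he'
    simp only [pathEdges, mem_insert, mem_singleton] at he
    rcases he with rfl | rfl | rfl | rfl <;> rcases Sym2.mem_iff.1 hj with h | h <;>
      exact hab _ _ h.symm
  have h1 := hd hab
  have h2 := hd fun i j => (hab j i).symm
  have sa := pathEdges_subset ha
  have sb := pathEdges_subset hb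
  have hev : ∀ S ⊆ pairs V, PathEvent a S ∧ PathEvent b S ↔ pathEdges a ∪ pathEdges b ⊆ S ∧
      Disjoint S ((pathPairs a ∪ pathPairs b) \ (pathEdges a ∪ pathEdges b)) := by
    intro S _
    have : (pathPairs a ∪ pathPairs b) \ (pathEdges a ∪ pathEdges b) =
        (pathPairs a \ pathEdges a) ∪ (pathPairs b \ pathEdges b) := by
      ext e
      have := h1 e
      have := h2 e
      simp only [mem_sdiff, mem_union]
      tauto
    rw [this, union_subset_iff, disjoint_union_right]
    unfold PathEvent
    tauto
  have hfs : ∀ a : Fin 5 → V, pathPairs a ⊆ pairs V := pathPairs_subset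
  have hcard : #(pathEdges a ∪ pathEdges b) = 8 := by
    rw [card_union_of_disjoint, card_pathEdges ha, card_pathEdges hb]
    exact disjoint_left.2 fun e he he' => h1 e he (sb he')
  have hinter : #(pathPairs a ∩ pathPairs b) ≤ 25 := by
    have : pathPairs a ∩ pathPairs b ⊆
        (univ : Finset (Fin 5 × Fin 5)).image fun q => s(a q.1, b q.2) := by
      intro e he
      obtain ⟨he1, he2⟩ := mem_inter.1 he
      obtain ⟨-, i, hi⟩ := mem_filter.1 he1
      obtain ⟨-, j, hj⟩ := mem_filter.1 he2
      exact mem_image.2 ⟨(i, j), mem_univ _, ((Sym2.mem_and_mem_iff (hab i j)).1 ⟨hi, hj⟩).symm⟩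
    refine (card_le_card this).trans (card_image_le.trans ?_)
    simp
  have hun := card_union_add_card_inter (pathPairs a) (pathPairs b)
  have c1 : 4 ≤ #(pathPairs a) := (card_pathEdges ha).symm.le.trans (card_le_card sa)
  have c2 : 4 ≤ #(pathPairs b) := (card_pathEdges hb).symm.le.trans (card_le_card sb)
  have c3 : 8 ≤ #(pathPairs a ∪ pathPairs b) :=
    hcard.symm.le.trans (card_le_card (union_subset_union sa sb))
  rw [pr_congr hev, pr_subset_disjoint
    (union_subset (sa.trans (hfs a)) (sb.trans (hfs b)))
    (sdiff_subset.trans (union_subset (hfs a) (hfs b))) disjoint_sdiff,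
    card_sdiff_of_subset (union_subset_union sa sb), hcard, pr_pathEvent ha, pr_pathEvent hb]
  have hq : 0 ≤ 1 - p := sub_nonneg.2 hp1
  have hq1 : 1 - p ≤ 1 := by linarith
  calc (1 - p) ^ 25 * (p ^ 8 * (1 - p) ^ (#(pathPairs a ∪ pathPairs b) - 8))
      = p ^ 8 * (1 - p) ^ (#(pathPairs a ∪ pathPairs b) - 8 + 25) := by ring
    _ ≤ p ^ 8 * (1 - p) ^ ((#(pathPairs a) - 4) + (#(pathPairs b) - 4)) :=
        mul_le_mul_of_nonneg_left (pow_le_pow_of_le_one hq hq1 (by omega)) (by positivity)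
    _ = _ := by ring

/-- The number of paths `a 0, …, a 4` which form a component. -/
noncomputable def pathCount (S : Finset (Sym2 V)) : ℝ := by
  classical
  exact ∑ a : Fin 5 → V with Function.Injective a, if PathEvent a S then 1 else 0

/-- A component which meets a has the form a ∘ σ with σ : Fin 5 → Fin 5, and there are 5⁵ = 3125
such maps. One more component must be disjoint from a. -/
theorem exists_disjoint_of_lt_pathCount {S : Finset (Sym2 V)} (hS : S ⊆ pairs V)
    (h : 3125 < pathCount S) : ¬ Reconstructible 2 (gr S) := by
  classical
  unfold pathCount at h
  rw [sum_boole, filter_filter] at h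
  set F := (univ : Finset (Fin 5 → V)).filter fun a => Function.Injective a ∧ PathEvent a S
  have h' : 3125 < #F := by exact_mod_cast h
  obtain ⟨a, ha⟩ : F.Nonempty := card_pos.1 (by omega)
  have hcomp : ∀ a ∈ F, PathComponent (gr S) a := fun a ha =>
    pathComponent_of_pathEvent (mem_filter.1 ha).2.1 hS (mem_filter.1 ha).2.2
  obtain ⟨b, hb, hb'⟩ : ∃ b ∈ F, b ∉ (univ : Finset (Fin 5 → Fin 5)).image fun σ => a ∘ σ := by
    by_contra hcon
    push Not at hcon
    have h1 := (card_le_card (s := F) (fun b hb => hcon b hb)).trans card_image_le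
    simp at h1
    omega
  refine not_reconstructible_of_pathComponents (hcomp a ha) (hcomp b hb) fun i j hij => hb' ?_
  have h1 := (hcomp a ha).range_subset (hcomp b hb) hij
  choose σ hσ using h1
  exact mem_image.2 ⟨σ, mem_univ _, funext hσ⟩

/-- Ordered pairs of components are split: those that meet, at most 3125 for each first component,
and disjoint pairs, which are independent up to the factor (1 - p)⁻²⁵. -/
theorem ex_pathCount_sq_le {p : ℝ} (hp : 0 ≤ p) (hp1 : p < 1) :
    (ex p (pairs V) fun S => pathCount S ^ 2) ≤ 3125 * ex p (pairs V) pathCount +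
      (1 / (1 - p) ^ 25) * ex p (pairs V) pathCount ^ 2 := by
  classical
  set F := (univ : Finset (Fin 5 → V)).filter Function.Injective with hF
  set f : (Fin 5 → V) → Finset (Sym2 V) → ℝ := fun a S => if PathEvent a S then 1 else 0
  have hX : ∀ S, pathCount S = ∑ a ∈ F, f a S := fun S => rfl
  have hE : ex p (pairs V) pathCount = ∑ a ∈ F, pr p (pairs V) (PathEvent a) := by
    have : (pathCount : Finset (Sym2 V) → ℝ) = fun S => ∑ a ∈ F, f a S := funext hX
    rw [this, ex_sum]
    rfl
  have hq : 0 < 1 - p := by linarith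
  set I : (Fin 5 → V) → Finset (Fin 5 → V) := fun a =>
    (univ : Finset (Fin 5 → Fin 5)).image fun σ => a ∘ σ with hI
  have hIc : ∀ a, #(I a) ≤ 3125 := fun a => card_image_le.trans (by simp)
  set J : (Fin 5 → V) → Finset (Fin 5 → V) := fun a => F.filter fun b => ∀ i j, a i ≠ b j with hJ
  have hle : ∀ S ⊆ pairs V, pathCount S ^ 2 ≤
      ∑ a ∈ F, (3125 * f a S + ∑ b ∈ J a, f a S * f b S) := by
    intro S hS
    rw [sq, hX, sum_mul]
    refine sum_le_sum fun a ha => ?_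
    by_cases hE : PathEvent a S
    · have hfa : f a S = 1 := by simp [f, hE]
      rw [hfa]
      simp only [one_mul, mul_one]
      have hsub : ∀ b ∈ F, f b S ≠ 0 → b ∈ I a ∪ J a := by
        intro b hb hfb
        have hEb : PathEvent b S := by by_contra h; simp [f, h] at hfb
        have c1 := pathComponent_of_pathEvent (mem_filter.1 ha).2 hS hE
        have c2 := pathComponent_of_pathEvent (mem_filter.1 hb).2 hS hEb
        by_cases hd : ∀ i j, a i ≠ b j
        · exact mem_union_right _ (mem_filter.2 ⟨hb, hd⟩)
        · push Not at hd
          obtain ⟨i, j, hij⟩ := hd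
          choose σ hσ using c1.range_subset c2 hij
          exact mem_union_left _ (mem_image.2 ⟨σ, mem_univ _, funext hσ⟩)
      have hnn : ∀ b, 0 ≤ f b S := fun b => by simp only [f]; split_ifs <;> simp
      have hle1 : ∀ b, f b S ≤ 1 := fun b => by simp only [f]; split_ifs <;> simp
      calc ∑ b ∈ F, f b S ≤ ∑ b ∈ I a ∪ J a, f b S := by
            rw [← sum_filter_ne_zero]
            exact sum_le_sum_of_subset_of_nonneg (fun b hb => hsub b (mem_filter.1 hb).1
              (mem_filter.1 hb).2) fun b _ _ => hnn b
        _ ≤ ∑ b ∈ I a, f b S + ∑ b ∈ J a, f b S := by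
            rw [← sum_union_inter]
            exact le_add_of_nonneg_right (sum_nonneg fun b _ => hnn b)
        _ ≤ 3125 + ∑ b ∈ J a, f b S := by
            have : ∑ b ∈ I a, f b S ≤ #(I a) := by
              have := sum_le_card_nsmul (I a) (fun b => f b S) 1 fun b _ => hle1 b
              rwa [nsmul_one] at this
            have h3 : (#(I a) : ℝ) ≤ 3125 := by exact_mod_cast hIc a
            linarith
    · simp [f, hE]
  refine (ex_mono hp hp1.le hle).trans ?_
  rw [ex_sum, hE, mul_sum, sq, mul_comm (1 / (1 - p) ^ 25), sum_mul, sum_mul, ← sum_add_distrib]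
  refine sum_le_sum fun a ha => ?_
  rw [ex_add, ex_const_mul, ex_sum]
  refine add_le_add le_rfl ?_
  rw [mul_assoc]
  calc ∑ b ∈ J a, ex p (pairs V) (fun S => f a S * f b S)
      ≤ ∑ b ∈ J a, pr p (pairs V) (PathEvent a) *
          (pr p (pairs V) (PathEvent b) * (1 / (1 - p) ^ 25)) := by
        refine sum_le_sum fun b hb => ?_
        have hb' := mem_filter.1 hb
        have h1 := pr_pathEvent_and hp hp1.le (mem_filter.1 ha).2 (mem_filter.1 hb'.1).2 hb'.2
        have h2 : ex p (pairs V) (fun S => f a S * f b S) =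
            pr p (pairs V) fun S => PathEvent a S ∧ PathEvent b S := by
          refine ex_congr fun S _ => ?_
          by_cases h : PathEvent a S <;> by_cases h' : PathEvent b S <;> simp [f, h, h']
        rw [h2, ← mul_assoc, mul_one_div, le_div_iff₀ (by positivity)]
        linarith
    _ ≤ _ := by
        rw [← mul_sum, ← sum_mul]
        refine mul_le_mul_of_nonneg_left (mul_le_mul_of_nonneg_right ?_ (by positivity))
          (pr_nonneg hp hp1.le)
        exact sum_le_sum_of_subset_of_nonneg (filter_subset _ _) fun b _ _ => pr_nonneg hp hp1.le

theorem le_ex_pathCount {p : ℝ} (hp : 0 ≤ p) (hp1 : p < 1) (hn : 8 ≤ Fintype.card V) :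
    ((Fintype.card V : ℝ) / 2) ^ 5 * p ^ 4 * (1 - p) ^ (5 * Fintype.card V) ≤
      ex p (pairs V) pathCount := by
  classical
  set n := Fintype.card V with hn'
  have hE : ex p (pairs V) pathCount =
      ∑ a : Fin 5 → V with Function.Injective a, pr p (pairs V) (PathEvent a) := by
    have : (pathCount : Finset (Sym2 V) → ℝ) =
        fun S => ∑ a : Fin 5 → V with Function.Injective a, if PathEvent a S then 1 else 0 := rfl
    rw [this, ex_sum]
    rfl
  have hcard : #((univ : Finset (Fin 5 → V)).filter Function.Injective) = n.descFactorial 5 := by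
    have := Fintype.card_embedding_eq (α := Fin 5) (β := V)
    rw [Fintype.card_fin] at this
    rw [← this, ← Fintype.card_subtype]
    exact Fintype.card_congr (Equiv.subtypeInjectiveEquivEmbedding _ _)
  have hlow : ((n : ℝ) / 2) ^ 5 ≤ n.descFactorial 5 := by
    -- The number of injections is at least (n - 4)⁵, and n - 4 ≥ n/2 because n ≥ 8.
    have h1 := Nat.pow_sub_le_descFactorial n 5
    have h2 : ((n + 1 - 5 : ℕ) : ℝ) ^ 5 ≤ n.descFactorial 5 := by exact_mod_cast h1
    refine le_trans (pow_le_pow_left₀ (by positivity) ?_ 5) h2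
    rw [Nat.cast_sub (by omega)]
    push_cast
    have : (8 : ℝ) ≤ n := by exact_mod_cast hn
    linarith
  have hq : 0 ≤ 1 - p := by linarith
  rw [hE]
  calc ((n : ℝ) / 2) ^ 5 * p ^ 4 * (1 - p) ^ (5 * n)
      ≤ n.descFactorial 5 * p ^ 4 * (1 - p) ^ (5 * n) := by gcongr
    _ = ∑ a : Fin 5 → V with Function.Injective a, p ^ 4 * (1 - p) ^ (5 * n) := by
        rw [sum_const, hcard, nsmul_eq_mul, mul_assoc]
    _ ≤ _ := by
        refine sum_le_sum fun a ha => ?_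
        rw [pr_pathEvent (mem_filter.1 ha).2]
        refine mul_le_mul_of_nonneg_left (pow_le_pow_of_le_one hq (by linarith) ?_) (by positivity)
        have := card_pathPairs_le a
        omega

/-- In the sparse regime most graphs are not determined by their `2`-neighbourhoods. -/
theorem pr_reconstructible_le_sparse {p M : ℝ} (hp : 0 ≤ p) (hp1 : p < 1)
    (hn : 8 ≤ Fintype.card V) (hM0 : 6250 < M)
    (hM : M ≤ ((Fintype.card V : ℝ) / 2) ^ 5 * p ^ 4 * (1 - p) ^ (5 * Fintype.card V)) :
    pr p (pairs V) (fun S => Reconstructible 2 (gr S)) ≤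
      4 * (3125 / M + (1 / (1 - p) ^ 25 - 1)) := by
  obtain ⟨m, hm⟩ : ∃ m, m = ex p (pairs V) (pathCount (V := V)) := ⟨_, rfl⟩
  have hMm : M ≤ m := hm ▸ hM.trans (le_ex_pathCount hp hp1 hn)
  have hm0 : 0 < m := by linarith
  have h1 : pr p (pairs V) (fun S => Reconstructible 2 (gr S)) ≤
      pr p (pairs V) fun S => m / 2 ≤ |pathCount S - m| := by
    refine pr_mono hp hp1.le fun S hS hrec => ?_
    -- Since m > 6250, a count of at most 3125 is at least m/2 below the mean.
    have : pathCount S ≤ 3125 := not_lt.1 fun h => exists_disjoint_of_lt_pathCount hS h hrec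
    rw [abs_sub_comm]
    exact le_trans (by linarith) (le_abs_self _)
  have h2 := chebyshev (s := pairs V) (f := pathCount) hp hp1.le (c := m / 2) (by linarith)
  have h3 := ex_pathCount_sq_le (V := V) hp hp1
  rw [← hm] at h2 h3
  set P := pr p (pairs V) fun S => m / 2 ≤ |pathCount S - m|
  refine h1.trans ?_
  have h4 : m * (m * P) ≤ m * (4 * (3125 + (1 / (1 - p) ^ 25 - 1) * m)) := by nlinarith
  have h5 := le_of_mul_le_mul_left h4 hm0
  have h6 : P ≤ 4 * (3125 / m + (1 / (1 - p) ^ 25 - 1)) := by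
    rw [← mul_le_mul_iff_right₀ hm0]
    refine h5.trans (le_of_eq ?_)
    field_simp
  refine h6.trans ?_
  gcongr

end PathComponents

end Shotgun

namespace Shotgun

open Finset

/-! ### Which quadruples are affected by the removal of one edge. -/

section Sensitivity

variable {V : Type u} [Fintype V] {G G' : SimpleGraph V} {x y u v : V} {lo hi : ℝ}

/-- The stars of `x`, `y`, `u`, `v` allow a switch, and the degrees lie between `lo` and `hi`. -/
structure StarEvent (lo hi : ℝ) (G : SimpleGraph V) (x y u v : V) : Prop where
  pair : StarPair G x y u v
  degx : deg G x = deg G u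
  degy : deg G y = deg G v
  lox : lo ≤ deg G x
  loy : lo ≤ deg G y
  hix : deg G x ≤ hi
  hiy : deg G y ≤ hi

theorem StarEvent.swap (h : StarEvent lo hi G x y u v) : StarEvent lo hi G y x v u :=
  ⟨h.pair.swap, h.degy, h.degx, h.loy, h.lox, h.hiy, h.hix⟩

theorem deg_congr {a : V} (h : ∀ z, G.Adj a z ↔ G'.Adj a z) : deg G a = deg G' a := by
  classical
  unfold deg
  simp only [h]

theorem StarEvent.congr (h : StarEvent lo hi G x y u v)
    (hx : ∀ z, G.Adj x z ↔ G'.Adj x z) (hy : ∀ z, G.Adj y z ↔ G'.Adj y z)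
    (hu : ∀ z, G.Adj u z ↔ G'.Adj u z) (hv : ∀ z, G.Adj v z ↔ G'.Adj v z) :
    StarEvent lo hi G' x y u v := by
  obtain ⟨⟨h1, h2, h3, h4, h5, h6, h7, h8, h9, h10, h11, h12, h13, h14⟩, d1, d2, d3, d4, d5, d6⟩ := h
  simp only [deg_congr hx, deg_congr hy, deg_congr hu, deg_congr hv] at d1 d2 d3 d4 d5 d6
  simp only [hx, hy, hu, hv] at h1 h2 h5 h6 h7 h8 h9 h10 h11 h12 h13 h14
  exact ⟨⟨h1, h2, h3, h4, h5, h6, h7, h8, h9, h10, h11, h12, h13, h14⟩, d1, d2, d3, d4, d5, d6⟩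

theorem side_congr (hx : ∀ z, G.Adj x z ↔ G'.Adj x z) (hu : ∀ z, G.Adj u z ↔ G'.Adj u z) (a : V) :
    Side G x y u v a ↔ Side G' x y u v a := by
  unfold Side
  rw [hx, hu]

theorem NoShort.anti (h : NoShort G x y u v) (hle : G' ≤ G)
    (hx : ∀ z, G.Adj x z ↔ G'.Adj x z) (hy : ∀ z, G.Adj y z ↔ G'.Adj y z)
    (hu : ∀ z, G.Adj u z ↔ G'.Adj u z) (hv : ∀ z, G.Adj v z ↔ G'.Adj v z) :
    NoShort G' x y u v := by
  have s1 := side_congr (y := y) (v := v) hx hu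
  have s2 := side_congr (y := x) (v := u) hy hv
  refine ⟨fun a a' ha ha' k => ?_, fun a a' ha ha' k => ?_, fun a a' ha ha' k => ?_,
    fun a b c ha hc k k' => ?_⟩
  · exact h.side a a' ((s1 a).2 ha) ((s1 a').2 ha') (hle k)
  · exact h.side' a a' ((s2 a).2 ha) ((s2 a').2 ha') (hle k)
  · exact h.cross a a' ((s1 a).2 ha) ((s2 a').2 ha') (hle k)
  · exact h.path a b c ((s1 a).2 ha) ((s2 c).2 hc) (hle k) (hle k')

variable [DecidableEq V] {S : Finset (Sym2 V)} {s t : V}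

/-- The neighbours of a vertex in the graph with the given edges. -/
def nb (S : Finset (Sym2 V)) (a : V) : Finset V := univ.filter fun b => s(a, b) ∈ S

theorem mem_nb {a b : V} : b ∈ nb S a ↔ s(a, b) ∈ S := by simp [nb]

theorem mem_nb_comm {a b : V} : b ∈ nb S a ↔ a ∈ nb S b := by
  rw [mem_nb, mem_nb, Sym2.eq_swap]

theorem gr_adj_nb (hS : S ⊆ pairs V) {a b : V} : (gr S).Adj a b ↔ b ∈ nb S a := by
  rw [gr_adj' hS, mem_nb]

theorem deg_gr (hS : S ⊆ pairs V) (a : V) : deg (gr S) a = #(nb S a) := by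
  classical
  unfold deg nb
  simp only [gr_adj' hS]

/-- The triples which extend the edge `st` to a cycle of length five. -/
def pentagons (S : Finset (Sym2 V)) (s t : V) : Finset (V × V × V) :=
  univ.filter fun q => q.1 ∈ nb S s ∧ q.2.1 ∈ nb S t ∧ q.2.2 ∈ nb S q.1 ∧ q.2.2 ∈ nb S q.2.1 ∧
    q.2.1 ≠ s ∧ q.2.1 ≠ q.1 ∧ q.1 ≠ t ∧ q.2.2 ≠ s ∧ q.2.2 ≠ t

/-- The pairs of vertices joined by a path of length three or four through the edge `st`. -/
def throughPairs (S : Finset (Sym2 V)) (s t : V) : Finset (V × V) :=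
  (nb S s ×ˢ nb S t) ∪ (nb S s ×ˢ nb S t).biUnion fun q => (nb S q.2).image fun b => (q.1, b)

/-- The adjacent pairs of vertices for which the edge `st` matters, in one direction. -/
def nearPairs (S : Finset (Sym2 V)) (s t : V) : Finset (V × V) :=
  -- In order: edges at s, edges at the apex of a triangle on st, edges opposite st in a four-cycle,
  -- and edges not adjacent to st in a five-cycle through st, read off from its vertex next to s.
  (nb S s).image (fun b => (s, b)) ∪
  ((nb S s ∩ nb S t).biUnion fun a => (nb S a).image fun b => (a, b)) ∪
  (((nb S s).erase t).biUnion fun a => (nb S a ∩ nb S t).image fun b => (a, b)) ∪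
  (pentagons S s t).image fun q => (q.1, q.2.2)

/-- Membership in a set of pairs, for some orientation of the edge and of the pair. -/
def Sym (D : V → V → Finset (V × V)) (s t a b : V) : Prop :=
  (a, b) ∈ D s t ∨ (a, b) ∈ D t s ∨ (b, a) ∈ D s t ∨ (b, a) ∈ D t s

theorem Sym.comm {D : V → V → Finset (V × V)} {a b : V} (h : Sym D s t a b) : Sym D s t b a := by
  unfold Sym at *; tauto

theorem mem_throughPairs_three {a b : V} (h1 : a ∈ nb S s) (h2 : b ∈ nb S t) :
    (a, b) ∈ throughPairs S s t :=
  mem_union_left _ (mem_product.2 ⟨h1, h2⟩)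

theorem mem_throughPairs_four {a b c : V} (h1 : a ∈ nb S s) (h2 : c ∈ nb S t) (h3 : b ∈ nb S c) :
    (a, b) ∈ throughPairs S s t :=
  mem_union_right _ (mem_biUnion.2 ⟨(a, c), mem_product.2 ⟨h1, h2⟩, mem_image.2 ⟨b, h3, rfl⟩⟩)

theorem mem_nearPairs_star {b : V} (h : b ∈ nb S s) : (s, b) ∈ nearPairs S s t :=
  mem_union_left _ (mem_union_left _ (mem_union_left _ (mem_image.2 ⟨b, h, rfl⟩)))

theorem mem_nearPairs_triangle {a b : V} (h1 : a ∈ nb S s) (h2 : a ∈ nb S t) (h3 : b ∈ nb S a) :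
    (a, b) ∈ nearPairs S s t :=
  mem_union_left _ (mem_union_left _ (mem_union_right _
    (mem_biUnion.2 ⟨a, mem_inter.2 ⟨h1, h2⟩, mem_image.2 ⟨b, h3, rfl⟩⟩)))

theorem mem_nearPairs_square {a b : V} (h1 : a ∈ nb S s) (ha : a ≠ t) (h2 : b ∈ nb S t)
    (h3 : b ∈ nb S a) : (a, b) ∈ nearPairs S s t :=
  mem_union_left _ (mem_union_right _
    (mem_biUnion.2 ⟨a, mem_erase.2 ⟨ha, h1⟩, mem_image.2 ⟨b, mem_inter.2 ⟨h3, h2⟩, rfl⟩⟩))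

theorem mem_nearPairs_pentagon {a b c : V} (h1 : a ∈ nb S s) (h2 : c ∈ nb S t) (h3 : b ∈ nb S a)
    (h4 : b ∈ nb S c) (h5 : c ≠ s) (h6 : c ≠ a) (h7 : a ≠ t) (h8 : b ≠ s) (h9 : b ≠ t) :
    (a, b) ∈ nearPairs S s t :=
  mem_union_right _ (mem_image.2 ⟨(a, c, b), by simp [pentagons, *], rfl⟩)

theorem mk_eq_iff {a b : V} : s(a, b) = s(s, t) ↔ (a = s ∧ b = t) ∨ (a = t ∧ b = s) := by
  simp

/-- If the removal of an edge creates a good quadruple without touching its four vertices, then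
the edge lies on a short path between these vertices. -/
theorem near_of_noShort_erase (hS : S ⊆ pairs V) (hp : StarPair (gr S) x y u v)
    (hn' : NoShort (gr (S.erase s(s, t))) x y u v) (hn : ¬ NoShort (gr S) x y u v)
    (hQ : ∀ q, (q = x ∨ q = y ∨ q = u ∨ q = v) → q ≠ s ∧ q ≠ t) :
    Sym (nearPairs S) s t x y ∨ Sym (nearPairs S) s t u v ∨ Sym (throughPairs S) s t x u ∨
      Sym (throughPairs S) s t y v ∨ Sym (throughPairs S) s t x v ∨
      Sym (throughPairs S) s t u y := by
  by_contra hcon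
  push Not at hcon
  obtain ⟨c1, c2, c3, c4, c5, c6⟩ := hcon
  have hS' : S.erase s(s, t) ⊆ pairs V := (erase_subset _ _).trans hS
  have hadj' : ∀ {a b}, (gr S).Adj a b → s(a, b) ≠ s(s, t) →
      (gr (S.erase s(s, t))).Adj a b := by
    intro a b h h'
    rw [gr_adj' hS] at h
    rw [gr_adj' hS']
    exact mem_erase.2 ⟨h', h⟩
  have hstar : ∀ q, (q = x ∨ q = y ∨ q = u ∨ q = v) → ∀ z,
      ((gr S).Adj q z ↔ (gr (S.erase s(s, t))).Adj q z) := by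
    intro q hq z
    rw [gr_adj' hS, gr_adj' hS', mem_erase]
    refine ⟨fun h => ⟨fun h' => ?_, h⟩, fun h => h.2⟩
    have := hQ q hq
    rcases mk_eq_iff.1 h' with h | h
    · exact this.1 h.1
    · exact this.2 h.1
  have e1 := hstar x (by simp)
  have e2 := hstar y (by simp)
  have e3 := hstar u (by simp)
  have e4 := hstar v (by simp)
  have s1 := side_congr (y := y) (v := v) e1 e3
  have s2 := side_congr (y := x) (v := u) e2 e4
  have q1 := hQ x (by simp)
  have q2 := hQ y (by simp)
  have q3 := hQ u (by simp)
  have q4 := hQ v (by simp)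
  have hxy := hp.xy
  have huv := hp.uv
  have hxy' := hxy.symm
  have huv' := huv.symm
  rw [gr_adj_nb hS] at hxy huv hxy' huv'
  have key1 : ∀ a, Side (gr S) x y u v a → (a ∈ nb S x ∧ x ∈ nb S a) ∨ (a ∈ nb S u ∧ u ∈ nb S a) := by
    intro a h
    unfold Side at h
    rw [gr_adj_nb hS, gr_adj_nb hS] at h
    rcases h with h | h
    · exact Or.inl ⟨h.1, mem_nb_comm.1 h.1⟩
    · exact Or.inr ⟨h.1, mem_nb_comm.1 h.1⟩
  have key2 : ∀ a, Side (gr S) y x v u a → (a ∈ nb S y ∧ y ∈ nb S a) ∨ (a ∈ nb S v ∧ v ∈ nb S a) := by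
    intro a h
    unfold Side at h
    rw [gr_adj_nb hS, gr_adj_nb hS] at h
    rcases h with h | h
    · exact Or.inl ⟨h.1, mem_nb_comm.1 h.1⟩
    · exact Or.inr ⟨h.1, mem_nb_comm.1 h.1⟩
  refine hn ⟨?_, ?_, ?_, ?_⟩
  · intro a a' ha ha' h
    by_cases he : s(a, a') = s(s, t)
    · rcases mk_eq_iff.1 he with ⟨rfl, rfl⟩ | ⟨rfl, rfl⟩ <;>
      rcases key1 _ ha with h1 | h1 <;> rcases key1 _ ha' with h2 | h2
      · exact c1 (Or.inl (mem_nearPairs_triangle h1.2 h2.2 hxy))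
      · exact c3 (Or.inl (mem_throughPairs_three h1.2 h2.2))
      · exact c3 (Or.inr (Or.inr (Or.inl (mem_throughPairs_three h1.2 h2.2))))
      · exact c2 (Or.inl (mem_nearPairs_triangle h1.2 h2.2 huv))
      · exact c1 (Or.inl (mem_nearPairs_triangle h2.2 h1.2 hxy))
      · exact c3 (Or.inr (Or.inl (mem_throughPairs_three h1.2 h2.2)))
      · exact c3 (Or.inl (mem_throughPairs_three h2.2 h1.2))
      · exact c2 (Or.inl (mem_nearPairs_triangle h2.2 h1.2 huv))
    · exact hn'.side a a' ((s1 a).1 ha) ((s1 a').1 ha') (hadj' h he)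
  · intro a a' ha ha' h
    by_cases he : s(a, a') = s(s, t)
    · rcases mk_eq_iff.1 he with ⟨rfl, rfl⟩ | ⟨rfl, rfl⟩ <;>
      rcases key2 _ ha with h1 | h1 <;> rcases key2 _ ha' with h2 | h2
      · exact c1 (Sym.comm (Or.inl (mem_nearPairs_triangle h1.2 h2.2 hxy')))
      · exact c4 (Or.inl (mem_throughPairs_three h1.2 h2.2))
      · exact c4 (Or.inr (Or.inr (Or.inl (mem_throughPairs_three h1.2 h2.2))))
      · exact c2 (Sym.comm (Or.inl (mem_nearPairs_triangle h1.2 h2.2 huv')))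
      · exact c1 (Sym.comm (Or.inl (mem_nearPairs_triangle h2.2 h1.2 hxy')))
      · exact c4 (Or.inr (Or.inl (mem_throughPairs_three h1.2 h2.2)))
      · exact c4 (Or.inl (mem_throughPairs_three h2.2 h1.2))
      · exact c2 (Sym.comm (Or.inl (mem_nearPairs_triangle h2.2 h1.2 huv')))
    · exact hn'.side' a a' ((s2 a).1 ha) ((s2 a').1 ha') (hadj' h he)
  · intro a a' ha ha' h
    by_cases he : s(a, a') = s(s, t)
    · rcases mk_eq_iff.1 he with ⟨rfl, rfl⟩ | ⟨rfl, rfl⟩ <;>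
      rcases key1 _ ha with h1 | h1 <;> rcases key2 _ ha' with h2 | h2
      · exact c1 (Or.inl (mem_nearPairs_square h1.2 q1.2 h2.2 (mem_nb_comm.1 hxy')))
      · exact c5 (Or.inl (mem_throughPairs_three h1.2 h2.2))
      · exact c6 (Or.inl (mem_throughPairs_three h1.2 h2.2))
      · exact c2 (Or.inl (mem_nearPairs_square h1.2 q3.2 h2.2 (mem_nb_comm.1 huv')))
      · exact c1 (Or.inr (Or.inl (mem_nearPairs_square h1.2 q1.1 h2.2 (mem_nb_comm.1 hxy'))))
      · exact c5 (Or.inr (Or.inl (mem_throughPairs_three h1.2 h2.2)))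
      · exact c6 (Or.inr (Or.inl (mem_throughPairs_three h1.2 h2.2)))
      · exact c2 (Or.inr (Or.inl (mem_nearPairs_square h1.2 q3.1 h2.2 (mem_nb_comm.1 huv'))))
    · exact hn'.cross a a' ((s1 a).1 ha) ((s2 a').1 ha') (hadj' h he)
  · intro a b c ha hc h h'
    -- These inequalities make the five-cycle nondegenerate, as `pentagons` demands. Without them
    -- its five edges need not be distinct, and the expected number of pentagons could not be
    -- bounded by n⁵p⁵.
    have hac : a ≠ c := by
      rintro rfl
      unfold Side at ha hc
      rcases ha with ha | ha <;> rcases hc with hc | hc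
      · exact hp.cxy a ha.1 hc.1
      · exact hp.cxv a ha.1 hc.1
      · exact hp.cyu a hc.1 ha.1
      · exact hp.cuv a ha.1 hc.1
    have hcx : c ≠ x := by
      rintro rfl
      rcases hc with hc | hc
      · exact hc.2 rfl
      · exact hp.nxv hc.1.symm
    have hcu : c ≠ u := by
      rintro rfl
      rcases hc with hc | hc
      · exact hp.nyu hc.1
      · exact hc.2 rfl
    have hay : a ≠ y := by
      rintro rfl
      rcases ha with ha | ha
      · exact ha.2 rfl
      · exact hp.nyu ha.1.symm
    have hav : a ≠ v := by
      rintro rfl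
      rcases ha with ha | ha
      · exact hp.nxv ha.1
      · exact ha.2 rfl
    have hab' := (gr_adj_nb hS).1 h
    have hbc' := (gr_adj_nb hS).1 h'
    by_cases he : s(a, b) = s(s, t)
    · rcases mk_eq_iff.1 he with ⟨rfl, rfl⟩ | ⟨rfl, rfl⟩ <;>
      rcases key1 _ ha with h1 | h1 <;> rcases key2 _ hc with h2 | h2
      · exact c1 (Or.inl (mem_nearPairs_pentagon h1.2 hbc' hxy h2.2 hac.symm hcx q1.2 q2.1 q2.2))
      · exact c5 (Or.inl (mem_throughPairs_four h1.2 hbc' h2.2))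
      · exact c6 (Or.inl (mem_throughPairs_four h1.2 hbc' h2.2))
      · exact c2 (Or.inl (mem_nearPairs_pentagon h1.2 hbc' huv h2.2 hac.symm hcu q3.2 q4.1 q4.2))
      · exact c1 (Or.inr (Or.inl
          (mem_nearPairs_pentagon h1.2 hbc' hxy h2.2 hac.symm hcx q1.1 q2.2 q2.1)))
      · exact c5 (Or.inr (Or.inl (mem_throughPairs_four h1.2 hbc' h2.2)))
      · exact c6 (Or.inr (Or.inl (mem_throughPairs_four h1.2 hbc' h2.2)))
      · exact c2 (Or.inr (Or.inl
          (mem_nearPairs_pentagon h1.2 hbc' huv h2.2 hac.symm hcu q3.1 q4.2 q4.1)))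
    · by_cases he' : s(b, c) = s(s, t)
      · have hba := mem_nb_comm.1 hab'
        rcases mk_eq_iff.1 he' with ⟨rfl, rfl⟩ | ⟨rfl, rfl⟩ <;>
        rcases key1 _ ha with h1 | h1 <;> rcases key2 _ hc with h2 | h2
        · exact c1 (Sym.comm (Or.inr (Or.inl
            (mem_nearPairs_pentagon h2.2 hba hxy' h1.2 hac hay q2.1 q1.2 q1.1))))
        · exact c5 (Sym.comm (Or.inr (Or.inl (mem_throughPairs_four h2.2 hba h1.2))))
        · exact c6 (Sym.comm (Or.inr (Or.inl (mem_throughPairs_four h2.2 hba h1.2))))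
        · exact c2 (Sym.comm (Or.inr (Or.inl
            (mem_nearPairs_pentagon h2.2 hba huv' h1.2 hac hav q4.1 q3.2 q3.1))))
        · exact c1 (Sym.comm (Or.inl
            (mem_nearPairs_pentagon h2.2 hba hxy' h1.2 hac hay q2.2 q1.1 q1.2)))
        · exact c5 (Sym.comm (Or.inl (mem_throughPairs_four h2.2 hba h1.2)))
        · exact c6 (Sym.comm (Or.inl (mem_throughPairs_four h2.2 hba h1.2)))
        · exact c2 (Sym.comm (Or.inl
            (mem_nearPairs_pentagon h2.2 hba huv' h1.2 hac hav q4.2 q3.1 q3.2)))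
      · exact hn'.path a b c ((s1 a).1 ha) ((s2 c).1 hc) (hadj' h he) (hadj' h' he')

/-- The edges `xy` and `uv` can be switched. -/
def Good (lo hi : ℝ) (G : SimpleGraph V) (x y u v : V) : Prop :=
  StarEvent lo hi G x y u v ∧ NoShort G x y u v

/-- If st touches one of the four vertices, it is incident with xy or uv. Otherwise the four stars
agree in both graphs, so only `NoShort` can change, and a removal can only create it; then st lies
on a forbidden short path. -/
theorem near_of_good_ne (hS : S ⊆ pairs V)
    (h : ¬ (Good lo hi (gr S) x y u v ↔ Good lo hi (gr (S.erase s(s, t))) x y u v)) :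
    y ∈ nb S x ∧ v ∈ nb S u ∧ (Sym (nearPairs S) s t x y ∨ Sym (nearPairs S) s t u v ∨
      Sym (throughPairs S) s t x u ∨ Sym (throughPairs S) s t y v ∨ Sym (throughPairs S) s t x v ∨
      Sym (throughPairs S) s t u y) := by
  have hS' : S.erase s(s, t) ⊆ pairs V := (erase_subset _ _).trans hS
  have hle : gr (S.erase s(s, t)) ≤ gr S := by
    intro a b h
    rw [gr_adj' hS'] at h
    rw [gr_adj' hS]
    exact mem_of_mem_erase h
  have hor : Good lo hi (gr S) x y u v ∨ Good lo hi (gr (S.erase s(s, t))) x y u v := by tauto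
  have hxy : (gr S).Adj x y := by
    rcases hor with h | h
    · exact h.1.pair.xy
    · exact hle h.1.pair.xy
  have huv : (gr S).Adj u v := by
    rcases hor with h | h
    · exact h.1.pair.uv
    · exact hle h.1.pair.uv
  have hxy' := hxy.symm
  have huv' := huv.symm
  rw [gr_adj_nb hS] at hxy huv hxy' huv'
  refine ⟨hxy, huv, ?_⟩
  by_cases hQ : ∀ q, (q = x ∨ q = y ∨ q = u ∨ q = v) → q ≠ s ∧ q ≠ t
  · have hstar : ∀ q, (q = x ∨ q = y ∨ q = u ∨ q = v) → ∀ z,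
        ((gr S).Adj q z ↔ (gr (S.erase s(s, t))).Adj q z) := by
      intro q hq z
      rw [gr_adj' hS, gr_adj' hS', mem_erase]
      refine ⟨fun h => ⟨fun h' => ?_, h⟩, fun h => h.2⟩
      have := hQ q hq
      rcases mk_eq_iff.1 h' with h | h
      · exact this.1 h.1
      · exact this.2 h.1
    have e1 := hstar x (by simp)
    have e2 := hstar y (by simp)
    have e3 := hstar u (by simp)
    have e4 := hstar v (by simp)
    have hG' : Good lo hi (gr (S.erase s(s, t))) x y u v := by
      rcases hor with h1 | h1
      · exact ⟨h1.1.congr e1 e2 e3 e4, h1.2.anti hle e1 e2 e3 e4⟩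
      · exact h1
    have hst : StarEvent lo hi (gr S) x y u v :=
      hG'.1.congr (fun z => (e1 z).symm) (fun z => (e2 z).symm) (fun z => (e3 z).symm)
        fun z => (e4 z).symm
    have hn : ¬ NoShort (gr S) x y u v := fun hn => h ⟨fun _ => hG', fun _ => ⟨hst, hn⟩⟩
    exact near_of_noShort_erase hS hst.pair hG'.2 hn hQ
  · push Not at hQ
    obtain ⟨q, hq, hqs⟩ := hQ
    have hq' : q = s ∨ q = t := by
      by_cases h : q = s
      · exact Or.inl h
      · exact Or.inr (hqs h)
    rcases hq with rfl | rfl | rfl | rfl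
    · left
      rcases hq' with rfl | rfl
      · exact Or.inl (mem_nearPairs_star hxy)
      · exact Or.inr (Or.inl (mem_nearPairs_star hxy))
    · left
      rcases hq' with rfl | rfl
      · exact Sym.comm (Or.inl (mem_nearPairs_star hxy'))
      · exact Sym.comm (Or.inr (Or.inl (mem_nearPairs_star hxy')))
    · right; left
      rcases hq' with rfl | rfl
      · exact Or.inl (mem_nearPairs_star huv)
      · exact Or.inr (Or.inl (mem_nearPairs_star huv))
    · right; left
      rcases hq' with rfl | rfl
      · exact Sym.comm (Or.inl (mem_nearPairs_star huv'))
      · exact Sym.comm (Or.inr (Or.inl (mem_nearPairs_star huv')))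

end Sensitivity

end Shotgun

namespace Shotgun

open Finset

/-! ### The variance of the number of good quadruples. -/

section Variance

variable {V : Type u} [Fintype V] [DecidableEq V] {S : Finset (Sym2 V)} {s t : V} {lo hi : ℝ}
  {K c : ℕ}

open Classical in
/-- The number of pairs of edges which can be switched. -/
noncomputable def goodCount (lo hi : ℝ) (S : Finset (Sym2 V)) : ℝ :=
  ∑ q : V × V × V × V, if Good lo hi (gr S) q.1 q.2.1 q.2.2.1 q.2.2.2 then 1 else 0

/-- The degrees and the codegrees are bounded. -/
def BoundedDegrees (K c : ℕ) (S : Finset (Sym2 V)) : Prop :=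
  (∀ a, #(nb S a) ≤ K) ∧ ∀ a b, a ≠ b → #(nb S a ∩ nb S b) ≤ c

/-- All orientations of the pairs in a set which depends on an oriented edge. -/
def symPairs (D : V → V → Finset (V × V)) (s t : V) : Finset (V × V) :=
  (D s t ∪ D t s) ∪ (D s t ∪ D t s).image Prod.swap

theorem mem_symPairs {D : V → V → Finset (V × V)} {a b : V} (h : Sym D s t a b) :
    (a, b) ∈ symPairs D s t := by
  unfold symPairs
  rcases h with h | h | h | h
  · exact mem_union_left _ (mem_union_left _ h)
  · exact mem_union_left _ (mem_union_right _ h)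
  · exact mem_union_right _ (mem_image.2 ⟨(b, a), mem_union_left _ h, rfl⟩)
  · exact mem_union_right _ (mem_image.2 ⟨(b, a), mem_union_right _ h, rfl⟩)

theorem card_symPairs_le (D : V → V → Finset (V × V)) (s t : V) :
    #(symPairs D s t) ≤ 2 * (#(D s t) + #(D t s)) := by
  have h1 := card_union_le (D s t ∪ D t s) ((D s t ∪ D t s).image Prod.swap)
  have h2 := card_union_le (D s t) (D t s)
  have h3 := card_image_le (s := D s t ∪ D t s) (f := Prod.swap)
  unfold symPairs
  omega

theorem card_throughPairs_le (hb : BoundedDegrees K c S) (s t : V) :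
    #(throughPairs S s t) ≤ K ^ 2 + K ^ 3 := by
  have h1 : #(nb S s ×ˢ nb S t) ≤ K ^ 2 := by
    rw [card_product, sq]
    exact Nat.mul_le_mul (hb.1 s) (hb.1 t)
  have h2 := card_biUnion_le_card_mul (nb S s ×ˢ nb S t)
    (fun q => (nb S q.2).image fun b => (q.1, b)) K fun q _ => card_image_le.trans (hb.1 q.2)
  refine (card_union_le _ _).trans (add_le_add h1 (h2.trans ?_))
  calc _ ≤ K ^ 2 * K := Nat.mul_le_mul_right _ h1
    _ = K ^ 3 := by ring

theorem card_nearPairs_le (hb : BoundedDegrees K c S) (hst : s ≠ t) :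
    #(nearPairs S s t) ≤ K + 2 * (c * K) + #(pentagons S s t) := by
  have h1 : #((nb S s).image fun b => (s, b)) ≤ K := card_image_le.trans (hb.1 s)
  have h2 : #((nb S s ∩ nb S t).biUnion fun a => (nb S a).image fun b => (a, b)) ≤ c * K :=
    (card_biUnion_le_card_mul _ _ K fun a _ => card_image_le.trans (hb.1 a)).trans
      (Nat.mul_le_mul_right _ (hb.2 s t hst))
  have h3 : #(((nb S s).erase t).biUnion fun a => (nb S a ∩ nb S t).image fun b => (a, b)) ≤
      K * c :=
    (card_biUnion_le_card_mul _ _ c fun a ha =>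
      card_image_le.trans (hb.2 a t (ne_of_mem_erase ha))).trans
      (Nat.mul_le_mul_right _ ((card_le_card (erase_subset _ _)).trans (hb.1 s)))
  have h4 : #((pentagons S s t).image fun q => (q.1, q.2.2)) ≤ #(pentagons S s t) := card_image_le
  unfold nearPairs
  refine (card_union_le _ _).trans (add_le_add ((card_union_le _ _).trans ?_) h4)
  have h5 := card_union_le ((nb S s).image fun b => (s, b))
    ((nb S s ∩ nb S t).biUnion fun a => (nb S a).image fun b => (a, b))
  rw [mul_comm K c] at h3
  omega

/-- The neighbours of s and t on the cycle are chosen in K² ways; the last vertex is a common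
neighbour of these two distinct vertices. -/
theorem card_pentagons_le (hb : BoundedDegrees K c S) (s t : V) :
    #(pentagons S s t) ≤ K ^ 2 * c := by
  have hsub : pentagons S s t ⊆ ((nb S s ×ˢ nb S t).filter fun q => q.2 ≠ q.1).biUnion fun q =>
      (nb S q.1 ∩ nb S q.2).image fun b => (q.1, q.2, b) := by
    rintro ⟨a, d, b⟩ h
    simp only [pentagons, mem_filter, mem_univ, true_and] at h
    obtain ⟨h1, h2, h3, h4, -, h5, -⟩ := h
    simp only [mem_biUnion, mem_filter, mem_product, mem_image, mem_inter]
    exact ⟨(a, d), ⟨⟨h1, h2⟩, h5⟩, b, ⟨h3, h4⟩, rfl⟩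
  refine (card_le_card hsub).trans ((card_biUnion_le_card_mul _ _ c fun q hq =>
    card_image_le.trans (hb.2 _ _ (mem_filter.1 hq).2.symm)).trans (Nat.mul_le_mul_right _ ?_))
  refine (card_filter_le _ _).trans ?_
  rw [card_product, sq]
  exact Nat.mul_le_mul (hb.1 s) (hb.1 t)

/-- The oriented edges. -/
def arcs (S : Finset (Sym2 V)) : Finset (V × V) :=
  (univ : Finset V).biUnion fun a => (nb S a).image fun b => (a, b)

theorem mem_arcs {a b : V} : (a, b) ∈ arcs S ↔ b ∈ nb S a := by
  simp [arcs]

theorem card_arcs_le (hb : BoundedDegrees K c S) : #(arcs S) ≤ Fintype.card V * K :=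
  card_biUnion_le_card_mul _ _ K fun a _ => card_image_le.trans (hb.1 a)

/-- The good quadruples which a given edge affects are among these. -/
def affected (S : Finset (Sym2 V)) (s t : V) : Finset (V × V × V × V) :=
  let D := symPairs (nearPairs S) s t
  let E := symPairs (throughPairs S) s t
  ((D ×ˢ arcs S).image fun q => (q.1.1, q.1.2, q.2.1, q.2.2)) ∪
  ((D ×ˢ arcs S).image fun q => (q.2.1, q.2.2, q.1.1, q.1.2)) ∪
  (E.biUnion fun d => (nb S d.1 ×ˢ nb S d.2).image fun q => (d.1, q.1, d.2, q.2)) ∪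
  (E.biUnion fun d => (nb S d.1 ×ˢ nb S d.2).image fun q => (q.1, d.1, q.2, d.2)) ∪
  (E.biUnion fun d => (nb S d.1 ×ˢ nb S d.2).image fun q => (d.1, q.1, q.2, d.2)) ∪
  (E.biUnion fun d => (nb S d.1 ×ˢ nb S d.2).image fun q => (q.2, d.2, d.1, q.1))

theorem mem_affected (hS : S ⊆ pairs V) {x y u v : V}
    (h : ¬ (Good lo hi (gr S) x y u v ↔ Good lo hi (gr (S.erase s(s, t))) x y u v)) :
    (x, y, u, v) ∈ affected S s t := by
  obtain ⟨hxy, huv, h⟩ := near_of_good_ne hS h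
  have hyx := mem_nb_comm.1 hxy
  have hvu := mem_nb_comm.1 huv
  simp only [affected, mem_union, mem_image, mem_biUnion, mem_product]
  rcases h with h | h | h | h | h | h
  · exact Or.inl (Or.inl (Or.inl (Or.inl (Or.inl
      ⟨((x, y), (u, v)), ⟨mem_symPairs h, mem_arcs.2 huv⟩, rfl⟩))))
  · exact Or.inl (Or.inl (Or.inl (Or.inl (Or.inr
      ⟨((u, v), (x, y)), ⟨mem_symPairs h, mem_arcs.2 hxy⟩, rfl⟩))))
  · exact Or.inl (Or.inl (Or.inl (Or.inr ⟨(x, u), mem_symPairs h, (y, v), ⟨hxy, huv⟩, rfl⟩)))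
  · exact Or.inl (Or.inl (Or.inr ⟨(y, v), mem_symPairs h, (x, u), ⟨hyx, hvu⟩, rfl⟩))
  · exact Or.inl (Or.inr ⟨(x, v), mem_symPairs h, (y, u), ⟨hxy, hvu⟩, rfl⟩)
  · exact Or.inr ⟨(u, y), mem_symPairs h, (v, x), ⟨huv, hyx⟩, rfl⟩

/-- A pair near st is one of the two switched edges, and the other edge is arbitrary, with at most
nK choices. A pair joined through st has one end in each switched edge, so K² choices complete it.
Pentagons stay explicit, as their worst-case number is too large for the variance. -/
theorem card_affected_le (hb : BoundedDegrees K c S) (hst : s ≠ t) :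
    #(affected S s t) ≤ 8 * Fintype.card V * K ^ 2 * (1 + 2 * c) + 16 * (K ^ 4 + K ^ 5) +
      4 * Fintype.card V * K * (#(pentagons S s t) + #(pentagons S t s)) := by
  have hD : #(symPairs (nearPairs S) s t) ≤
      4 * (K + 2 * (c * K)) + 2 * (#(pentagons S s t) + #(pentagons S t s)) := by
    have h1 := card_symPairs_le (nearPairs S) s t
    have h2 := card_nearPairs_le hb hst
    have h3 := card_nearPairs_le hb hst.symm
    omega
  have hE : #(symPairs (throughPairs S) s t) ≤ 4 * (K ^ 2 + K ^ 3) := by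
    have h1 := card_symPairs_le (throughPairs S) s t
    have h2 := card_throughPairs_le hb s t
    have h3 := card_throughPairs_le hb t s
    omega
  set D := symPairs (nearPairs S) s t
  set E := symPairs (throughPairs S) s t
  have hDA : #(D ×ˢ arcs S) ≤ #D * (Fintype.card V * K) := by
    rw [card_product]
    exact Nat.mul_le_mul_left _ (card_arcs_le hb)
  have hEK : ∀ f : V × V → V × V → V × V × V × V,
      #(E.biUnion fun d => (nb S d.1 ×ˢ nb S d.2).image (f d)) ≤ #E * (K * K) := fun f =>
    card_biUnion_le_card_mul _ _ _ fun d _ => card_image_le.trans (by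
      rw [card_product]; exact Nat.mul_le_mul (hb.1 _) (hb.1 _))
  have hall : #(affected S s t) ≤ 2 * (#D * (Fintype.card V * K)) + 4 * (#E * (K * K)) := by
    unfold affected
    refine (card_union_le _ _).trans ?_
    refine (add_le_add_left (card_union_le _ _) _).trans ?_
    refine (add_le_add_left (add_le_add_left (card_union_le _ _) _) _).trans ?_
    refine (add_le_add_left (add_le_add_left (add_le_add_left (card_union_le _ _) _) _) _).trans ?_
    refine (add_le_add_left (add_le_add_left (add_le_add_left
      (add_le_add_left (card_union_le _ _) _) _) _) _).trans ?_
    have a1 := (card_image_le (s := D ×ˢ arcs S)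
      (f := fun q => (q.1.1, q.1.2, q.2.1, q.2.2))).trans hDA
    have a2 := (card_image_le (s := D ×ˢ arcs S)
      (f := fun q => (q.2.1, q.2.2, q.1.1, q.1.2))).trans hDA
    have a3 := hEK fun d q => (d.1, q.1, d.2, q.2)
    have a4 := hEK fun d q => (q.1, d.1, q.2, d.2)
    have a5 := hEK fun d q => (d.1, q.1, q.2, d.2)
    have a6 := hEK fun d q => (q.2, d.2, d.1, q.1)
    exact (add_le_add (add_le_add (add_le_add (add_le_add (add_le_add a1 a2) a3) a4) a5) a6).trans
      (le_of_eq (by ring))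
  refine hall.trans ?_
  have b1 := Nat.mul_le_mul_right (2 * (Fintype.card V * K)) hD
  have b2 := Nat.mul_le_mul_right (4 * (K * K)) hE
  calc _ = #D * (2 * (Fintype.card V * K)) + #E * (4 * (K * K)) := by ring
    _ ≤ _ := add_le_add b1 b2
    _ = _ := by ring

theorem abs_goodCount_sub_le (hS : S ⊆ pairs V) (s t : V) :
    |goodCount lo hi S - goodCount lo hi (S.erase s(s, t))| ≤ #(affected S s t) := by
  classical
  unfold goodCount
  rw [← sum_sub_distrib]
  refine (abs_sum_le_sum_abs _ _).trans ?_
  rw [card_eq_sum_ones, Nat.cast_sum, ← sum_filter_add_sum_filter_not univ (· ∈ affected S s t)]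
  have h2 : ∑ q ∈ univ.filter (fun q => q ∉ affected S s t),
      |(if Good lo hi (gr S) q.1 q.2.1 q.2.2.1 q.2.2.2 then (1 : ℝ) else 0) -
        if Good lo hi (gr (S.erase s(s, t))) q.1 q.2.1 q.2.2.1 q.2.2.2 then 1 else 0| = 0 := by
    refine sum_eq_zero fun q hq => ?_
    have : Good lo hi (gr S) q.1 q.2.1 q.2.2.1 q.2.2.2 ↔
        Good lo hi (gr (S.erase s(s, t))) q.1 q.2.1 q.2.2.1 q.2.2.2 := by
      by_contra h
      exact (mem_filter.1 hq).2 (mem_affected hS h)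
    simp [this]
  rw [h2, add_zero, filter_mem_eq_inter, univ_inter]
  refine sum_le_sum fun q _ => ?_
  split_ifs <;> simp

/-- The sum of the squared influences of the edges, if degrees and codegrees are bounded. -/
theorem sum_sq_influence_le (hS : S ⊆ pairs V) (hb : BoundedDegrees K c S) :
    ∑ e ∈ S, (goodCount lo hi S - goodCount lo hi (S.erase e)) ^ 2 ≤
      2 * (Fintype.card V * K) * (8 * Fintype.card V * K ^ 2 * (1 + 2 * c) +
        16 * (K ^ 4 + K ^ 5) : ℝ) ^ 2 +
      128 * (Fintype.card V) ^ 2 * K ^ 4 * c * ∑ q ∈ arcs S, (#(pentagons S q.1 q.2) : ℝ) := by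
  set n : ℝ := (Fintype.card V : ℝ) with hn
  set A : ℝ := 8 * n * K ^ 2 * (1 + 2 * c) + 16 * (K ^ 4 + K ^ 5) with hA
  have h1 : ∑ e ∈ S, (goodCount lo hi S - goodCount lo hi (S.erase e)) ^ 2 ≤
      ∑ q ∈ arcs S, (goodCount lo hi S - goodCount lo hi (S.erase s(q.1, q.2))) ^ 2 := by
    have himg : S ⊆ (arcs S).image fun q => s(q.1, q.2) := by
      intro e he
      induction e with
      | _ a b => exact mem_image.2 ⟨(a, b), mem_arcs.2 (mem_nb.2 he), rfl⟩
    refine (sum_le_sum_of_subset_of_nonneg himg fun e _ _ => sq_nonneg _).trans ?_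
    exact sum_image_le_of_nonneg (s := arcs S) (g := fun q : V × V => s(q.1, q.2))
      (f := fun e => (goodCount lo hi S - goodCount lo hi (S.erase e)) ^ 2)
      (fun e _ => sq_nonneg _)
  have h2 : ∀ q ∈ arcs S, (goodCount lo hi S - goodCount lo hi (S.erase s(q.1, q.2))) ^ 2 ≤
      2 * A ^ 2 + 64 * n ^ 2 * K ^ 4 * c * (#(pentagons S q.1 q.2) + #(pentagons S q.2 q.1)) := by
    rintro ⟨s, t⟩ hq
    have hst : s ≠ t := mem_pairs.1 (hS (mem_nb.1 (mem_arcs.1 hq)))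
    have h3 := abs_goodCount_sub_le (lo := lo) (hi := hi) hS s t
    have h4 : (#(affected S s t) : ℝ) ≤
        A + 4 * n * K * (#(pentagons S s t) + #(pentagons S t s)) := by
      have := card_affected_le hb hst
      have h5 : (#(affected S s t) : ℝ) ≤ ((8 * Fintype.card V * K ^ 2 * (1 + 2 * c) +
        16 * (K ^ 4 + K ^ 5) +
        4 * Fintype.card V * K * (#(pentagons S s t) + #(pentagons S t s)) : ℕ) : ℝ) := by
        exact_mod_cast this
      push_cast at h5
      exact h5
    have p1 : (#(pentagons S s t) : ℝ) ≤ K ^ 2 * c := by exact_mod_cast card_pentagons_le hb s t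
    have p2 : (#(pentagons S t s) : ℝ) ≤ K ^ 2 * c := by exact_mod_cast card_pentagons_le hb t s
    set a : ℝ := (#(pentagons S s t) : ℝ)
    set b : ℝ := (#(pentagons S t s) : ℝ)
    have ha : 0 ≤ a := by positivity
    have hb0 : 0 ≤ b := by positivity
    have hA0 : 0 ≤ A := by positivity
    have hnK : 0 ≤ 16 * n ^ 2 * (K : ℝ) ^ 2 := by positivity
    -- Only one factor is bounded by the worst case. The other is kept linear so that it can be
    -- replaced by its much smaller expectation.
    have h6 : (a + b) ^ 2 ≤ 2 * (K ^ 2 * c) * (a + b) := by nlinarith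
    dsimp only
    rw [← sq_abs]
    calc _ ≤ (A + 4 * n * K * (a + b)) ^ 2 := pow_le_pow_left₀ (abs_nonneg _) (h3.trans h4) 2
      _ ≤ 2 * A ^ 2 + 2 * (4 * n * K * (a + b)) ^ 2 := by
          nlinarith [sq_nonneg (A - 4 * n * K * (a + b))]
      _ = 2 * A ^ 2 + 2 * (16 * n ^ 2 * K ^ 2 * (a + b) ^ 2) := by ring
      _ ≤ 2 * A ^ 2 + 2 * (16 * n ^ 2 * K ^ 2 * (2 * (K ^ 2 * c) * (a + b))) := by
          have := mul_le_mul_of_nonneg_left h6 hnK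
          linarith
      _ = _ := by ring
  refine h1.trans ((sum_le_sum h2).trans ?_)
  rw [sum_add_distrib, sum_const, nsmul_eq_mul, ← mul_sum, sum_add_distrib]
  have h7 : ∑ q ∈ arcs S, (#(pentagons S q.2 q.1) : ℝ) =
      ∑ q ∈ arcs S, (#(pentagons S q.1 q.2) : ℝ) := by
    refine sum_bij' (fun q _ => q.swap) (fun q _ => q.swap) ?_ ?_ ?_ ?_ ?_
    · rintro ⟨a, b⟩ h; exact mem_arcs.2 (mem_nb_comm.1 (mem_arcs.1 h))
    · rintro ⟨a, b⟩ h; exact mem_arcs.2 (mem_nb_comm.1 (mem_arcs.1 h))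
    · simp
    · simp
    · simp
  rw [h7]
  have h8 : (#(arcs S) : ℝ) ≤ n * K := by rw [hn]; exact_mod_cast card_arcs_le hb
  have h9 : (#(arcs S) : ℝ) * (2 * A ^ 2) ≤ n * K * (2 * A ^ 2) :=
    mul_le_mul_of_nonneg_right h8 (by positivity)
  linarith

/-- Each of the n⁵ ordered choices of vertices which can occur needs five distinct edges and has
probability p⁵. -/
theorem ex_sum_pentagons_le {p : ℝ} (hp : 0 ≤ p) (hp1 : p ≤ 1) :
    (ex p (pairs V) fun S => ∑ q ∈ arcs S, (#(pentagons S q.1 q.2) : ℝ)) ≤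
      (Fintype.card V : ℝ) ^ 5 * p ^ 5 := by
  classical
  let T : V × V × V × V × V → Finset (Sym2 V) := fun w =>
    {s(w.1, w.2.1), s(w.1, w.2.2.1), s(w.2.1, w.2.2.2.1), s(w.2.2.1, w.2.2.2.2),
      s(w.2.2.2.1, w.2.2.2.2)}
  let Q : V × V × V × V × V → Prop := fun w => T w ⊆ pairs V ∧ #(T w) = 5
  have hle : ∀ S ⊆ pairs V, ∑ q ∈ arcs S, (#(pentagons S q.1 q.2) : ℝ) ≤
      ∑ w ∈ univ.filter Q, if T w ⊆ S then (1 : ℝ) else 0 := by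
    intro S hS
    rw [sum_boole, ← Nat.cast_sum, ← card_sigma]
    refine Nat.cast_le.2 (card_le_card_of_injOn
      (fun w => (w.1.1, w.1.2, w.2.1, w.2.2.1, w.2.2.2)) ?_ ?_)
    · rintro ⟨⟨s, t⟩, a, d, b⟩ hw
      simp only [coe_sigma, Set.mem_sigma_iff, mem_coe, mem_arcs, pentagons, mem_filter, mem_univ,
        true_and, mem_nb] at hw
      obtain ⟨h0, h1, h2, h3, h4, n1, n2, n3, n4, n5⟩ := hw
      have e0 := mem_pairs.1 (hS h0)
      have e1 := mem_pairs.1 (hS h1)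
      have e2 := mem_pairs.1 (hS h2)
      have e3 := mem_pairs.1 (hS h3)
      have e4 := mem_pairs.1 (hS h4)
      have hT : T (s, t, a, d, b) ⊆ S := by
        intro e he
        simp only [T, mem_insert, mem_singleton] at he
        rcases he with rfl | rfl | rfl | rfl | rfl <;> assumption
      simp only [coe_filter, mem_filter, mem_univ, true_and, Set.mem_ofPred_eq]
      refine ⟨⟨hT.trans hS, ?_⟩, hT⟩
      simp only [T]
      rw [card_insert_of_notMem, card_insert_of_notMem, card_insert_of_notMem,
        card_insert_of_notMem, card_singleton]
      all_goals
        simp only [mem_insert, mem_singleton, mk_eq_iff]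
        grind
    · rintro ⟨⟨s, t⟩, a, d, b⟩ - ⟨⟨s', t'⟩, a', d', b'⟩ - h
      simp only [Prod.mk.injEq] at h
      obtain ⟨rfl, rfl, rfl, rfl, rfl⟩ := h
      rfl
  refine (ex_mono hp hp1 hle).trans ?_
  rw [ex_sum]
  have h1 : ∀ w ∈ univ.filter Q, (ex p (pairs V) fun S => if T w ⊆ S then (1 : ℝ) else 0) =
      p ^ 5 := by
    intro w hw
    obtain ⟨h1, h2⟩ := (mem_filter.1 hw).2
    rw [← h2, ← pr_subset h1]
    exact ex_congr fun S _ => by by_cases h : T w ⊆ S <;> simp [h]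
  rw [sum_congr rfl h1, sum_const, nsmul_eq_mul]
  refine mul_le_mul_of_nonneg_right ?_ (by positivity)
  have : #(univ.filter Q) ≤ Fintype.card V ^ 5 := by
    refine (card_le_univ _).trans (le_of_eq ?_)
    simp only [Fintype.card_prod]
    ring
  exact_mod_cast this

/-- Union bound: over a vertex with K of its neighbours, needing K edges, and over two vertices with
c common neighbours, needing 2c edges. -/
theorem pr_not_boundedDegrees_le {p : ℝ} (hp : 0 ≤ p) (hp1 : p ≤ 1) (K c : ℕ) :
    pr p (pairs V) (fun S => ¬ BoundedDegrees K c S) ≤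
      Fintype.card V * ((Fintype.card V).choose K * p ^ K) +
        (Fintype.card V) ^ 2 * ((Fintype.card V).choose c * p ^ (2 * c)) := by
  classical
  have h1 : ∀ S ⊆ pairs V, ¬ BoundedDegrees K c S →
      (∃ w ∈ univ.sigma fun a : V => powersetCard K (univ.erase a),
        w.2.image (fun b => s(w.1, b)) ⊆ S) ∨
      ∃ w ∈ (univ.filter fun q : V × V => q.1 ≠ q.2).sigma fun q =>
        powersetCard c ((univ.erase q.1).erase q.2),
        w.2.image (fun b => s(w.1.1, b)) ∪ w.2.image (fun b => s(w.1.2, b)) ⊆ S := by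
    intro S hS h
    unfold BoundedDegrees at h
    rw [not_and_or] at h
    have hne : ∀ a, nb S a ⊆ univ.erase a := by
      intro a b hb
      exact mem_erase.2 ⟨(mem_pairs.1 (hS (mem_nb.1 hb))).symm, mem_univ _⟩
    rcases h with h | h
    · left
      push Not at h
      obtain ⟨a, ha⟩ := h
      obtain ⟨J, hJ, hJK⟩ := exists_subset_card_eq ha.le
      refine ⟨⟨a, J⟩, mem_sigma.2 ⟨mem_univ _, mem_powersetCard.2 ⟨hJ.trans (hne a), hJK⟩⟩, ?_⟩
      intro e he
      obtain ⟨b, hb, rfl⟩ := mem_image.1 he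
      exact mem_nb.1 (hJ hb)
    · right
      push Not at h
      obtain ⟨a, a', haa, ha⟩ := h
      obtain ⟨J, hJ, hJK⟩ := exists_subset_card_eq ha.le
      refine ⟨⟨(a, a'), J⟩, mem_sigma.2 ⟨mem_filter.2 ⟨mem_univ _, haa⟩,
        mem_powersetCard.2 ⟨fun b hb => ?_, hJK⟩⟩, ?_⟩
      · have hb' := mem_inter.1 (hJ hb)
        exact mem_erase.2 ⟨ne_of_mem_erase (hne a' hb'.2), hne a hb'.1⟩
      · refine union_subset (fun e he => ?_) fun e he => ?_ <;>
          obtain ⟨b, hb, rfl⟩ := mem_image.1 he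
        · exact mem_nb.1 (mem_inter.1 (hJ hb)).1
        · exact mem_nb.1 (mem_inter.1 (hJ hb)).2
  have hinj : ∀ a : V, Function.Injective fun b => s(a, b) := fun a b b' h => Sym2.congr_right.1 h
  have hsub : ∀ (a : V) (J : Finset V), a ∉ J → J.image (fun b => s(a, b)) ⊆ pairs V := by
    intro a J ha e he
    obtain ⟨b, hb, rfl⟩ := mem_image.1 he
    exact mem_pairs.2 fun h => ha (h ▸ hb)
  refine (pr_le_add hp hp1 h1).trans (add_le_add ?_ ?_)
  · refine (pr_le_sum hp hp1 _ _ fun S _ h => h).trans ?_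
    have h2 : ∀ w ∈ univ.sigma fun a : V => powersetCard K (univ.erase a),
        pr p (pairs V) (fun S => w.2.image (fun b => s(w.1, b)) ⊆ S) = p ^ K := by
      rintro ⟨a, J⟩ hw
      obtain ⟨hJ, hJK⟩ := mem_powersetCard.1 (mem_sigma.1 hw).2
      dsimp only at hJ hJK ⊢
      rw [pr_subset (hsub a J fun h => by simpa using hJ h), card_image_of_injective _ (hinj a), hJK]
    rw [sum_congr rfl h2, sum_const, nsmul_eq_mul, card_sigma, ← mul_assoc]
    refine mul_le_mul_of_nonneg_right ?_ (by positivity)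
    have : ∑ a : V, #(powersetCard K (univ.erase a)) ≤
        ∑ a : V, (Fintype.card V).choose K := by
      refine sum_le_sum fun a _ => ?_
      rw [card_powersetCard]
      exact Nat.choose_le_choose K (card_le_univ _)
    simp only [sum_const, smul_eq_mul, card_univ] at this
    exact_mod_cast this
  · refine (pr_le_sum hp hp1 _ _ fun S _ h => h).trans ?_
    have h2 : ∀ w ∈ (univ.filter fun q : V × V => q.1 ≠ q.2).sigma fun q =>
        powersetCard c ((univ.erase q.1).erase q.2), pr p (pairs V) (fun S =>
          w.2.image (fun b => s(w.1.1, b)) ∪ w.2.image (fun b => s(w.1.2, b)) ⊆ S) =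
          p ^ (2 * c) := by
      rintro ⟨⟨a, a'⟩, J⟩ hw
      obtain ⟨hq, hJ⟩ := mem_sigma.1 hw
      have haa := (mem_filter.1 hq).2
      obtain ⟨hJ, hJK⟩ := mem_powersetCard.1 hJ
      dsimp only at hJ hJK haa ⊢
      have ha : a ∉ J := fun h => by simpa using hJ h
      have ha' : a' ∉ J := fun h => by simpa using hJ h
      rw [pr_subset (union_subset (hsub a J ha) (hsub a' J ha')), card_union_of_disjoint,
        card_image_of_injective _ (hinj a), card_image_of_injective _ (hinj a'), hJK, two_mul]
      rw [disjoint_left]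
      intro e he he'
      obtain ⟨b, hb, rfl⟩ := mem_image.1 he
      obtain ⟨b', hb', h⟩ := mem_image.1 he'
      rcases mk_eq_iff.1 h with h | h
      · exact haa h.1.symm
      · exact ha' (h.1 ▸ hb)
    rw [sum_congr rfl h2, sum_const, nsmul_eq_mul, card_sigma, ← mul_assoc]
    refine mul_le_mul_of_nonneg_right ?_ (by positivity)
    have : ∑ q ∈ univ.filter (fun q : V × V => q.1 ≠ q.2),
        #(powersetCard c ((univ.erase q.1).erase q.2)) ≤
        ∑ q : V × V, (Fintype.card V).choose c := by
      refine (sum_le_sum fun q _ => ?_).trans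
        (sum_le_sum_of_subset_of_nonneg (filter_subset _ _) fun _ _ _ => Nat.zero_le _)
      rw [card_powersetCard]
      exact Nat.choose_le_choose c (card_le_univ _)
    simp only [sum_const, smul_eq_mul, card_univ, Fintype.card_prod] at this
    have h3 := (Nat.cast_le (α := ℝ)).2 this
    push_cast at h3 ⊢
    linarith

/-- A crude bound for graphs with large degrees or codegrees: the count lies between 0 and n⁴, and
there are at most n² edges. The small probability of such graphs pays for it. -/
theorem sum_sq_influence_le_pow (S : Finset (Sym2 V)) :
    ∑ e ∈ S, (goodCount lo hi S - goodCount lo hi (S.erase e)) ^ 2 ≤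
      (Fintype.card V : ℝ) ^ 10 := by
  classical
  have hX : ∀ S, 0 ≤ goodCount (V := V) lo hi S ∧
      goodCount (V := V) lo hi S ≤ (Fintype.card V : ℝ) ^ 4 := by
    intro S
    unfold goodCount
    rw [sum_boole]
    refine ⟨by positivity, ?_⟩
    have : #(univ.filter fun q : V × V × V × V =>
        Good lo hi (gr S) q.1 q.2.1 q.2.2.1 q.2.2.2) ≤ Fintype.card V ^ 4 := by
      refine (card_le_univ _).trans (le_of_eq ?_)
      simp only [Fintype.card_prod]
      ring
    exact_mod_cast this
  have h2 : ∀ e ∈ S, (goodCount lo hi S - goodCount lo hi (S.erase e)) ^ 2 ≤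
      (Fintype.card V : ℝ) ^ 8 := by
    intro e _
    have := hX S
    have := hX (S.erase e)
    have h3 : |goodCount lo hi S - goodCount lo hi (S.erase e)| ≤ (Fintype.card V : ℝ) ^ 4 :=
      abs_le.2 ⟨by linarith, by linarith⟩
    rw [← sq_abs]
    calc _ ≤ ((Fintype.card V : ℝ) ^ 4) ^ 2 := pow_le_pow_left₀ (abs_nonneg _) h3 2
      _ = _ := by ring
  have h3 : (#S : ℝ) ≤ (Fintype.card V : ℝ) ^ 2 := by
    have himg : S ⊆ (univ : Finset (V × V)).image fun q => s(q.1, q.2) := by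
      intro e _
      induction e with
      | _ a b => exact mem_image.2 ⟨(a, b), mem_univ _, rfl⟩
    have := (card_le_card himg).trans card_image_le
    simp only [card_univ, Fintype.card_prod] at this
    rw [sq]
    exact_mod_cast this
  have h4 := sum_le_card_nsmul S _ _ h2
  rw [nsmul_eq_mul] at h4
  have h5 : (#S : ℝ) * (Fintype.card V : ℝ) ^ 8 ≤
      (Fintype.card V : ℝ) ^ 2 * (Fintype.card V : ℝ) ^ 8 :=
    mul_le_mul_of_nonneg_right h3 (by positivity)
  calc _ ≤ (Fintype.card V : ℝ) ^ 2 * (Fintype.card V : ℝ) ^ 8 := h4.trans h5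
    _ = _ := by ring

/-- The variance of the number of good quadruples. -/
theorem variance_goodCount_le {p : ℝ} (hp : 0 ≤ p) (hp1 : p ≤ 1) (lo hi : ℝ) (K c : ℕ) :
    (ex p (pairs V) fun S => goodCount lo hi S ^ 2) - ex p (pairs V) (goodCount lo hi) ^ 2 ≤
      2 * (Fintype.card V * K) * (8 * Fintype.card V * K ^ 2 * (1 + 2 * c) +
        16 * (K ^ 4 + K ^ 5) : ℝ) ^ 2 +
      128 * (Fintype.card V) ^ 2 * K ^ 4 * c * ((Fintype.card V) ^ 5 * p ^ 5) +
      (Fintype.card V) ^ 10 * (Fintype.card V * ((Fintype.card V).choose K * p ^ K) +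
        (Fintype.card V) ^ 2 * ((Fintype.card V).choose c * p ^ (2 * c))) := by
  classical
  set n : ℝ := (Fintype.card V : ℝ) with hn
  set A : ℝ := 8 * n * K ^ 2 * (1 + 2 * c) + 16 * (K ^ 4 + K ^ 5)
  have h0 := pr_not_boundedDegrees_le (V := V) hp hp1 K c
  have h1 := efron_stein (s := pairs V) (f := goodCount lo hi) hp hp1
  refine h1.trans ?_
  have hle : ∀ S ⊆ pairs V, ∑ e ∈ S, (goodCount lo hi S - goodCount lo hi (S.erase e)) ^ 2 ≤
      (2 * (n * K) * A ^ 2 +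
        128 * n ^ 2 * K ^ 4 * c * ∑ q ∈ arcs S, (#(pentagons S q.1 q.2) : ℝ)) +
      n ^ 10 * if ¬ BoundedDegrees K c S then 1 else 0 := by
    intro S hS
    have h6 : 0 ≤ 2 * (n * K) * A ^ 2 := by positivity
    have h7 : 0 ≤ 128 * n ^ 2 * K ^ 4 * c * ∑ q ∈ arcs S, (#(pentagons S q.1 q.2) : ℝ) :=
      mul_nonneg (by positivity) (sum_nonneg fun _ _ => Nat.cast_nonneg _)
    by_cases hb : BoundedDegrees K c S
    · rw [if_neg (not_not.2 hb), mul_zero, add_zero]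
      exact sum_sq_influence_le hS hb
    · rw [if_pos hb, mul_one]
      exact (sum_sq_influence_le_pow S).trans (le_add_of_nonneg_left (add_nonneg h6 h7))
  refine (ex_mono hp hp1 hle).trans ?_
  rw [ex_add, ex_add, ex_const, ex_const_mul, ex_const_mul]
  refine add_le_add (add_le_add le_rfl ?_) ?_
  · exact mul_le_mul_of_nonneg_left (ex_sum_pentagons_le hp hp1) (by positivity)
  · refine mul_le_mul_of_nonneg_left (le_trans (le_of_eq ?_) h0) (by positivity)
    unfold pr
    exact ex_congr fun S _ => by beta_reduce; congr

end Variance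

end Shotgun

namespace Shotgun

open Finset

/-! ### Bounds on conditional probabilities by exposing one part of the set first. -/

section Conditioning

variable {ι : Type*} [DecidableEq ι] {p : ℝ} {s t : Finset ι} {P R : Finset ι → Prop}

theorem mul_pr_le_pr_and (hp : 0 ≤ p) (hp1 : p ≤ 1) (hst : Disjoint s t) {c : ℝ}
    (hP : ∀ S ⊆ s, ∀ T ⊆ t, P (S ∪ T) ↔ P S)
    (hc : ∀ S ⊆ s, P S → c ≤ pr p t fun T => R (S ∪ T)) :
    c * pr p (s ∪ t) P ≤ pr p (s ∪ t) fun S => P S ∧ R S := by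
  rw [pr_union hst, pr_union hst, ← ex_const_mul]
  refine ex_mono hp hp1 fun S hS => ?_
  by_cases h : P S
  · rw [pr_congr (Q := fun _ => True) fun T hT => iff_true_intro ((hP S hS T hT).2 h), pr_true,
      mul_one]
    exact (hc S hS h).trans (pr_mono hp hp1 fun T hT hR => ⟨(hP S hS T hT).2 h, hR⟩)
  · rw [pr_congr (Q := fun _ => False) fun T hT => iff_false_intro (mt (hP S hS T hT).1 h)]
    refine le_trans (le_of_eq ?_) (pr_nonneg hp hp1)
    have : pr p t (fun _ => False) = 0 := by
      have := pr_not (p := p) (s := t) (P := fun _ => True)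
      rw [pr_true] at this
      simpa using this
    rw [this, mul_zero]

/-- This is `mul_pr_le_pr_and` for the complement of R. -/
theorem pr_and_le_mul_pr (hp : 0 ≤ p) (hp1 : p ≤ 1) (hst : Disjoint s t) {c : ℝ}
    (hP : ∀ S ⊆ s, ∀ T ⊆ t, P (S ∪ T) ↔ P S)
    (hc : ∀ S ⊆ s, P S → (pr p t fun T => R (S ∪ T)) ≤ c) :
    (pr p (s ∪ t) fun S => P S ∧ R S) ≤ c * pr p (s ∪ t) P := by
  have h := mul_pr_le_pr_and (R := fun S => ¬ R S) hp hp1 hst (c := 1 - c) hP fun S hS hPS => by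
    rw [pr_not (P := fun T => R (S ∪ T))]
    linarith [hc S hS hPS]
  have h2 : pr p (s ∪ t) P ≥ (pr p (s ∪ t) fun S => P S ∧ R S) +
      pr p (s ∪ t) fun S => P S ∧ ¬ R S := by
    unfold pr
    rw [← ex_add]
    refine ex_mono hp hp1 fun S _ => ?_
    by_cases h : P S <;> by_cases h' : R S <;> simp [h, h']
  linarith

end Conditioning

/-! ### Conditioning on the stars of the four vertices. -/

section Stars

variable {V : Type u} [Fintype V] [DecidableEq V] {x y u v : V} {lo hi p : ℝ}
  {S T : Finset (Sym2 V)}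

/-- The edges with an end in `Q`. -/
def touching (Q : Finset V) : Finset (Sym2 V) := (pairs V).filter fun e => ∃ q ∈ Q, q ∈ e

/-- The edges without an end in `Q`. -/
def avoiding (Q : Finset V) : Finset (Sym2 V) := (pairs V).filter fun e => ¬ ∃ q ∈ Q, q ∈ e

theorem touching_union_avoiding (Q : Finset V) : touching Q ∪ avoiding Q = pairs V :=
  filter_union_filter_not_eq _ _

theorem disjoint_touching_avoiding (Q : Finset V) : Disjoint (touching Q) (avoiding Q) :=
  disjoint_filter_filter_not _ _ _

theorem mem_avoiding {Q : Finset V} {a b : V} :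
    s(a, b) ∈ avoiding Q ↔ a ≠ b ∧ a ∉ Q ∧ b ∉ Q := by
  simp only [avoiding, mem_filter, mem_pairs, Sym2.mem_iff]
  grind

theorem touching_subset (Q : Finset V) : touching Q ⊆ pairs V := filter_subset _ _

theorem avoiding_subset (Q : Finset V) : avoiding Q ⊆ pairs V := filter_subset _ _

theorem gr_adj_union {Q : Finset V} (hS : S ⊆ pairs V) (hT : T ⊆ avoiding Q) {q : V} (hq : q ∈ Q)
    (z : V) : (gr (S ∪ T)).Adj q z ↔ (gr S).Adj q z := by
  rw [gr_adj' hS, gr_adj' (union_subset hS (hT.trans (avoiding_subset Q))), mem_union]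
  refine or_iff_left fun h => ?_
  exact (mem_avoiding.1 (hT h)).2.1 hq

theorem starEvent_union (hS : S ⊆ pairs V) (hT : T ⊆ avoiding {x, y, u, v}) :
    StarEvent lo hi (gr (S ∪ T)) x y u v ↔ StarEvent lo hi (gr S) x y u v := by
  have e1 := gr_adj_union hS hT (q := x) (by simp)
  have e2 := gr_adj_union hS hT (q := y) (by simp)
  have e3 := gr_adj_union hS hT (q := u) (by simp)
  have e4 := gr_adj_union hS hT (q := v) (by simp)
  exact ⟨fun h => h.congr e1 e2 e3 e4, fun h => h.congr (fun z => (e1 z).symm)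
    (fun z => (e2 z).symm) (fun z => (e3 z).symm) fun z => (e4 z).symm⟩

theorem StarPair.side_notMem {G : SimpleGraph V} (h : StarPair G x y u v) {a : V}
    (ha : Side G x y u v a) : a ∉ ({x, y, u, v} : Finset V) := by
  have h1 := h.nxu
  have h2 := h.nxv
  have h3 := h.nyu
  have h4 : ¬ G.Adj u x := fun k => h1 k.symm
  have h6 : ¬ G.Adj u y := fun k => h3 k.symm
  unfold Side at ha
  simp only [mem_insert, mem_singleton]
  rintro (rfl | rfl | rfl | rfl) <;> simp_all

theorem StarPair.not_side_side {G : SimpleGraph V} (h : StarPair G x y u v) {a : V}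
    (ha : Side G x y u v a) (hc : Side G y x v u a) : False := by
  rcases ha with ha | ha <;> rcases hc with hc | hc
  · exact h.cxy a ha.1 hc.1
  · exact h.cxv a ha.1 hc.1
  · exact h.cyu a hc.1 ha.1
  · exact h.cuv a ha.1 hc.1

open Classical in
/-- Given the stars, the probability that no short path exists is bounded below. -/
theorem le_pr_noShort (hp : 0 ≤ p) (hp1 : p ≤ 1) {k : ℕ} (hk : 2 * hi ≤ k)
    (hSQ : S ⊆ touching {x, y, u, v}) (h : StarEvent lo hi (gr S) x y u v) :
    (1 - p) ^ (4 * k ^ 2) * (1 - p ^ 2) ^ (k ^ 2 * Fintype.card V) ≤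
      pr p (avoiding {x, y, u, v}) fun T => NoShort (gr (S ∪ T)) x y u v := by
  have hS := hSQ.trans (touching_subset _)
  have hpair := h.pair
  set Q : Finset V := {x, y, u, v} with hQ
  set A : Finset V := univ.filter fun a => Side (gr S) x y u v a with hA
  set B : Finset V := univ.filter fun a => Side (gr S) y x v u a with hB
  have hdeg : ∀ (a b : V), (deg (gr S) a : ℝ) ≤ hi → (deg (gr S) b : ℝ) ≤ hi →
      deg (gr S) a + deg (gr S) b ≤ k := by
    intro a b h1 h2
    have : ((deg (gr S) a + deg (gr S) b : ℕ) : ℝ) ≤ k := by push_cast; linarith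
    exact_mod_cast this
  have hAk : #A ≤ k := by
    refine le_trans ?_ (hdeg x u h.hix (h.degx ▸ h.hix))
    unfold deg
    refine (card_le_card ?_).trans (card_union_le _ _)
    intro a ha
    rcases (mem_filter.1 ha).2 with h | h <;> simp [h.1]
  have hBk : #B ≤ k := by
    refine le_trans ?_ (hdeg y v h.hiy (h.degy ▸ h.hiy))
    unfold deg
    refine (card_le_card ?_).trans (card_union_le _ _)
    intro a ha
    rcases (mem_filter.1 ha).2 with h | h <;> simp [h.1]
  have hAQ : ∀ a ∈ A, a ∉ Q := fun a ha => hpair.side_notMem (mem_filter.1 ha).2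
  have hBQ : ∀ a ∈ B, a ∉ Q := fun a ha => by
    have := hpair.swap.side_notMem (mem_filter.1 ha).2
    simp only [hQ, mem_insert, mem_singleton] at this ⊢
    tauto
  have hABne : ∀ a ∈ A, ∀ c ∈ B, a ≠ c := by
    rintro a ha c hc rfl
    exact hpair.not_side_side (mem_filter.1 ha).2 (mem_filter.1 hc).2
  let D := A ∪ B
  have hDk : #(D ×ˢ D) ≤ 4 * k ^ 2 := by
    have : #D ≤ 2 * k := (card_union_le _ _).trans (by omega)
    rw [card_product]
    calc _ ≤ (2 * k) * (2 * k) := Nat.mul_le_mul this this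
      _ = _ := by ring
  -- Candidates for a path of length two from A to B. They are about k²n in number and cost 1 - p²
  -- each, which produces the dominant term d⁴/n in the exponent.
  let E : Finset (V × V × V) := A ×ˢ univ ×ˢ B
  have hEk : #E ≤ k ^ 2 * Fintype.card V := by
    simp only [E, card_product, card_univ]
    calc _ ≤ k * (Fintype.card V * k) :=
        Nat.mul_le_mul hAk (Nat.mul_le_mul_left _ hBk)
      _ = _ := by ring
  let F : (V × V) ⊕ (V × V × V) → Finset (Sym2 V) :=
    Sum.elim (fun q => {s(q.1, q.2)}) fun q => {s(q.1, q.2.1), s(q.2.1, q.2.2)}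
  -- Only sets inside `avoiding Q` can be contained in T, so other candidates, including diagonal
  -- pairs, are dropped.
  let D' := (D ×ˢ D).filter fun q => {s(q.1, q.2)} ⊆ avoiding Q
  let E' := E.filter fun q => {s(q.1, q.2.1), s(q.2.1, q.2.2)} ⊆ avoiding Q
  have h1 := prod_le_pr_forall_not_subset (s := avoiding Q) hp hp1 (D'.disjSum E') F (by
    intro k hk
    rcases mem_disjSum.1 hk with ⟨q, hq, rfl⟩ | ⟨q, hq, rfl⟩
    · exact (mem_filter.1 hq).2
    · exact (mem_filter.1 hq).2)
  have h2 : (1 - p) ^ (4 * k ^ 2) * (1 - p ^ 2) ^ (k ^ 2 * Fintype.card V) ≤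
      ∏ k ∈ D'.disjSum E', (1 - p ^ #(F k)) := by
    rw [prod_disjSum]
    have e1 : ∏ q ∈ D', (1 - p ^ #(F (Sum.inl q))) = (1 - p) ^ #D' := by
      rw [prod_congr rfl fun q _ => show 1 - p ^ #(F (Sum.inl q)) = 1 - p by simp [F], prod_const]
    have e2 : ∏ q ∈ E', (1 - p ^ #(F (Sum.inr q))) = (1 - p ^ 2) ^ #E' := by
      rw [prod_congr rfl fun q hq => show 1 - p ^ #(F (Sum.inr q)) = 1 - p ^ 2 from ?_, prod_const]
      obtain ⟨h3, -⟩ := mem_filter.1 hq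
      simp only [E, mem_product, mem_univ, true_and] at h3
      have := hABne _ h3.1 _ h3.2
      simp only [F, Sum.elim_inr]
      rw [card_pair]
      simp only [ne_eq, Sym2.eq_iff]
      grind
    rw [e1, e2]
    have q1 : 0 ≤ 1 - p := by linarith
    have q2 : 0 ≤ 1 - p ^ 2 := by nlinarith
    exact mul_le_mul
      (pow_le_pow_of_le_one q1 (by linarith) ((card_filter_le _ _).trans hDk))
      (pow_le_pow_of_le_one q2 (by nlinarith) ((card_filter_le _ _).trans hEk))
      (pow_nonneg q2 _) (pow_nonneg q1 _)
  refine h2.trans (h1.trans (pr_mono hp hp1 fun T hT hTF => ?_))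
  have hST : S ∪ T ⊆ pairs V := union_subset hS (hT.trans (avoiding_subset Q))
  have e1 := gr_adj_union hS hT (q := x) (by simp [hQ])
  have e2 := gr_adj_union hS hT (q := y) (by simp [hQ])
  have e3 := gr_adj_union hS hT (q := u) (by simp [hQ])
  have e4 := gr_adj_union hS hT (q := v) (by simp [hQ])
  have s1 : ∀ a, Side (gr (S ∪ T)) x y u v a → a ∈ A := fun a h =>
    mem_filter.2 ⟨mem_univ _, (side_congr e1 e3 a).1 h⟩
  have s2 : ∀ a, Side (gr (S ∪ T)) y x v u a → a ∈ B := fun a h =>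
    mem_filter.2 ⟨mem_univ _, (side_congr e2 e4 a).1 h⟩
  have hmem : ∀ a b, a ∉ Q → b ∉ Q → (gr (S ∪ T)).Adj a b → s(a, b) ∈ T := by
    intro a b ha hb hab
    rcases mem_union.1 ((gr_adj' hST a b).1 hab) with h3 | h3
    · obtain ⟨q, hq, hqe⟩ := (mem_filter.1 (hSQ h3)).2
      rcases Sym2.mem_iff.1 hqe with rfl | rfl
      · exact absurd hq ha
      · exact absurd hq hb
    · exact h3
  have hDQ : ∀ a ∈ D, a ∉ Q := fun a ha => (mem_union.1 ha).elim (hAQ a) (hBQ a)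
  have hD : ∀ a ∈ D, ∀ b ∈ D, ¬ (gr (S ∪ T)).Adj a b := by
    intro a ha b hb hab
    have h3 := hmem a b (hDQ a ha) (hDQ b hb) hab
    exact hTF (Sum.inl (a, b)) (inl_mem_disjSum.2 (mem_filter.2 ⟨mem_product.2 ⟨ha, hb⟩,
      singleton_subset_iff.2 (hT h3)⟩)) (singleton_subset_iff.2 h3)
  refine ⟨fun a a' ha ha' => hD a (mem_union_left _ (s1 a ha)) a' (mem_union_left _ (s1 a' ha')),
    fun a a' ha ha' => hD a (mem_union_right _ (s2 a ha)) a' (mem_union_right _ (s2 a' ha')),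
    fun a c ha hc => hD a (mem_union_left _ (s1 a ha)) c (mem_union_right _ (s2 c hc)),
    fun a b c ha hc hab hbc => ?_⟩
  have haA := s1 a ha
  have hcB := s2 c hc
  -- A middle vertex in Q would make a or c a common neighbour of two of the four vertices, which
  -- `StarPair` excludes.
  have hbQ : b ∉ Q := by
    have ha' := (mem_filter.1 haA).2
    have hc' := (mem_filter.1 hcB).2
    have hba := hab.symm
    intro hb
    simp only [hQ, mem_insert, mem_singleton] at hb
    rcases hb with rfl | rfl | rfl | rfl
    · rw [e1] at hbc
      rcases hc' with h | h
      · exact hpair.cxy c hbc h.1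
      · exact hpair.cxv c hbc h.1
    · rw [e2] at hba
      rcases ha' with h | h
      · exact hpair.cxy a h.1 hba
      · exact hpair.cyu a hba h.1
    · rw [e3] at hbc
      rcases hc' with h | h
      · exact hpair.cyu c h.1 hbc
      · exact hpair.cuv c hbc h.1
    · rw [e4] at hba
      rcases ha' with h | h
      · exact hpair.cxv a h.1 hba
      · exact hpair.cuv a h.1 hba
  have h3 := hmem a b (hAQ a haA) hbQ hab
  have h4 := hmem b c hbQ (hBQ c hcB) hbc
  have h5 : ({s(a, b), s(b, c)} : Finset (Sym2 V)) ⊆ T :=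
    insert_subset_iff.2 ⟨h3, singleton_subset_iff.2 h4⟩
  exact hTF (Sum.inr (a, b, c)) (inr_mem_disjSum.2 (mem_filter.2
    ⟨mem_product.2 ⟨haA, mem_product.2 ⟨mem_univ _, hcB⟩⟩, h5.trans hT⟩)) h5

/-- A switchable pair is good with a conditional probability which is bounded below. -/
theorem le_pr_good (hp : 0 ≤ p) (hp1 : p ≤ 1) {k : ℕ} (hk : 2 * hi ≤ k) (x y u v : V) :
    (1 - p) ^ (4 * k ^ 2) * (1 - p ^ 2) ^ (k ^ 2 * Fintype.card V) *
      pr p (pairs V) (fun S => StarEvent lo hi (gr S) x y u v) ≤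
      pr p (pairs V) fun S => Good lo hi (gr S) x y u v := by
  rw [← touching_union_avoiding {x, y, u, v}]
  exact mul_pr_le_pr_and (R := fun S => NoShort (gr S) x y u v) hp hp1
    (disjoint_touching_avoiding _)
    (fun S hS T hT => starEvent_union (hS.trans (touching_subset _)) hT)
    fun S hS h => le_pr_noShort hp hp1 hk hS h

theorem degSum_gr (hS : S ⊆ pairs V) (a : V) :
    degSum (gr S) a = ∑ b ∈ nb S a, (#(nb S b) : ℤ) := by
  classical
  unfold degSum nbrSum nb
  rw [sum_filter]
  refine sum_congr rfl fun b _ => ?_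
  rw [gr_adj' hS]
  split_ifs
  · simp only [gr_adj' hS, sum_boole]
  · rfl

theorem nb_union (a : V) : nb (S ∪ T) a = nb S a ∪ nb T a := by
  ext b; simp [mem_nb]

/-- The pairs with one element in `A` and one in `B`. -/
def between (A B : Finset V) : Finset (Sym2 V) := (A ×ˢ B).image fun q => s(q.1, q.2)

theorem card_between {A B : Finset V} (h : Disjoint A B) : #(between A B) = #A * #B := by
  rw [between, card_image_of_injOn, card_product]
  rintro ⟨a, b⟩ hq ⟨a', b'⟩ hq' he
  rw [mem_coe, mem_product] at hq hq'
  rcases mk_eq_iff.1 he with ⟨rfl, rfl⟩ | ⟨rfl, rfl⟩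
  · rfl
  · exact absurd hq'.2 (disjoint_left.1 h hq.1)

/-- Each bipartite edge is counted at its unique end in A. -/
theorem card_eq_sum_nb {A B : Finset V} (h : Disjoint A B) (hT : T ⊆ between A B) :
    (#T : ℤ) = ∑ a ∈ A, (#(nb T a) : ℤ) := by
  rw [← Nat.cast_sum, ← card_sigma, Nat.cast_inj]
  symm
  refine card_bij (fun q _ => s(q.1, q.2)) ?_ ?_ ?_
  · rintro ⟨a, b⟩ hq
    exact mem_nb.1 (mem_sigma.1 hq).2
  · rintro ⟨a, b⟩ hq ⟨a', b'⟩ hq' he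
    obtain ⟨h1, h2⟩ := mem_sigma.1 hq
    obtain ⟨h1', h2'⟩ := mem_sigma.1 hq'
    dsimp only at *
    rcases mk_eq_iff.1 he with ⟨rfl, rfl⟩ | ⟨rfl, rfl⟩
    · rfl
    · obtain ⟨⟨c, d⟩, hcd, hce⟩ := mem_image.1 (hT (mem_nb.1 h2))
      obtain ⟨hc, hd⟩ := mem_product.1 hcd
      rcases mk_eq_iff.1 hce with ⟨rfl, rfl⟩ | ⟨rfl, rfl⟩
      · exact absurd hd (disjoint_left.1 h h1')
      · exact absurd hd (disjoint_left.1 h h1)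
  · intro e he
    obtain ⟨⟨c, d⟩, hcd, rfl⟩ := mem_image.1 (hT he)
    exact ⟨⟨c, d⟩, mem_sigma.2 ⟨(mem_product.1 hcd).1, mem_nb.2 he⟩, rfl⟩

/-- Given the stars, the degree sums of `x` and `u` are unlikely to agree. -/
theorem pr_degSum_eq_le (hp : 0 ≤ p) (hp1 : p ≤ 1 / 2) (hSQ : S ⊆ touching {x, y, u, v})
    (h : StarEvent lo hi (gr S) x y u v) {β : ℝ} (hβ : 0 ≤ β)
    (hβ1 : 1 ≤ 2 * ((lo - 1) * (Fintype.card V - 4 - 2 * hi) * p) * β ^ 2) (hlo : 1 < lo) :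
    (pr p (avoiding {x, y, u, v}) fun T => degSum (gr (S ∪ T)) x = degSum (gr (S ∪ T)) u) ≤ β := by
  have hS := hSQ.trans (touching_subset _)
  have hpair := h.pair
  set Q : Finset V := {x, y, u, v} with hQ
  have hp1' : p ≤ 1 := by linarith
  set A := (nb S x).erase y with hA
  -- An edge between A and B raises the degree of exactly one neighbour of x and of no neighbour of
  -- u. Hence it adds 1 to the degree sum of x and nothing to that of u.
  set B : Finset V := univ \ (Q ∪ (nb S x ∪ nb S u)) with hB
  have hAB : Disjoint A B := by
    rw [disjoint_left]
    intro a ha hb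
    simp only [hB, mem_sdiff, mem_union, not_or] at hb
    exact hb.2.2.1 (mem_of_mem_erase ha)
  have hAQ : ∀ a ∈ A, a ∉ Q := fun a ha => hpair.side_notMem (Or.inl
    ⟨(gr_adj_nb hS).2 (mem_of_mem_erase ha), ne_of_mem_erase ha⟩)
  have hF : between A B ⊆ avoiding Q := by
    intro e he
    obtain ⟨⟨a, b⟩, hq, rfl⟩ := mem_image.1 he
    obtain ⟨ha, hb⟩ := mem_product.1 hq
    refine mem_avoiding.2 ⟨fun h => disjoint_left.1 hAB ha (h ▸ hb), hAQ a ha, ?_⟩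
    simp only [hB, mem_sdiff, mem_union, not_or] at hb
    exact hb.2.1
  have hcard : (lo - 1) * (Fintype.card V - 4 - 2 * hi) ≤ #(between A B) := by
    have hdx := deg_gr hS x
    have hdu := deg_gr hS u
    have e1 : (#A : ℝ) = deg (gr S) x - 1 := by
      have := card_erase_add_one ((gr_adj_nb hS).1 hpair.xy)
      rw [hdx, ← this, hA]
      push_cast
      ring
    have e2 : (Fintype.card V : ℝ) - 4 - 2 * hi ≤ #B := by
      have h1 : Fintype.card V ≤ #B + (4 + (#(nb S x) + #(nb S u))) := by
        have h2 := le_card_sdiff (Q ∪ (nb S x ∪ nb S u)) (univ : Finset V)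
        have h3 := card_union_le Q (nb S x ∪ nb S u)
        have h4 := card_union_le (nb S x) (nb S u)
        have h5 : #Q ≤ 4 := card_le_four
        rw [card_univ, ← hB] at h2
        omega
      rw [← hdx, ← hdu, ← h.degx] at h1
      have h2 : (Fintype.card V : ℝ) ≤ #B + (4 + (deg (gr S) x + deg (gr S) x)) := by
        exact_mod_cast h1
      linarith [h.hix]
    have h1 := h.lox
    rw [card_between hAB, Nat.cast_mul, e1]
    calc _ ≤ (lo - 1) * #B := mul_le_mul_of_nonneg_left e2 (by linarith)
      _ ≤ _ := mul_le_mul_of_nonneg_right (by linarith) (Nat.cast_nonneg _)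
  have hpr : ∀ j, (pr p (between A B) fun T => #T = j) ≤ β := by
    intro j
    have h1 := pr_card_eq_sq_le (s := between A B) hp hp1 j
    have h2 : (lo - 1) * (Fintype.card V - 4 - 2 * hi) * p ≤ #(between A B) * p :=
      mul_le_mul_of_nonneg_right hcard hp
    by_contra! hcon
    have h3 : β ^ 2 < pr p (between A B) (fun T => #T = j) ^ 2 :=
      pow_lt_pow_left₀ hcon hβ two_ne_zero
    have h4 := mul_le_mul_of_nonneg_right h2 (sq_nonneg β)
    have h5 : 0 < 2 * (#(between A B) * p) := by
      by_contra! h6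
      nlinarith [sq_nonneg β]
    nlinarith [mul_lt_mul_of_pos_left h3 h5]
  -- All edges outside `between A B` are exposed as well, and only the binomial number #T stays
  -- random.
  rw [← sdiff_union_of_subset hF, pr_union sdiff_disjoint]
  refine ex_le_const hp hp1' fun R hR => ?_
  set W := S ∪ R with hW
  have hRQ : R ⊆ avoiding Q := hR.trans sdiff_subset
  have hWV : W ⊆ pairs V := union_subset hS (hRQ.trans (avoiding_subset Q))
  -- A tie forces #T to equal the difference of the two sums computed in W, a single value.
  -- Truncation by `toNat` is harmless because a tie makes this difference nonnegative.
  refine le_trans (pr_mono hp hp1' fun T hT hTd => ?_)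
    (hpr (∑ b ∈ nb S u, (#(nb W b) : ℤ) - ∑ b ∈ nb S x, (#(nb W b) : ℤ)).toNat)
  rw [← union_assoc, ← hW] at hTd
  have hTQ := hT.trans hF
  have hWT : Disjoint W T := by
    refine disjoint_union_left.2 ⟨?_, ?_⟩
    · exact ((disjoint_touching_avoiding Q).mono_left hSQ).mono_right hTQ
    · exact (sdiff_disjoint.mono_left hR).mono_right hT
  have hWTV : W ∪ T ⊆ pairs V := union_subset hWV (hTQ.trans (avoiding_subset Q))
  have hstar : ∀ q ∈ Q, nb (W ∪ T) q = nb S q := by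
    intro q hq
    ext b
    rw [hW, union_assoc, ← gr_adj_nb hS, ← gr_adj_nb (by rw [← union_assoc]; exact hWTV)]
    exact gr_adj_union hS (union_subset hRQ hTQ) hq b
  have hcardnb : ∀ b, (#(nb (W ∪ T) b) : ℤ) = #(nb W b) + #(nb T b) := by
    intro b
    rw [nb_union, card_union_of_disjoint]
    · push_cast; rfl
    · rw [disjoint_left]
      intro c h1 h2
      exact disjoint_left.1 hWT (mem_nb.1 h1) (mem_nb.1 h2)
  have hnbT : ∀ b, b ∉ A → b ∉ B → (#(nb T b) : ℤ) = 0 := by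
    intro b h1 h2
    rw [Nat.cast_eq_zero, card_eq_zero, eq_empty_iff_forall_notMem]
    intro c hc
    obtain ⟨⟨a, d⟩, hq, he⟩ := mem_image.1 (hT (mem_nb.1 hc))
    obtain ⟨ha, hd⟩ := mem_product.1 hq
    rcases mk_eq_iff.1 he with ⟨rfl, rfl⟩ | ⟨rfl, rfl⟩
    · exact h1 ha
    · exact h2 hd
  have hx : ∑ b ∈ nb S x, (#(nb T b) : ℤ) = #T := by
    rw [card_eq_sum_nb hAB hT, hA, ← sum_erase (f := fun b => (#(nb T b) : ℤ)) _
      (hnbT y (notMem_erase y _) ?_)]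
    simp [hB, hQ]
  have hu : ∑ b ∈ nb S u, (#(nb T b) : ℤ) = 0 := by
    refine sum_eq_zero fun b hb => hnbT b (fun hbA => ?_) (by simp [hB, hb])
    exact hpair.cxu b ((gr_adj_nb hS).2 (mem_of_mem_erase hbA)) ((gr_adj_nb hS).2 hb)
  rw [degSum_gr hWTV, degSum_gr hWTV, hstar x (by simp [hQ]), hstar u (by simp [hQ]),
    sum_congr rfl fun b _ => hcardnb b, sum_congr rfl fun b _ => hcardnb b, sum_add_distrib,
    sum_add_distrib, hx, hu] at hTd
  omega

/-- Switchable pairs whose switch may be unnoticed by the edge invariant. -/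
theorem pr_starEvent_degSum_eq_le (hp : 0 ≤ p) (hp1 : p ≤ 1 / 2) {β : ℝ} (hβ : 0 ≤ β)
    (hβ1 : 1 ≤ 2 * ((lo - 1) * (Fintype.card V - 4 - 2 * hi) * p) * β ^ 2) (hlo : 1 < lo)
    (x y u v : V) :
    (pr p (pairs V) fun S => StarEvent lo hi (gr S) x y u v ∧
      (degSum (gr S) x = degSum (gr S) u ∨ degSum (gr S) y = degSum (gr S) v)) ≤
      2 * β * pr p (pairs V) fun S => StarEvent lo hi (gr S) x y u v := by
  have hp1' : p ≤ 1 := by linarith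
  have key : ∀ x y u v : V, (pr p (pairs V) fun S => StarEvent lo hi (gr S) x y u v ∧
      degSum (gr S) x = degSum (gr S) u) ≤
      β * pr p (pairs V) fun S => StarEvent lo hi (gr S) x y u v := by
    intro x y u v
    rw [← touching_union_avoiding {x, y, u, v}]
    exact pr_and_le_mul_pr (R := fun S => degSum (gr S) x = degSum (gr S) u) hp hp1'
      (disjoint_touching_avoiding _)
      (fun S hS T hT => starEvent_union (hS.trans (touching_subset _)) hT)
      fun S hS h => pr_degSum_eq_le hp hp1 hS h hβ hβ1 hlo
  have h1 := key x y u v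
  have h2 := key y x v u
  rw [pr_congr (P := fun S => StarEvent lo hi (gr S) y x v u)
    fun S _ => (⟨StarEvent.swap, StarEvent.swap⟩ :
      _ ↔ StarEvent lo hi (gr S) x y u v)] at h2
  have h3 : (pr p (pairs V) fun S => StarEvent lo hi (gr S) x y u v ∧
      (degSum (gr S) x = degSum (gr S) u ∨ degSum (gr S) y = degSum (gr S) v)) ≤
      (pr p (pairs V) fun S => StarEvent lo hi (gr S) x y u v ∧
        degSum (gr S) x = degSum (gr S) u) +
      pr p (pairs V) fun S => StarEvent lo hi (gr S) y x v u ∧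
        degSum (gr S) y = degSum (gr S) v :=
    pr_le_add hp hp1' fun S _ h => h.2.imp (fun k => ⟨h.1, k⟩) fun k => ⟨h.1.swap, k⟩
  linarith

end Stars

end Shotgun

namespace Shotgun

open Finset

/-! ### A lower bound for the probability that four stars allow a switch. -/

section StarLowerBound

/-- Events determined by disjoint parts of s are independent; the rest of s integrates out. -/
theorem pr_and_eq_mul {ι : Type*} [DecidableEq ι] {p : ℝ} {s A B : Finset ι}
    {P Q : Finset ι → Prop} (hA : A ⊆ s) (hB : B ⊆ s) (hAB : Disjoint A B)
    (hP : ∀ S, P (S ∩ A) ↔ P S) (hQ : ∀ S, Q (S ∩ B) ↔ Q S) :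
    (pr p s fun S => P S ∧ Q S) = pr p A P * pr p B Q := by
  have h1 : (pr p (A ∪ B) fun S => P S ∧ Q S) = pr p A P * pr p B Q := by
    rw [← pr_union_mul hAB]
    exact pr_congr fun S _ => by rw [hP, hQ]
  have h2 := pr_union_mul (p := p) (s := A ∪ B) (t := s \ (A ∪ B)) (P := fun S => P S ∧ Q S)
    (Q := fun _ => True) disjoint_sdiff
  rw [pr_true, mul_one, h1, union_sdiff_of_subset (union_subset hA hB)] at h2
  rw [← h2]
  refine pr_congr fun S _ => ?_
  have e1 : P (S ∩ (A ∪ B)) ↔ P S := by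
    rw [← hP, inter_assoc, union_inter_cancel_left, hP]
  have e2 : Q (S ∩ (A ∪ B)) ↔ Q S := by
    rw [← hQ, inter_assoc, union_inter_cancel_right, hQ]
  rw [e1, e2, and_true]

variable {V : Type u} [Fintype V] [DecidableEq V] {x y u v : V} {lo hi p : ℝ}

/-- The pairs of `q` with a vertex of `O`. -/
def star (O : Finset V) (q : V) : Finset (Sym2 V) := O.image fun b => s(q, b)

theorem mk_right_injective (q : V) : Function.Injective fun b : V => s(q, b) :=
  fun _ _ h => Sym2.congr_right.1 h

theorem card_star (O : Finset V) (q : V) : #(star O q) = #O :=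
  card_image_of_injective _ (mk_right_injective q)

theorem card_inter_star (O : Finset V) (q : V) (S : Finset (Sym2 V)) :
    #(S ∩ star O q) = #(O.filter fun b => s(q, b) ∈ S) := by
  rw [inter_comm, ← filter_mem_eq_inter, star, filter_image,
    card_image_of_injective _ (mk_right_injective q)]

theorem star_subset_pairs {O : Finset V} {q : V} (hq : q ∉ O) : star O q ⊆ pairs V := by
  intro e he
  obtain ⟨b, hb, rfl⟩ := mem_image.1 he
  exact mem_pairs.2 fun h => hq (h ▸ hb)

theorem disjoint_star {O : Finset V} {q q' : V} (hq : q ∉ O) (h : q ≠ q') :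
    Disjoint (star O q) (star O q') := by
  rw [disjoint_left]
  intro e he he'
  obtain ⟨b, hb, rfl⟩ := mem_image.1 he
  obtain ⟨b', hb', h2⟩ := mem_image.1 he'
  rcases mk_eq_iff.1 h2 with h2 | h2
  · exact h h2.1.symm
  · exact hq (h2.2 ▸ hb')

/-- Distinct vertices form a switchable pair with at least this probability. -/
theorem le_pr_starEvent (hp : 0 < p) (hp1 : p ≤ 1) (hxy : x ≠ y) (hxu : x ≠ u) (hxv : x ≠ v)
    (hyu : y ≠ u) (hyv : y ≠ v) (huv : u ≠ v) {N : ℕ} (hN : Fintype.card V = N + 4) (hN0 : 0 < N)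
    (hlo : lo ≤ N * p - 2 * √(N * p) + 1) (hhi : N * p + 2 * √(N * p) + 1 ≤ hi) :
    p ^ 2 * (1 - p) ^ 4 * (9 / 16 / (4 * √(N * p) + 1)) ^ 2 - 16 * N * p ^ 4 ≤
      pr p (pairs V) fun S => StarEvent lo hi (gr S) x y u v := by
  have hp0 := hp.le
  set Q : Finset V := {x, y, u, v} with hQ
  set O : Finset V := univ \ Q with hO
  have hcQ : #Q = 4 := by
    rw [hQ, card_insert_of_notMem, card_insert_of_notMem, card_insert_of_notMem, card_singleton] <;>
      simp [*]
  have hcO : #O = N := by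
    rw [hO, card_sdiff_of_subset (subset_univ _), card_univ, hcQ, hN]; omega
  have hxO : x ∉ O := by simp [hO, hQ]
  have hyO : y ∉ O := by simp [hO, hQ]
  have huO : u ∉ O := by simp [hO, hQ]
  have hvO : v ∉ O := by simp [hO, hQ]
  set T : Finset (Sym2 V) := {s(x, y), s(u, v)} with hT
  set U : Finset (Sym2 V) := {s(x, u), s(x, v), s(y, u), s(y, v)} with hU
  have hTp : T ⊆ pairs V := by
    intro e he
    simp only [hT, mem_insert, mem_singleton] at he
    rcases he with rfl | rfl <;> rw [mem_pairs] <;> assumption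
  have hUp : U ⊆ pairs V := by
    intro e he
    simp only [hU, mem_insert, mem_singleton] at he
    rcases he with rfl | rfl | rfl | rfl <;> rw [mem_pairs] <;> assumption
  have hTU : Disjoint T U := by
    simp only [hT, hU, disjoint_left, mem_insert, mem_singleton]
    rintro e (rfl | rfl) <;> simp only [mk_eq_iff] <;> grind
  have hcT : #T = 2 := by
    rw [hT, card_pair]
    simp only [ne_eq, mk_eq_iff]
    grind
  have hcU : #U ≤ 4 := card_le_four
  have hAstar : ∀ q, Disjoint (T ∪ U) (star O q) := by
    intro q
    rw [disjoint_left]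
    intro e he he'
    obtain ⟨b, hb, rfl⟩ := mem_image.1 he'
    simp only [hT, hU, mem_union, mem_insert, mem_singleton, mk_eq_iff] at he
    grind
  let W : V → V → Finset (Sym2 V) → Prop := fun q q' S =>
    #(S ∩ star O q) = #(S ∩ star O q') ∧ |(#(S ∩ star O q) : ℝ) - N * p| < 2 * √(N * p)
  have hW : ∀ q q', q ∉ O → q ≠ q' →
      9 / 16 / (4 * √(N * p) + 1) ≤ pr p (star O q ∪ star O q') (W q q') := by
    intro q q' hq hqq'
    have := le_pr_card_eq_card (p := p) hp0 hp1 (disjoint_star hq hqq')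
      (by rw [card_star, card_star]) (by rw [card_star, hcO]; positivity)
    rwa [card_star, hcO] at this
  have hWd : ∀ q q' S, W q q' (S ∩ (star O q ∪ star O q')) ↔ W q q' S := by
    intro q q' S
    simp only [W]
    rw [inter_assoc, inter_assoc, union_inter_cancel_left, union_inter_cancel_right]
  -- The pairs inside Q and the four stars towards O are disjoint, so the required edges and
  -- nonedges and the two degree collisions are independent.
  have h1 : p ^ 2 * (1 - p) ^ 4 * (9 / 16 / (4 * √(N * p) + 1)) ^ 2 ≤
      pr p (pairs V) fun S => (T ⊆ S ∧ Disjoint S U) ∧ W x u S ∧ W y v S := by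
    have hBC : Disjoint (star O x ∪ star O u) (star O y ∪ star O v) := by
      rw [disjoint_union_left, disjoint_union_right, disjoint_union_right]
      exact ⟨⟨disjoint_star hxO hxy, disjoint_star hxO hxv⟩,
        disjoint_star huO hyu.symm, disjoint_star huO huv⟩
    rw [pr_and_eq_mul (A := T ∪ U) (B := (star O x ∪ star O u) ∪ (star O y ∪ star O v))
      (P := fun S => T ⊆ S ∧ Disjoint S U) (Q := fun S => W x u S ∧ W y v S)
      (union_subset hTp hUp),
      pr_subset_disjoint subset_union_left subset_union_right hTU, hcT,
      pr_and_eq_mul (A := star O x ∪ star O u) (B := star O y ∪ star O v)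
        subset_union_left subset_union_right hBC (hWd x u) (hWd y v), sq (9 / 16 / _)]
    · have hp2 : 0 ≤ 1 - p := by linarith
      have h2 := hW x u hxO hxu
      have h3 := hW y v hyO hyv
      have h4 : 0 ≤ 9 / 16 / (4 * √(N * p) + 1) := by positivity
      have h5 : (1 - p) ^ 4 ≤ (1 - p) ^ #U := pow_le_pow_of_le_one hp2 (by linarith) hcU
      exact mul_le_mul (mul_le_mul_of_nonneg_left h5 (by positivity))
        (mul_le_mul h2 h3 h4 (h4.trans h2)) (mul_nonneg h4 h4) (by positivity)
    · exact union_subset (union_subset (star_subset_pairs hxO) (star_subset_pairs huO))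
        (union_subset (star_subset_pairs hyO) (star_subset_pairs hvO))
    · simp only [disjoint_union_right, hAstar, and_self]
    · intro S
      refine and_congr ?_ ?_
      · rw [subset_inter_iff, and_iff_left subset_union_left]
      · rw [disjoint_iff_inter_eq_empty, disjoint_iff_inter_eq_empty, inter_assoc,
          union_inter_cancel_right]
    · intro S
      simp only [W]
      have e : ∀ q, star O q ⊆ (star O x ∪ star O u) ∪ (star O y ∪ star O v) →
        S ∩ ((star O x ∪ star O u) ∪ (star O y ∪ star O v)) ∩ star O q = S ∩ star O q := by
        intro q hq
        rw [inter_assoc, inter_eq_right.2 hq]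
      rw [e x (by grind), e y (by grind), e u (by grind), e v (by grind)]
  -- Apart from the event in `h1`, only a common neighbour b in O of two of the four vertices can
  -- spoil the star event. Together with xy and uv this needs four edges, hence at most 16N terms
  -- p⁴.
  set K : Finset ((V × V) × V) := ((Q ×ˢ Q) ×ˢ O).filter fun k => k.1.1 ≠ k.1.2 with hK
  let F : (V × V) × V → Finset (Sym2 V) := fun k =>
    {s(x, y), s(u, v), s(k.1.1, k.2), s(k.1.2, k.2)}
  have hcK : #K ≤ 16 * N := by
    refine (card_filter_le _ _).trans (le_of_eq ?_)
    rw [card_product, card_product, hcQ, hcO]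
  have hF : ∀ k ∈ K, pr p (pairs V) (fun S => F k ⊆ S) = p ^ 4 := by
    rintro ⟨⟨q, q'⟩, b⟩ hk
    simp only [hK, mem_filter, mem_product] at hk
    obtain ⟨⟨⟨hq, hq'⟩, hb⟩, hqq'⟩ := hk
    have hbQ : b ∉ Q := (mem_sdiff.1 hb).2
    have hbq : q ≠ b := fun h => hbQ (h ▸ hq)
    have hbq' : q' ≠ b := fun h => hbQ (h ▸ hq')
    simp only [hQ, mem_insert, mem_singleton, not_or] at hbQ
    have hc : #(F ((q, q'), b)) = 4 := by
      simp only [F]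
      rw [card_insert_of_notMem, card_insert_of_notMem, card_insert_of_notMem, card_singleton]
      all_goals
        simp only [mem_insert, mem_singleton, mk_eq_iff]
        grind
    rw [pr_subset, hc]
    intro e he
    simp only [F, mem_insert, mem_singleton] at he
    rcases he with rfl | rfl | rfl | rfl <;> rw [mem_pairs] <;> assumption
  have h2 : (pr p (pairs V) fun S => (T ⊆ S ∧ Disjoint S U) ∧ W x u S ∧ W y v S) ≤
      pr p (pairs V) (fun S => StarEvent lo hi (gr S) x y u v) +
      pr p (pairs V) fun S => ∃ k ∈ K, F k ⊆ S := by
    refine pr_le_add hp0 hp1 fun S hS hE => ?_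
    by_contra hcon
    rw [not_or] at hcon
    obtain ⟨hnot, hbad⟩ := hcon
    push Not at hbad
    obtain ⟨⟨hTS, hSU⟩, hWx, hWy⟩ := hE
    have axy : (gr S).Adj x y := (gr_adj' hS _ _).2 (hTS (by simp [hT]))
    have auv : (gr S).Adj u v := (gr_adj' hS _ _).2 (hTS (by simp [hT]))
    have hn : ∀ a b, s(a, b) ∈ U → ¬ (gr S).Adj a b := fun a b h hab =>
      disjoint_left.1 hSU ((gr_adj' hS _ _).1 hab) h
    have nxu := hn x u (by simp [hU])
    have nxv := hn x v (by simp [hU])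
    have nyu := hn y u (by simp [hU])
    have nyv := hn y v (by simp [hU])
    have hpart : ∀ q ∈ Q, ((gr S).Adj q x → q = y) ∧ ((gr S).Adj q y → q = x) ∧
        ((gr S).Adj q u → q = v) ∧ ((gr S).Adj q v → q = u) := by
      intro q hq
      simp only [hQ, mem_insert, mem_singleton] at hq
      have nux := fun h => nxu (SimpleGraph.Adj.symm h)
      have nvx := fun h => nxv (SimpleGraph.Adj.symm h)
      have nuy := fun h => nyu (SimpleGraph.Adj.symm h)
      have nvy := fun h => nyv (SimpleGraph.Adj.symm h)
      have hl : ∀ a, ¬ (gr S).Adj a a := fun a => (gr S).irrefl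
      rcases hq with h | h | h | h <;> rw [h] <;> refine ⟨?_, ?_, ?_, ?_⟩ <;>
        first
        | exact fun _ => rfl
        | exact fun h => absurd h (hl _)
        | exact fun h => absurd h (by assumption)
    have hcom : ∀ q ∈ Q, ∀ q' ∈ Q, q ≠ q' → ∀ b, (gr S).Adj q b → ¬ (gr S).Adj q' b := by
      intro q hq q' hq' hqq' b hb hb'
      by_cases hbQ : b ∈ Q
      · have p1 := hpart q hq
        have p2 := hpart q' hq'
        simp only [hQ, mem_insert, mem_singleton] at hbQ
        rcases hbQ with rfl | rfl | rfl | rfl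
        · exact hqq' ((p1.1 hb).trans (p2.1 hb').symm)
        · exact hqq' ((p1.2.1 hb).trans (p2.2.1 hb').symm)
        · exact hqq' ((p1.2.2.1 hb).trans (p2.2.2.1 hb').symm)
        · exact hqq' ((p1.2.2.2 hb).trans (p2.2.2.2 hb').symm)
      · refine hbad ((q, q'), b) (mem_filter.2 ⟨mem_product.2 ⟨mem_product.2 ⟨hq, hq'⟩,
          mem_sdiff.2 ⟨mem_univ _, hbQ⟩⟩, hqq'⟩) ?_
        rw [gr_adj' hS] at hb hb' axy auv
        intro e he
        simp only [F, mem_insert, mem_singleton] at he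
        rcases he with rfl | rfl | rfl | rfl <;> assumption
    -- The degree is the number of neighbours in O plus one for the partner edge; this is the shift
    -- by 1 in the bounds on `lo` and `hi`.
    have hdeg : ∀ q ∈ Q, ∀ q' ∈ Q, (gr S).Adj q q' → (∀ r ∈ Q, (gr S).Adj q r → r = q') →
        deg (gr S) q = #(S ∩ star O q) + 1 := by
      intro q hq q' hq' hqq' hr
      rw [deg_gr hS, card_inter_star,
        ← card_insert_of_notMem (a := q') (by simp only [hO, mem_filter, mem_sdiff]; tauto)]
      congr 1
      ext b
      rw [← gr_adj_nb hS, mem_insert, mem_filter, ← gr_adj' hS, hO, mem_sdiff]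
      constructor
      · intro hb
        by_cases hbQ : b ∈ Q
        · exact Or.inl (hr b hbQ hb)
        · exact Or.inr ⟨⟨mem_univ _, hbQ⟩, hb⟩
      · rintro (rfl | h)
        · exact hqq'
        · exact h.2
    have hx : x ∈ Q := by simp [hQ]
    have hy : y ∈ Q := by simp [hQ]
    have hu : u ∈ Q := by simp [hQ]
    have hv : v ∈ Q := by simp [hQ]
    have dx := hdeg x hx y hy axy fun r hr h => (hpart r hr).1 h.symm
    have dy := hdeg y hy x hx axy.symm fun r hr h => (hpart r hr).2.1 h.symm
    have du := hdeg u hu v hv auv fun r hr h => (hpart r hr).2.2.1 h.symm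
    have dv := hdeg v hv u hu auv.symm fun r hr h => (hpart r hr).2.2.2 h.symm
    have wx := abs_lt.1 hWx.2
    have wy := abs_lt.1 hWy.2
    refine hnot ⟨⟨axy, auv, hxu, hyv, nxu, nxv, nyu, nyv, hcom x hx y hy hxy, hcom x hx u hu hxu,
      hcom x hx v hv hxv, hcom y hy u hu hyu, hcom y hy v hv hyv, hcom u hu v hv huv⟩, ?_, ?_, ?_,
      ?_, ?_, ?_⟩
    · rw [dx, du, hWx.1]
    · rw [dy, dv, hWy.1]
    · rw [dx]; push_cast; linarith
    · rw [dy]; push_cast; linarith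
    · rw [dx]; push_cast; linarith
    · rw [dy]; push_cast; linarith
  have h3 : (pr p (pairs V) fun S => ∃ k ∈ K, F k ⊆ S) ≤ 16 * N * p ^ 4 := by
    refine (pr_le_sum hp0 hp1 K (fun k S => F k ⊆ S) fun S _ h => h).trans ?_
    rw [sum_congr rfl hF, sum_const, nsmul_eq_mul]
    refine mul_le_mul_of_nonneg_right ?_ (by positivity)
    exact_mod_cast hcK
  linarith

end StarLowerBound

end Shotgun

namespace Shotgun

open Finset

/-! ### Good quadruples against ties. -/

section SecondMoment

variable {V : Type u} [Fintype V] [DecidableEq V] {lo hi p : ℝ}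

open Classical in
/-- The number of switchable pairs for which some degree sums agree. -/
noncomputable def tieCount (lo hi : ℝ) (S : Finset (Sym2 V)) : ℝ :=
  ∑ q : V × V × V × V, if StarEvent lo hi (gr S) q.1 q.2.1 q.2.2.1 q.2.2.2 ∧
    (degSum (gr S) q.1 = degSum (gr S) q.2.2.1 ∨ degSum (gr S) q.2.1 = degSum (gr S) q.2.2.2)
    then 1 else 0

/-- A good quadruple without a tie would contradict reconstructibility by `not_reconstructible`. -/
theorem goodCount_le_tieCount {S : Finset (Sym2 V)} (h : Reconstructible 2 (gr S)) :
    goodCount lo hi S ≤ tieCount lo hi S := by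
  classical
  unfold goodCount tieCount
  refine sum_le_sum fun q _ => ?_
  by_cases hg : Good lo hi (gr S) q.1 q.2.1 q.2.2.1 q.2.2.2
  · rw [if_pos hg, if_pos]
    refine ⟨hg.1, ?_⟩
    by_contra hcon
    rw [not_or] at hcon
    exact not_reconstructible hg.1.pair hg.2 hg.1.degx hg.1.degy hcon.1 hcon.2 h
  · rw [if_neg hg]
    split_ifs <;> simp

theorem ex_goodCount : ex p (pairs V) (goodCount lo hi) =
    ∑ q : V × V × V × V, pr p (pairs V) fun S => Good lo hi (gr S) q.1 q.2.1 q.2.2.1 q.2.2.2 := by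
  unfold goodCount pr
  rw [ex_sum]

theorem ex_tieCount : ex p (pairs V) (tieCount lo hi) =
    ∑ q : V × V × V × V, pr p (pairs V) fun S =>
      StarEvent lo hi (gr S) q.1 q.2.1 q.2.2.1 q.2.2.2 ∧
      (degSum (gr S) q.1 = degSum (gr S) q.2.2.1 ∨
        degSum (gr S) q.2.1 = degSum (gr S) q.2.2.2) := by
  unfold tieCount pr
  rw [ex_sum]
  exact sum_congr rfl fun q _ => ex_congr fun S _ => by beta_reduce; congr

/-- A lower bound for the number of quadruples of distinct elements. -/
theorem pow_four_le_card_distinct {N : ℕ} (hN : Fintype.card V = N + 4) :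
    N ^ 4 ≤ #((univ : Finset (V × V × V × V)).filter fun q => q.1 ≠ q.2.1 ∧ q.1 ≠ q.2.2.1 ∧
      q.1 ≠ q.2.2.2 ∧ q.2.1 ≠ q.2.2.1 ∧ q.2.1 ≠ q.2.2.2 ∧ q.2.2.1 ≠ q.2.2.2) := by
  have h1 : N ^ 4 ≤ Fintype.card (Fin 4 ↪ V) := by
    rw [Fintype.card_embedding_eq, hN, Fintype.card_fin]
    exact (Nat.pow_le_pow_left (by omega) 4).trans (Nat.pow_sub_le_descFactorial (N + 4) 4)
  refine h1.trans ?_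
  rw [← card_univ]
  refine card_le_card_of_injOn (fun f => (f 0, f 1, f 2, f 3)) ?_ ?_
  · intro f _
    simp [f.injective.eq_iff]
  · intro f _ g _ h
    simp only [Prod.mk.injEq] at h
    ext i
    fin_cases i
    · exact h.1
    · exact h.2.1
    · exact h.2.2.1
    · exact h.2.2.2

/-- The second moment bound for the probability that the graph is reconstructible. -/
theorem pr_reconstructible_le_dense (hp : 0 < p) (hp1 : p ≤ 1 / 2) {N k : ℕ}
    (hN : Fintype.card V = N + 4) (hN0 : 0 < N) (hk : 2 * hi ≤ k)
    (hlo : lo ≤ N * p - 2 * √(N * p) + 1) (hhi : N * p + 2 * √(N * p) + 1 ≤ hi) (hlo1 : 1 < lo)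
    {β : ℝ} (hβ : 0 ≤ β)
    (hβ1 : 1 ≤ 2 * ((lo - 1) * (Fintype.card V - 4 - 2 * hi) * p) * β ^ 2)
    {γ L v : ℝ} (hγ0 : 0 < γ)
    (hγ : γ ≤ (1 - p) ^ (4 * k ^ 2) * (1 - p ^ 2) ^ (k ^ 2 * Fintype.card V)) (hL0 : 0 < L)
    (hL : L ≤ N ^ 4 * (p ^ 2 * (1 - p) ^ 4 * (9 / 16 / (4 * √(N * p) + 1)) ^ 2 - 16 * N * p ^ 4))
    (hv : (ex p (pairs V) fun S => goodCount lo hi S ^ 2) -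
      ex p (pairs V) (goodCount lo hi) ^ 2 ≤ v) :
    pr p (pairs V) (fun S => Reconstructible 2 (gr S)) ≤ 4 * v / (γ * L) ^ 2 + 4 * β / γ := by
  have hp0 := hp.le
  have hp2 : p ≤ 1 := by linarith
  -- Good quadruples number at least γZ on average and ties at most 2βZ, so Z cancels when they are
  -- compared, leaving 4β/γ.
  set Z := ∑ q : V × V × V × V, pr p (pairs V) fun S =>
    StarEvent lo hi (gr S) q.1 q.2.1 q.2.2.1 q.2.2.2 with hZ
  set X := ex p (pairs V) (goodCount lo hi) with hX
  have hXZ : γ * Z ≤ X := by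
    rw [hX, ex_goodCount, hZ, mul_sum]
    refine sum_le_sum fun q _ => le_trans ?_ (le_pr_good hp0 hp2 hk _ _ _ _)
    exact mul_le_mul_of_nonneg_right hγ (pr_nonneg hp0 hp2)
  have hYZ : ex p (pairs V) (tieCount lo hi) ≤ 2 * β * Z := by
    rw [ex_tieCount, hZ, mul_sum]
    exact sum_le_sum fun q _ => pr_starEvent_degSum_eq_le hp0 hp1 hβ hβ1 hlo1 _ _ _ _
  have hLZ : L ≤ Z := by
    have h1 := pow_four_le_card_distinct hN
    set D := (univ : Finset (V × V × V × V)).filter fun q => q.1 ≠ q.2.1 ∧ q.1 ≠ q.2.2.1 ∧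
      q.1 ≠ q.2.2.2 ∧ q.2.1 ≠ q.2.2.1 ∧ q.2.1 ≠ q.2.2.2 ∧ q.2.2.1 ≠ q.2.2.2 with hD
    set l := p ^ 2 * (1 - p) ^ 4 * (9 / 16 / (4 * √(N * p) + 1)) ^ 2 - 16 * N * p ^ 4 with hl
    have h2 : (N : ℝ) ^ 4 ≤ #D := by exact_mod_cast h1
    have hl0 : 0 ≤ l := by
      by_contra! h
      have : (N : ℝ) ^ 4 * l ≤ 0 := mul_nonpos_of_nonneg_of_nonpos (by positivity) h.le
      linarith
    calc L ≤ (N : ℝ) ^ 4 * l := hL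
      _ ≤ #D * l := mul_le_mul_of_nonneg_right h2 hl0
      _ = ∑ q ∈ D, l := by rw [sum_const, nsmul_eq_mul]
      _ ≤ ∑ q ∈ D, pr p (pairs V) fun S =>
          StarEvent lo hi (gr S) q.1 q.2.1 q.2.2.1 q.2.2.2 := by
        refine sum_le_sum fun q hq => ?_
        obtain ⟨h1, h2, h3, h4, h5, h6⟩ := (mem_filter.1 hq).2
        exact le_pr_starEvent hp hp2 h1 h2 h3 h4 h5 h6 hN hN0 hlo hhi
      _ ≤ Z := sum_le_sum_of_subset_of_nonneg (subset_univ _) fun _ _ _ => pr_nonneg hp0 hp2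
  have hZ0 : 0 < Z := hL0.trans_le hLZ
  have hX0 : 0 < X := (mul_pos hγ0 hZ0).trans_le hXZ
  -- With half of the mean as threshold, the good count deviates by X/2 or the tie count, which
  -- dominates it, reaches X/2.
  have h1 : pr p (pairs V) (fun S => Reconstructible 2 (gr S)) ≤
      pr p (pairs V) (fun S => X / 2 ≤ |goodCount lo hi S - X|) +
      pr p (pairs V) (fun S => X / 2 ≤ tieCount lo hi S) := by
    refine pr_le_add hp0 hp2 fun S _ h => ?_
    have h2 := goodCount_le_tieCount (lo := lo) (hi := hi) h
    by_contra! hcon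
    have h3 := (abs_lt.1 hcon.1).1
    linarith [hcon.2]
  have h2 := chebyshev (s := pairs V) (f := goodCount lo hi) hp0 hp2 (c := X / 2) (by positivity)
  have h3 := markov (s := pairs V) (f := tieCount lo hi) hp0 hp2 (fun S _ => by
    unfold tieCount
    exact sum_nonneg fun q _ => by split_ifs <;> simp) (X / 2)
  have hγL : γ * L ≤ X := (mul_le_mul_of_nonneg_left hLZ hγ0.le).trans hXZ
  have h4 : pr p (pairs V) (fun S => X / 2 ≤ |goodCount lo hi S - X|) ≤ 4 * v / (γ * L) ^ 2 := by
    have h5 : (γ * L) ^ 2 ≤ X ^ 2 := pow_le_pow_left₀ (by positivity) hγL 2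
    rw [le_div_iff₀ (by positivity)]
    have h6 : 0 ≤ pr p (pairs V) (fun S => X / 2 ≤ |goodCount lo hi S - X|) := pr_nonneg hp0 hp2
    have h7 := mul_le_mul_of_nonneg_left h5 h6
    have h8 := h2.trans hv
    linarith
  have h5 : pr p (pairs V) (fun S => X / 2 ≤ tieCount lo hi S) ≤ 4 * β / γ := by
    rw [le_div_iff₀ hγ0]
    have h6 : 0 ≤ pr p (pairs V) (fun S => X / 2 ≤ tieCount lo hi S) := pr_nonneg hp0 hp2
    have h7 := mul_le_mul_of_nonneg_left hXZ h6
    have h8 : Z * (pr p (pairs V) (fun S => X / 2 ≤ tieCount lo hi S) * γ) ≤ Z * (4 * β) := by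
      nlinarith [h3.trans hYZ]
    exact le_of_mul_le_mul_left h8 hZ0
  linarith

end SecondMoment

end Shotgun

namespace Shotgun

open Finset

/-! ### Explicit estimates in the dense range. -/

section Estimates

/-- A Chernoff type tail: bound the binomial coefficient by n^K/K! and compare (np e³)^K/K! with one
term of the exponential series. -/
theorem choose_mul_pow_le {n K : ℕ} {p : ℝ} (hp : 0 ≤ p) :
    (n.choose K : ℝ) * p ^ K ≤ Real.exp (n * p * Real.exp 3 - 3 * K) := by
  have h1 : (n.choose K : ℝ) ≤ n ^ K / K.factorial := Nat.choose_le_pow_div K n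
  have h2 := Real.pow_div_factorial_le_exp (n * p * Real.exp 3) (by positivity) K
  have h3 : (n : ℝ) ^ K / K.factorial * p ^ K * Real.exp (3 * K) ≤
      Real.exp (n * p * Real.exp 3) := by
    refine le_trans (le_of_eq ?_) h2
    rw [mul_pow, mul_pow, ← Real.exp_nat_mul]
    ring_nf
  rw [Real.exp_sub, le_div_iff₀ (Real.exp_pos _)]
  refine le_trans ?_ h3
  gcongr

theorem exp_neg_le_one_sub {x : ℝ} (hx : 0 ≤ x) (hx1 : x ≤ 1 / 100) :
    Real.exp (-(11 / 10 * x)) ≤ 1 - x := by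
  rw [Real.exp_neg, inv_le_comm₀ (Real.exp_pos _) (by linarith)]
  refine le_trans ?_ (Real.add_one_le_exp _)
  rw [inv_le_iff_one_le_mul₀ (by linarith)]
  nlinarith

theorem exp_neg_le_pow_mul_pow {p : ℝ} (hp : 0 ≤ p) (hp1 : p ≤ 1 / 100) (a b : ℕ) :
    Real.exp (-(11 / 10 * (a * p + b * p ^ 2))) ≤ (1 - p) ^ a * (1 - p ^ 2) ^ b := by
  have h1 := pow_le_pow_left₀ (Real.exp_pos _).le (exp_neg_le_one_sub hp hp1) a
  have h2 := pow_le_pow_left₀ (Real.exp_pos _).le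
    (exp_neg_le_one_sub (sq_nonneg p) (by nlinarith)) b
  refine le_trans (le_of_eq ?_) (mul_le_mul h1 h2 (by positivity) (by
    have : 0 ≤ 1 - p := by linarith
    positivity))
  rw [← Real.exp_nat_mul, ← Real.exp_nat_mul, ← Real.exp_add]
  ring_nf

theorem sq_mul_le_starBound {n N p d : ℝ} (hN : N = n - 4) (hd : d = n * p) (hd1 : 1000 ≤ d)
    (hdn : 10000 * d ^ 3 ≤ n) :
    n ^ 2 * d / 200 ≤
      N ^ 4 * (p ^ 2 * (1 - p) ^ 4 * (9 / 16 / (4 * √(N * p) + 1)) ^ 2 - 16 * N * p ^ 4) := by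
  have hd0 : 0 < d := by linarith
  have hd3 : 1000 * 1000 * d ≤ d ^ 3 := by nlinarith [mul_le_mul hd1 hd1 (by norm_num) hd0.le]
  have hn : 10000 ≤ n := by nlinarith
  have hn0 : 0 < n := by linarith
  have hp : p = d / n := by rw [hd]; field_simp
  have hp0 : 0 < p := by rw [hp]; positivity
  have hp1 : p ≤ 1 / 100 := by
    rw [hp, div_le_iff₀ hn0]; nlinarith
  have hNp : 0 ≤ N * p := by rw [hN]; nlinarith
  have hNd : N * p ≤ d := by rw [hN, hd]; nlinarith
  set t := √(N * p)
  have ht : t ^ 2 = N * p := Real.sq_sqrt hNp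
  have ht0 : 0 ≤ t := Real.sqrt_nonneg _
  -- Equivalent to (4t + 1)² ≤ 25d, which follows from 8t ≤ t² + 16 and t² ≤ d.
  have hw : 81 / 6400 / d ≤ (9 / 16 / (4 * t + 1)) ^ 2 := by
    rw [div_pow, div_div, div_le_div_iff₀ (by positivity) (by positivity)]
    nlinarith [sq_nonneg (t - 4)]
  have hq : 96 / 100 ≤ (1 - p) ^ 4 := by
    have := one_add_mul_le_pow (a := -p) (by linarith) 4
    norm_num at this
    have h2 : (1 - p) ^ 4 = (1 + -p) ^ 4 := by ring
    rw [h2]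
    linarith
  have hNp2 : 16 * N * p ^ 4 ≤ p ^ 2 * (16 / 10000 / d) := by
    have h1 : 16 * N * p ^ 2 ≤ 16 / 10000 / d := by
      rw [le_div_iff₀ hd0]
      have h2 : n * p ^ 2 * d = d ^ 3 / n := by rw [hp]; field_simp
      have h3 : d ^ 3 / n ≤ 1 / 10000 := by rw [div_le_iff₀ hn0]; linarith
      have h4 : N * (p ^ 2 * d) ≤ n * (p ^ 2 * d) :=
        mul_le_mul_of_nonneg_right (by linarith) (by positivity)
      nlinarith
    calc 16 * N * p ^ 4 = p ^ 2 * (16 * N * p ^ 2) := by ring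
      _ ≤ _ := mul_le_mul_of_nonneg_left h1 (by positivity)
  have hmain : p ^ 2 * (1 / 100 / d) ≤
      p ^ 2 * (1 - p) ^ 4 * (9 / 16 / (4 * t + 1)) ^ 2 - 16 * N * p ^ 4 := by
    have h1 : 96 / 100 * (81 / 6400 / d) ≤ (1 - p) ^ 4 * (9 / 16 / (4 * t + 1)) ^ 2 :=
      mul_le_mul hq hw (by positivity) (by positivity)
    have h2 := mul_le_mul_of_nonneg_left h1 (sq_nonneg p)
    have h3 : p ^ 2 * (96 / 100 * (81 / 6400 / d)) - p ^ 2 * (16 / 10000 / d) ≥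
        p ^ 2 * (1 / 100 / d) := by
      have : 0 ≤ p ^ 2 / d := by positivity
      have e : ∀ c : ℝ, p ^ 2 * (c / d) = c * (p ^ 2 / d) := fun c => by ring
      rw [← mul_div_assoc, e, e, e]
      nlinarith
    linarith
  have hN4 : n ^ 4 / 2 ≤ N ^ 4 := by
    have h1 : 9 / 10 * n ≤ N := by linarith
    have h2 := pow_le_pow_left₀ (by linarith) h1 4
    nlinarith [pow_pos hn0 4]
  calc n ^ 2 * d / 200 = n ^ 4 / 2 * (p ^ 2 * (1 / 100 / d)) := by rw [hp]; field_simp; norm_num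
    _ ≤ N ^ 4 * (p ^ 2 * (1 / 100 / d)) := mul_le_mul_of_nonneg_right hN4 (by positivity)
    _ ≤ _ := mul_le_mul_of_nonneg_left hmain (by positivity)

theorem varianceBound_le {n d K : ℝ} (hd1 : 1000 ≤ d) (hdn : 10000 * d ^ 3 ≤ n) (hK1 : 1 ≤ K)
    (hK : K ≤ 101 * d) :
    2 * (n * K) * (8 * n * K ^ 2 * (1 + 2 * 26) + 16 * (K ^ 4 + K ^ 5)) ^ 2 +
      128 * n ^ 2 * K ^ 4 * 26 * d ^ 5 + 2 ≤ 10 ^ 18 * (n ^ 3 * d ^ 5 + n ^ 2 * d ^ 9) := by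
  have hd0 : 0 < d := by linarith
  have hK0 : 0 < K := by linarith
  have hn : 1 ≤ n := by
    have : (1 : ℝ) ≤ d ^ 3 := one_le_pow₀ (by linarith)
    linarith
  have hn0 : 0 < n := by linarith
  -- Since d³ is small against n, the terms K⁴ and K⁵ from paths through the removed edge are
  -- absorbed into nK².
  have h3 : K ^ 3 ≤ 104 * n := by
    have := pow_le_pow_left₀ hK0.le hK 3
    nlinarith
  have h4 : K ^ 4 ≤ 101 ^ 4 * d ^ 4 := by
    rw [← mul_pow]; exact pow_le_pow_left₀ hK0.le hK 4
  have h5 : K ^ 5 ≤ 101 ^ 5 * d ^ 5 := by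
    rw [← mul_pow]; exact pow_le_pow_left₀ hK0.le hK 5
  have h45 : K ^ 4 ≤ K ^ 5 := pow_le_pow_right₀ hK1 (by norm_num)
  have h6 : K ^ 5 ≤ 104 * (n * K ^ 2) := by
    have := mul_le_mul_of_nonneg_right h3 (sq_nonneg K)
    linarith
  have h7 : 8 * n * K ^ 2 * (1 + 2 * 26) + 16 * (K ^ 4 + K ^ 5) ≤ 4000 * (n * K ^ 2) := by
    have : 0 ≤ n * K ^ 2 := by positivity
    linarith
  have h8 : (8 * n * K ^ 2 * (1 + 2 * 26) + 16 * (K ^ 4 + K ^ 5)) ^ 2 ≤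
      16000000 * (n ^ 2 * K ^ 4) := by
    refine (pow_le_pow_left₀ (by positivity) h7 2).trans (le_of_eq (by ring))
  have h9 : 2 * (n * K) * (8 * n * K ^ 2 * (1 + 2 * 26) + 16 * (K ^ 4 + K ^ 5)) ^ 2 ≤
      32000000 * (101 ^ 5 * (n ^ 3 * d ^ 5)) := by
    calc _ ≤ 2 * (n * K) * (16000000 * (n ^ 2 * K ^ 4)) :=
        mul_le_mul_of_nonneg_left h8 (by positivity)
      _ = 32000000 * (n ^ 3 * K ^ 5) := by ring
      _ ≤ 32000000 * (n ^ 3 * (101 ^ 5 * d ^ 5)) := by gcongr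
      _ = _ := by ring
  have h10 : 128 * n ^ 2 * K ^ 4 * 26 * d ^ 5 ≤ 3328 * (101 ^ 4 * (n ^ 2 * d ^ 9)) := by
    calc _ = 3328 * (n ^ 2 * K ^ 4 * d ^ 5) := by ring
      _ ≤ 3328 * (n ^ 2 * (101 ^ 4 * d ^ 4) * d ^ 5) := by gcongr
      _ = _ := by ring
  have h11 : (1 : ℝ) ≤ n ^ 3 * d ^ 5 :=
    one_le_mul_of_one_le_of_one_le (one_le_pow₀ hn) (one_le_pow₀ (by linarith))
  have h12 : 0 ≤ n ^ 2 * d ^ 9 := by positivity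
  linarith

set_option maxHeartbeats 1000000 in
theorem pr_reconstructible_le_inv_log {V : Type u} [Fintype V] [DecidableEq V] {p d l : ℝ}
    (hp : 0 ≤ p) (hd : d = Fintype.card V * p) (hl : l = Real.log (Fintype.card V))
    (hl1 : 20000 ≤ l) (hld : l / 10 ≤ d) (hdl : 81 * d ^ 4 ≤ Fintype.card V * l) :
    pr p (pairs V) (fun S => Reconstructible 2 (gr S)) ≤ 10 ^ 30 / l := by
  set n : ℝ := (Fintype.card V : ℝ) with hn
  have hl0 : 0 < l := by linarith
  have hn0 : 0 < n := by
    by_contra! h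
    have : n = 0 := le_antisymm h (by rw [hn]; positivity)
    rw [this, Real.log_zero] at hl
    linarith
  have hnl : n = Real.exp l := by rw [hl, Real.exp_log hn0]
  -- m is n^(1/100), so powers of n and d can be compared through integer powers of m.
  set m := Real.exp (l / 100) with hm
  have hmk : ∀ k : ℕ, m ^ k = Real.exp (k * l / 100) := by
    intro k; rw [hm, ← Real.exp_nat_mul]; ring_nf
  have hnm : n = m ^ 100 := by rw [hmk, hnl]; norm_num
  -- The quadratic term (l/100)²/2 of the exponential is at least l exactly when l ≥ 20000.
  have hlm : l ≤ m := by
    have := Real.quadratic_le_exp_of_nonneg (x := l / 100) (by positivity)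
    nlinarith only [this, hl1]
  have hm1 : 20000 ≤ m := hl1.trans hlm
  have hm0 : 0 < m := by linarith
  have hm1' : 1 ≤ m := by linarith
  have hd1 : 1000 ≤ d := by linarith
  have hd0 : 0 < d := by linarith
  have hd4 : d ^ 4 ≤ m ^ 101 := by
    have : n * l ≤ n * m := mul_le_mul_of_nonneg_left hlm hn0.le
    have h2 : n * m = m ^ 101 := by rw [hnm]; ring
    have h3 : 0 ≤ d ^ 4 := by positivity
    linarith
  have hdm : d ≤ m ^ 26 := by
    refine le_of_pow_le_pow_left₀ (n := 4) (by norm_num) (by positivity) (hd4.trans ?_)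
    rw [← pow_mul]
    exact pow_le_pow_right₀ hm1' (by norm_num)
  have hd3 : d ^ 3 ≤ m ^ 78 := by
    refine (pow_le_pow_left₀ hd0.le hdm 3).trans (le_of_eq ?_)
    rw [← pow_mul]
  have hd7 : d ^ 7 ≤ m ^ 179 := by
    calc d ^ 7 = d ^ 3 * d ^ 4 := by ring
      _ ≤ m ^ 78 * m ^ 101 := mul_le_mul hd3 hd4 (by positivity) (by positivity)
      _ = m ^ 179 := by ring
  have hdn : 10000 * d ^ 3 ≤ n := by
    calc 10000 * d ^ 3 ≤ m * m ^ 78 := mul_le_mul (by linarith) hd3 (by positivity) hm0.le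
      _ = m ^ 79 := by ring
      _ ≤ n := by rw [hnm]; exact pow_le_pow_right₀ hm1' (by norm_num)
  have hdn1 : 10000 * 1000000 * d ≤ n := by
    have h1 : 1000 * 1000 * d ≤ d * d * d :=
      mul_le_mul_of_nonneg_right (mul_le_mul hd1 hd1 (by norm_num) hd0.le) hd0.le
    have h2 : d ^ 3 = d * d * d := by ring
    linarith
  have hpd : p = d / n := by rw [hd]; field_simp
  have hp0 : 0 < p := by rw [hpd]; positivity
  have hp1 : p ≤ 1 / 100 := by
    rw [hpd, div_le_iff₀ hn0]; linarith
  have hN4 : 4 < Fintype.card V := by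
    have : (4 : ℝ) < Fintype.card V := by rw [← hn]; linarith
    exact_mod_cast this
  obtain ⟨N, hN⟩ : ∃ N, Fintype.card V = N + 4 := ⟨Fintype.card V - 4, by omega⟩
  have hN0 : 0 < N := by omega
  have hNn : (N : ℝ) = n - 4 := by rw [hn, hN]; push_cast; ring
  have hNp : (N : ℝ) * p = d - 4 * p := by rw [hNn, hd]; ring
  set t := √(N * p) with htdef
  have ht : t ^ 2 = d - 4 * p := by rw [htdef, Real.sq_sqrt (by positivity), hNp]
  have ht0 : 0 ≤ t := Real.sqrt_nonneg _
  -- Then 2t + 1 ≤ t²/10, and the degree window Np ± 2√(Np) + 1 lies between d/2 and 1.1d.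
  have ht25 : 25 ≤ t := by nlinarith only [ht, ht0, hd1, hp1]
  set k := ⌈2.2 * d⌉₊ with hk
  have hk1 : 2 * (1.1 * d) ≤ k := by
    have := Nat.le_ceil (2.2 * d)
    rw [← hk] at this
    linarith
  have hk2 : (k : ℝ) ≤ 2.3 * d := by
    have := Nat.ceil_lt_add_one (a := 2.2 * d) (by positivity)
    rw [← hk] at this
    linarith
  set K := ⌈100 * d⌉₊ with hK
  have hK1 : 100 * d ≤ K := Nat.le_ceil _
  have hK2 : (K : ℝ) ≤ 101 * d := by
    have := Nat.ceil_lt_add_one (a := 100 * d) (by positivity)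
    rw [← hK] at this
    linarith
  -- The exponent is at most 5.29 · 1.1 · 1.1 < 7 times d⁴/n, from k ≤ 2.3d, the loss 11/10 in 1 - x
  -- ≥ exp(-1.1x), and the lower order term 4p.
  set γ := Real.exp (-(7 * (d ^ 4 / n))) with hγ
  have hγ1 : γ ≤ (1 - p) ^ (4 * k ^ 2) * (1 - p ^ 2) ^ (k ^ 2 * Fintype.card V) := by
    refine le_trans (Real.exp_le_exp.2 (neg_le_neg ?_))
      (exp_neg_le_pow_mul_pow hp hp1 (4 * k ^ 2) (k ^ 2 * Fintype.card V))
    push_cast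
    rw [← hn]
    have h1 : (k : ℝ) ^ 2 ≤ 5.29 * d ^ 2 := by
      refine (pow_le_pow_left₀ (Nat.cast_nonneg k) hk2 2).trans (le_of_eq (by ring))
    have h2 : 11 / 10 * (4 * (k : ℝ) ^ 2 * p + (k : ℝ) ^ 2 * n * p ^ 2) =
        (k : ℝ) ^ 2 * (11 / 10 * (4 * p + n * p ^ 2)) := by ring
    have h3 : 4 * p + n * p ^ 2 ≤ 1.1 * (d ^ 2 / n) := by
      have e1 : n * p ^ 2 = d ^ 2 / n := by rw [hpd]; field_simp
      have e2 : 4 * p ≤ 0.1 * (d ^ 2 / n) := by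
        rw [hpd, ← mul_div_assoc, ← mul_div_assoc]
        exact div_le_div_of_nonneg_right (by nlinarith only [hd1]) hn0.le
      linarith
    have h4 : d ^ 4 / n = d ^ 2 * (d ^ 2 / n) := by ring
    rw [h2]
    calc _ ≤ 5.29 * d ^ 2 * (11 / 10 * (1.1 * (d ^ 2 / n))) := by gcongr
      _ = 6.4009 * (d ^ 4 / n) := by rw [h4]; ring
      _ ≤ _ := by
        have : 0 ≤ d ^ 4 / n := by positivity
        linarith
  have hγ0 : 0 < γ := Real.exp_pos _
  -- Here d⁴/n ≤ l/81 enters, and 7/81 < 1/10.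
  have hγinv : γ⁻¹ ≤ m ^ 10 := by
    rw [hγ, ← Real.exp_neg, neg_neg, hmk]
    refine Real.exp_le_exp.2 ?_
    have : d ^ 4 / n ≤ l / 81 := by
      rw [div_le_div_iff₀ hn0 (by norm_num)]
      linarith
    norm_num
    linarith
  have hvar := variance_goodCount_le (V := V) hp (by linarith) (d / 2) (1.1 * d) K 26
  rw [← hn] at hvar
  -- With K ≥ 100d and e³ ≤ 27 the exponent is at most -273d, and l ≤ 10d makes this less than -11l.
  have htail1 : n ^ 11 * ((Fintype.card V).choose K * p ^ K) ≤ 1 := by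
    have h1 := choose_mul_pow_le (n := Fintype.card V) (K := K) hp
    rw [← hn, ← hd] at h1
    have h2 : Real.exp 3 ≤ 27 := by
      have h3 : Real.exp 3 = Real.exp 1 ^ 3 := by rw [← Real.exp_nat_mul]; norm_num
      rw [h3]
      have := pow_le_pow_left₀ (Real.exp_pos 1).le (Real.exp_one_lt_d9.le.trans
        (by norm_num : (2.7182818286 : ℝ) ≤ 3)) 3
      linarith
    have h3 : Real.exp (d * Real.exp 3 - 3 * K) ≤ Real.exp (-(11 * l)) := by
      refine Real.exp_le_exp.2 ?_
      have := mul_le_mul_of_nonneg_left h2 hd0.le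
      linarith
    have h4 : n ^ 11 = Real.exp (11 * l) := by rw [hnl, ← Real.exp_nat_mul]; norm_num
    calc _ ≤ Real.exp (11 * l) * Real.exp (-(11 * l)) := by
          rw [h4]
          exact mul_le_mul_of_nonneg_left (h1.trans h3) (Real.exp_pos _).le
      _ = 1 := by rw [← Real.exp_add]; simp
  -- The codegree cap 26 is large enough: d ≤ n^0.26 gives d⁵² ≤ n^13.52, below n¹⁴.
  have htail2 : n ^ 12 * ((Fintype.card V).choose 26 * p ^ (2 * 26)) ≤ 1 := by
    have h1 : ((Fintype.card V).choose 26 : ℝ) ≤ n ^ 26 := by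
      rw [hn]; exact_mod_cast Nat.choose_le_pow _ _
    have h2 : d ^ 52 ≤ m ^ 1352 := by
      refine (pow_le_pow_left₀ hd0.le hdm 52).trans (le_of_eq ?_)
      rw [← pow_mul]
    calc _ ≤ n ^ 12 * (n ^ 26 * p ^ (2 * 26)) := by gcongr
      _ = d ^ 52 / n ^ 14 := by
        rw [eq_div_iff (by positivity), hd, mul_pow]
        ring
      _ ≤ 1 := by
        rw [div_le_one (by positivity)]
        refine h2.trans ?_
        rw [hnm, ← pow_mul]
        exact pow_le_pow_right₀ hm1' (by norm_num)
  have hv := varianceBound_le (n := n) (K := K) hd1 hdn (by linarith) hK2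
  have hnp5 : n ^ 5 * p ^ 5 = d ^ 5 := by rw [← mul_pow, ← hd]
  have hvar2 : (ex p (pairs V) fun S => goodCount (d / 2) (1.1 * d) S ^ 2) -
      ex p (pairs V) (goodCount (d / 2) (1.1 * d)) ^ 2 ≤
      10 ^ 18 * (n ^ 3 * d ^ 5 + n ^ 2 * d ^ 9) := by
    refine hvar.trans (le_trans ?_ hv)
    rw [hnp5, mul_add (n ^ 10), ← mul_assoc (n ^ 10), ← mul_assoc (n ^ 10)]
    have e1 : n ^ 10 * n = n ^ 11 := by ring
    have e2 : n ^ 10 * n ^ 2 = n ^ 12 := by ring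
    rw [e1, e2]
    rw [show 2 * 26 = 52 from rfl] at htail2 ⊢
    rw [Nat.cast_ofNat]
    linarith
  -- β = 2/d satisfies the tie condition because at least d/4 free neighbours meet at least n/2
  -- outside vertices, and 2(d/4)(n/2)p(2/d)² = 1.
  have hmain := pr_reconstructible_le_dense (V := V) (lo := d / 2) (hi := 1.1 * d) (β := 2 / d)
    (γ := γ) (L := n ^ 2 * d / 200) hp0 (by linarith) hN hN0 hk1
    (by nlinarith only [ht, hNp, ht25, hp1, hp0]) (by nlinarith only [ht, hNp, ht25, hp0])
    (by linarith) (by positivity) (by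
      rw [← hn]
      have h1 : d / 4 ≤ d / 2 - 1 := by linarith
      have h2 : n / 2 ≤ n - 4 - 2 * (1.1 * d) := by linarith
      have h3 : 2 * (d / 4 * (n / 2) * p) * (2 / d) ^ 2 = 1 := by
        rw [hpd]; field_simp; norm_num
      refine h3.symm.le.trans ?_
      have : 0 ≤ d / 2 - 1 := by linarith only [hd1]
      gcongr) hγ0 hγ1 (by positivity)
    (sq_mul_le_starBound hNn hd hd1 hdn) hvar2
  refine hmain.trans ?_
  have hT1 : 4 * (10 ^ 18 * (n ^ 3 * d ^ 5 + n ^ 2 * d ^ 9)) / (γ * (n ^ 2 * d / 200)) ^ 2 ≤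
      10 ^ 25 / l := by
    have e : 4 * (10 ^ 18 * (n ^ 3 * d ^ 5 + n ^ 2 * d ^ 9)) / (γ * (n ^ 2 * d / 200)) ^ 2 =
        16 * 10 ^ 22 * (γ⁻¹ ^ 2 * (d ^ 3 / n + d ^ 7 / n ^ 2)) := by
      field_simp; norm_num
    have h1 : γ⁻¹ ^ 2 ≤ m ^ 20 := by
      refine (pow_le_pow_left₀ (by positivity) hγinv 2).trans (le_of_eq (by ring))
    have h2 : d ^ 3 / n ≤ 1 / m ^ 21 := by
      rw [hnm, div_le_div_iff₀ (by positivity) (by positivity)]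
      calc d ^ 3 * m ^ 21 ≤ m ^ 78 * m ^ 21 := by gcongr
        _ = m ^ 99 := by ring
        _ ≤ 1 * m ^ 100 := by rw [one_mul]; exact pow_le_pow_right₀ hm1' (by norm_num)
    have h3 : d ^ 7 / n ^ 2 ≤ 1 / m ^ 21 := by
      rw [hnm, div_le_div_iff₀ (by positivity) (by positivity)]
      calc d ^ 7 * m ^ 21 ≤ m ^ 179 * m ^ 21 := by gcongr
        _ = 1 * (m ^ 100) ^ 2 := by ring
    rw [e]
    calc _ ≤ 16 * 10 ^ 22 * (m ^ 20 * (1 / m ^ 21 + 1 / m ^ 21)) := by gcongr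
      _ = 32 * 10 ^ 22 / m := by field_simp; norm_num
      _ ≤ 10 ^ 25 / m := by gcongr; norm_num
      _ ≤ 10 ^ 25 / l := by gcongr
  have hT2 : 4 * (2 / d) / γ ≤ 10 ^ 6 / l := by
    have e : 4 * (2 / d) / γ = 8 / d * γ⁻¹ := by ring
    rw [e]
    -- Either γ is bounded below by a constant, or d > n^(1/4) beats the possible loss n^(1/10) in
    -- 1/γ.
    by_cases hc : d ^ 4 ≤ n
    · have h1 : γ⁻¹ ≤ 2187 := by
        rw [hγ, ← Real.exp_neg, neg_neg]
        have h2 : Real.exp 7 = Real.exp 1 ^ 7 := by rw [← Real.exp_nat_mul]; norm_num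
        have h3 := pow_le_pow_left₀ (Real.exp_pos 1).le (Real.exp_one_lt_d9.le.trans
          (by norm_num : (2.7182818286 : ℝ) ≤ 3)) 7
        have h4 : d ^ 4 / n ≤ 1 := by rw [div_le_one hn0]; exact hc
        have h5 : Real.exp (7 * (d ^ 4 / n)) ≤ Real.exp 7 := Real.exp_le_exp.2 (by linarith)
        linarith
      calc 8 / d * γ⁻¹ ≤ 8 / (l / 10) * 2187 := by gcongr
        _ = 174960 / l := by field_simp; norm_num
        _ ≤ _ := by gcongr; norm_num
    · push Not at hc
      have h1 : m ^ 25 ≤ d := by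
        refine le_of_pow_le_pow_left₀ (n := 4) (by norm_num) hd0.le ?_
        rw [← pow_mul]
        norm_num
        rw [← hnm]
        exact hc.le
      calc 8 / d * γ⁻¹ ≤ 8 / m ^ 25 * m ^ 10 := by gcongr
        _ = 8 / m ^ 15 := by field_simp
        _ ≤ 8 / m := by
          gcongr
          exact le_self_pow₀ hm1' (by norm_num)
        _ ≤ 10 ^ 6 / l := by gcongr; norm_num
  calc _ ≤ 10 ^ 25 / l + 10 ^ 6 / l := add_le_add hT1 hT2
    _ = (10 ^ 25 + 10 ^ 6) / l := by ring
    _ ≤ 10 ^ 30 / l := by gcongr; norm_num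

end Estimates

end Shotgun

namespace Shotgun

open Finset

/-! ### Both ranges together, and the limit. -/

section Limit

open Filter Topology

theorem pr_reconstructible_le_of_sparse {V : Type u} [Fintype V] [DecidableEq V] {p d l h : ℝ}
    (hp : 0 < p) (hd : d = Fintype.card V * p) (hl : l = Real.log (Fintype.card V))
    (hld : d ≤ l / 10) (hn : 8 ≤ Fintype.card V) (hln : l / Fintype.card V ≤ 1 / 10)
    (hh : h = Real.exp 6 / (Fintype.card V * d ^ 4) + Real.exp (-(9 / 20 * l)))
    (hh1 : 200000 * h < 1) :
    pr p (pairs V) (fun S => Reconstructible 2 (gr S)) ≤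
      4 * (100000 * h + 5 * (l / Fintype.card V)) := by
  set n : ℝ := (Fintype.card V : ℝ) with hnV
  have hn8 : (8 : ℝ) ≤ n := by rw [hnV]; exact_mod_cast hn
  have hn0 : 0 < n := by linarith
  have hd0 : 0 < d := by rw [hd]; positivity
  have hnl : n = Real.exp l := by rw [hl, Real.exp_log hn0]
  have hpd : p = d / n := by rw [hd]; field_simp
  have hpl : p ≤ l / n / 10 := by
    rw [hpd, div_div, mul_comm, ← div_div]
    exact div_le_div_of_nonneg_right hld hn0.le
  have hp1 : p ≤ 1 / 100 := by linarith
  have h0 : 0 < h := by rw [hh]; positivity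
  -- The mean is at least n d⁴ exp(-5.5d)/32. The first term of h serves d ≤ 1, where the
  -- exponential is at least e⁻⁶; the second serves 1 < d ≤ l/10, where n exp(-5.5d) ≥ exp(9l/20).
  have hM : 1 / (32 * h) ≤ (n / 2) ^ 5 * p ^ 4 * (1 - p) ^ (5 * Fintype.card V) := by
    have h1 := exp_neg_le_pow_mul_pow hp.le hp1 (5 * Fintype.card V) 0
    push_cast at h1
    rw [← hnV, pow_zero, mul_one, zero_mul, add_zero,
      show 11 / 10 * (5 * n * p) = 11 / 2 * d by rw [hd]; ring] at h1
    have h2 : (n / 2) ^ 5 * p ^ 4 = n * d ^ 4 / 32 := by rw [hpd]; field_simp; norm_num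
    rw [h2]
    refine le_trans ?_ (mul_le_mul_of_nonneg_left h1 (by positivity))
    rw [div_le_iff₀ (by positivity)]
    have h3 : n * d ^ 4 / 32 * Real.exp (-(11 / 2 * d)) * (32 * h) =
        n * d ^ 4 * Real.exp (-(11 / 2 * d)) * h := by ring
    rw [h3]
    by_cases hc : d ≤ 1
    · have h4 : Real.exp 6 / (n * d ^ 4) ≤ h := by
        rw [hh]; exact le_add_of_nonneg_right (Real.exp_pos _).le
      calc 1 ≤ Real.exp (-(11 / 2 * d) + 6) := Real.one_le_exp (by linarith)
        _ = n * d ^ 4 * Real.exp (-(11 / 2 * d)) * (Real.exp 6 / (n * d ^ 4)) := by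
          rw [Real.exp_add]; field_simp
        _ ≤ _ := by gcongr
    · push Not at hc
      have h4 : Real.exp (-(9 / 20 * l)) ≤ h := by
        rw [hh]; exact le_add_of_nonneg_left (by positivity)
      have h5 : (1 : ℝ) ≤ d ^ 4 := one_le_pow₀ hc.le
      calc 1 ≤ Real.exp (l + -(11 / 2 * d) + -(9 / 20 * l)) := Real.one_le_exp (by linarith)
        _ = n * 1 * Real.exp (-(11 / 2 * d)) * Real.exp (-(9 / 20 * l)) := by
          rw [Real.exp_add, Real.exp_add, hnl]; ring
        _ ≤ _ := by gcongr
  have hM1 : 6250 < 1 / (32 * h) := by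
    rw [lt_div_iff₀ (by positivity)]
    linarith
  refine (pr_reconstructible_le_sparse hp.le (by linarith) hn hM1 hM).trans ?_
  have h1 : 3125 / (1 / (32 * h)) = 100000 * h := by field_simp; norm_num
  -- Bernoulli's inequality, and (1 + 50p)(1 - 25p) ≥ 1 for p ≤ 1/50.
  have h2 : 1 / (1 - p) ^ 25 - 1 ≤ 50 * p := by
    have h3 := one_add_mul_le_pow (a := -p) (by linarith) 25
    have h4 : 1 - 25 * p ≤ (1 - p) ^ 25 := by
      refine le_trans (le_of_eq ?_) h3
      norm_num
      ring
    rw [sub_le_iff_le_add, div_le_iff₀ (by linarith)]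
    nlinarith
  rw [h1]
  linarith

/-- The range may change with n infinitely often, so the sum g of the bounds for the two ranges is
used for every large n. -/
theorem tendsto_pr_reconstructible (p : ℕ → unitInterval)
    (hlower : Asymptotics.IsLittleO atTop
      (fun n : ℕ => (n : ℝ) ^ (-(5 / 4) : ℝ)) (fun n : ℕ => (p n : ℝ)))
    (hupper : ∀ᶠ n : ℕ in atTop,
      (p n : ℝ) ≤ 1 / 3 * (n : ℝ) ^ (-(3 / 4) : ℝ) * Real.log n ^ (1 / 4 : ℝ)) :
    Tendsto (fun n : ℕ => pr (p n : ℝ) (pairs (Fin n)) fun S => Reconstructible 2 (gr S)) atTop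
      (𝓝 0) := by
  have hlog : Tendsto (fun n : ℕ => Real.log n) atTop atTop :=
    Real.tendsto_log_atTop.comp tendsto_natCast_atTop_atTop
  have hlogn : Tendsto (fun n : ℕ => Real.log n / n) atTop (𝓝 0) :=
    (Real.isLittleO_log_id_atTop.tendsto_div_nhds_zero).comp tendsto_natCast_atTop_atTop
  let h : ℕ → ℝ := fun n => Real.exp 6 * ((n : ℝ) ^ (-(5 / 4) : ℝ) / p n) ^ 4 +
    Real.exp (-(9 / 20 * Real.log n))
  have hh : Tendsto h atTop (𝓝 0) := by
    have h1 := (hlower.tendsto_div_nhds_zero.pow 4).const_mul (Real.exp 6)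
    have h2 : Tendsto (fun n : ℕ => Real.exp (-(9 / 20 * Real.log n))) atTop (𝓝 0) :=
      Real.tendsto_exp_neg_atTop_nhds_zero.comp (hlog.const_mul_atTop (by norm_num))
    simpa using h1.add h2
  let g : ℕ → ℝ := fun n => 4 * (100000 * h n + 5 * (Real.log n / n)) + 10 ^ 30 / Real.log n
  have hg : Tendsto g atTop (𝓝 0) := by
    have h1 := ((hh.const_mul 100000).add (hlogn.const_mul 5)).const_mul 4
    have h2 : Tendsto (fun n : ℕ => (10 : ℝ) ^ 30 / Real.log n) atTop (𝓝 0) :=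
      tendsto_const_nhds.div_atTop hlog
    simpa using h1.add h2
  refine tendsto_of_tendsto_of_tendsto_of_le_of_le' tendsto_const_nhds hg ?_ ?_
  · exact Eventually.of_forall fun n => pr_nonneg (p n).2.1 (p n).2.2
  have hh1 : ∀ᶠ n in atTop, 200000 * h n < 1 := by
    have := hh.const_mul 200000
    rw [mul_zero] at this
    exact this.eventually_lt_const one_pos
  have hlog1 : ∀ᶠ n : ℕ in atTop, Real.log n / n < 1 / 10 :=
    hlogn.eventually_lt_const (by norm_num)
  have hlow := hlower.bound one_pos
  filter_upwards [hh1, hlog1, hlow, hupper, hlog.eventually_ge_atTop 20000,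
    eventually_ge_atTop 8] with n hh1 hln hlow hup hl20 hn8
  have hn0 : (0 : ℝ) < n := by positivity
  set l := Real.log n with hl
  have hl0 : 0 < l := by linarith
  have hp0 : 0 < (p n : ℝ) := by
    rw [one_mul, Real.norm_of_nonneg (by positivity), Real.norm_of_nonneg (p n).2.1] at hlow
    exact lt_of_lt_of_le (by positivity) hlow
  have hh0 : 0 ≤ h n := by
    have := Real.exp_pos (-(9 / 20 * Real.log n))
    positivity
  by_cases hc : n * (p n : ℝ) ≤ l / 10
  · have hpow : ((n : ℝ) ^ (-(5 / 4) : ℝ) / p n) ^ 4 = 1 / (n * (n * (p n : ℝ)) ^ 4) := by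
      rw [div_pow, ← Real.rpow_natCast, ← Real.rpow_mul hn0.le]
      norm_num
      field_simp
    have h1 := pr_reconstructible_le_of_sparse (V := Fin n) (h := h n) hp0 rfl rfl
      (by simpa using hc) (by simpa using hn8) (by simpa using hln.le)
      (by simp only [h, hpow, Fintype.card_fin]; ring) hh1
    rw [Fintype.card_fin] at h1
    refine h1.trans (le_add_of_nonneg_right (by positivity))
  · push Not at hc
    -- The fourth power of the upper bound on p, with 81 = 3⁴.
    have h4 : 81 * (n * (p n : ℝ)) ^ 4 ≤ n * l := by
      have h1 := pow_le_pow_left₀ hp0.le hup 4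
      have h2 : (1 / 3 * (n : ℝ) ^ (-(3 / 4) : ℝ) * l ^ (1 / 4 : ℝ)) ^ 4 = l / (81 * n ^ 3) := by
        rw [mul_pow, mul_pow, ← Real.rpow_natCast, ← Real.rpow_natCast, ← Real.rpow_natCast,
          ← Real.rpow_mul hn0.le, ← Real.rpow_mul hl0.le]
        norm_num
        field_simp
      rw [h2, le_div_iff₀ (by positivity)] at h1
      have h3 := mul_le_mul_of_nonneg_left h1 hn0.le
      calc _ = n * ((p n : ℝ) ^ 4 * (81 * n ^ 3)) := by ring
        _ ≤ _ := h3
    have h1 := pr_reconstructible_le_inv_log (V := Fin n) hp0.le rfl rfl (by simpa using hl20)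
      (by simpa using hc.le) (by simpa using h4)
    rw [Fintype.card_fin] at h1
    refine h1.trans (le_add_of_nonneg_left (by positivity))

end Limit

end Shotgun

theorem theorem4 (p : ℕ → unitInterval)
    (hlower : Asymptotics.IsLittleO Filter.atTop
      (fun n : ℕ => (n : ℝ) ^ (-(5 / 4) : ℝ)) (fun n : ℕ => (p n : ℝ)))
    (hupper : ∀ᶠ n : ℕ in Filter.atTop,
      (p n : ℝ) ≤ 1 / 3 * (n : ℝ) ^ (-(3 / 4) : ℝ) * Real.log n ^ (1 / 4 : ℝ)) :
    Filter.Tendsto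
      (fun n : ℕ => SimpleGraph.binomialRandom (Fin n) (p n)
        {G : SimpleGraph (Fin n) | ¬ Shotgun.Reconstructible 2 G})
      Filter.atTop (nhds 1) := by
  have h := (Shotgun.tendsto_pr_reconstructible p hlower hupper).const_sub 1
  rw [sub_zero] at h
  have h2 := ENNReal.tendsto_ofReal h
  rw [ENNReal.ofReal_one] at h2
  refine h2.congr fun n => ?_
  rw [← Shotgun.pr_not, ← Shotgun.binomialRandom_real (p n) fun G => ¬ Shotgun.Reconstructible 2 G,
    MeasureTheory.ofReal_measureReal]
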